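/- Let $\mathcal{C}$ be a rigid C$^*$-tensor category, i.e. a C$^*$-tensor category with finite direct sums and subobjects that is semisimple, has irreducible tensor unit $\varepsilon$, and in which every object $\alpha$ has a conjugate $\overline{\alpha}$ that is both a left and a right dual. Write $\operatorname{Mor}(\alpha,\beta)$ for the morphisms from $\beta$ to $\alpha$. Let $\operatorname{Irr}(\mathcal{C})$ be the set of isomorphism classes of irreducible objects, let $d(\alpha)=s_\alpha^* s_\alpha$ be the categorical dimension, where $s_\alpha\in\operatorname{Mor}(\alpha\otimes\overline\alpha,\varepsilon)$, $t_\alpha\in\operatorname{Mor}(\overline\alpha\otimes\alpha,\varepsilon)$ is a solution of the conjugate equations that is standard, i.e. $s_\alpha^*(X\otimes 1)s_\alpha=t_\alpha^*(1\otimes X)t_\alpha$ for all $X\in\operatorname{End}(\alpha)$, and let $\operatorname{mult}(\gamma,\alpha)$ be the multiplicity of $\gamma\in\operatorname{Irr}(\mathcal{C})$ in $\alpha$. The fusion $*$-algebra $\mathbb{C}[\mathcal{C}]$ has vector space basis $\operatorname{Irr}(\mathcal{C})$, product $\alpha\beta=\sum_\gamma\operatorname{mult}(\gamma,\alpha\otimes\beta)\,\gamma$,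 unit $\varepsilon$ and involution $\alpha^*=\overline{\alpha}$; an arbitrary object $\alpha$ defines the element $\sum_\gamma \operatorname{mult}(\gamma,\alpha)\,\gamma$ of $\mathbb{C}[\mathcal{C}]$, still denoted $\alpha$. A multiplier on $\mathcal{C}$ is a family of linear maps $\theta_{\alpha,\beta}:\operatorname{End}(\alpha\otimes\beta)\to\operatorname{End}(\alpha\otimes\beta)$, $\alpha,\beta\in\mathcal{C}$, with $\theta_{\alpha_2,\beta_2}(UXV^*)=U\theta_{\alpha_1,\beta_1}(X)V^*$ and $\theta_{\alpha_2\otimes\alpha_1,\beta_1\otimes\beta_2}(1\otimes X\otimes 1)=1\otimes\theta_{\alpha_1,\beta_1}(X)\otimes 1$ for all $X\in\operatorname{End}(\alpha_1\otimes\beta_1)$ and $U,V\in\operatorname{Mor}(\alpha_2,\alpha_1)\otimes\operatorname{Mor}(\beta_2,\beta_1)$. It extends uniquely to linear maps on all spaces $\operatorname{Mor}(\alpha\otimes\beta,\gamma\otimes\delta)$ compatible with composition with morphisms of the form $f\otimes g$, and it is determined by the function $\varphi:\operatorname{Irr}(\mathcal{C})\to\mathbb{C}$ such that it acts on $\operatorname{Mor}(\alpha\otimes\overline\alpha,\varepsilon\otimes\varepsilon)$,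 $\alpha\in\operatorname{Irr}(\mathcal{C})$, as multiplication by $\varphi(\alpha)$. A function $\varphi$ is called a cp-multiplier if it arises in this way from a multiplier all of whose maps $\theta_{\alpha,\beta}$ are completely positive. A $*$-representation $\Theta:\mathbb{C}[\mathcal{C}]\to B(\mathcal{K})$ on a Hilbert space is called admissible if $\alpha\mapsto d(\alpha)^{-1}\langle\Theta(\alpha)\xi,\xi\rangle$ is a cp-multiplier for every $\xi\in\mathcal{K}$. Then for each $x\in\mathbb{C}[\mathcal{C}]$ the norms $\|\Theta(x)\|$, with $\Theta$ admissible, are bounded, so that the completion $C_u(\mathcal{C})$ of $\mathbb{C}[\mathcal{C}]$ in a universal admissible $*$-representation is defined; and there is a unique $*$-representation $\Theta_0:\mathbb{C}[\mathcal{C}]\to B(\ell^2(\operatorname{Irr}(\mathcal{C})))$ (the regular representation) with $\Theta_0(\alpha)\delta_\beta=\sum_\gamma\operatorname{mult}(\gamma,\alpha\otimes\beta)\,\delta_\gamma$ for all $\alpha,\beta\in\operatorname{Irr}(\mathcal{C})$, and it is admissible. Let $C_r(\mathcal{C})$ be the norm closure of $\Theta_0(\mathbb{C}[\mathcal{C}])$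 and let $\epsilon:\mathbb{C}[\mathcal{C}]\to\mathbb{C}$ be the trivial representation, the linear map with $\epsilon(\alpha)=d(\alpha)$ for $\alpha\in\operatorname{Irr}(\mathcal{C})$. The following conditions are equivalent. 1. $\mathcal{C}$ is amenable: there is a net of finitely supported cp-multipliers $\varphi_n:\operatorname{Irr}(\mathcal{C})\to\mathbb{C}$ that converges to $1$ pointwise. 2. The natural $*$-homomorphism $C_u(\mathcal{C})\to C_r(\mathcal{C})$ is an isomorphism. 3. $|\epsilon(x)|\le\|\Theta_0(x)\|$ for all $x\in\mathbb{C}[\mathcal{C}]$. 4. $\|\Theta_0(\alpha)\|=d(\alpha)$ for all objects $\alpha\in\mathcal{C}$. -/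

import Mathlib

open CategoryTheory MonoidalCategory
open scoped ENNReal

universe v u

noncomputable section

/-- A C*-tensor category: a `ℂ`-linear monoidal category (with `ℂ`-bilinear tensor product of
morphisms) whose morphism spaces are Banach spaces, with an antilinear, involutive, contravariant
operation `dagger` that is the identity on objects, such that the C*-identity holds, `f* f` is a
positive element of the endomorphism algebra, tensoring is compatible with `dagger` and the
structure isomorphisms are unitary. With Mathlib's order of composition, the operator product
`g f` is `f ≫ g`; so `f* f` is `f ≫ dagger f`. -/
class CStarTensorCategory (C : Type u) [Category.{v} C] [Preadditive C] [Linear ℂ C]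
    [MonoidalCategory C] [MonoidalPreadditive C] [MonoidalLinear ℂ C] where
  /-- The adjoint of a morphism. -/
  dagger : ∀ {X Y : C}, (X ⟶ Y) → (Y ⟶ X)
  dagger_dagger : ∀ {X Y : C} (f : X ⟶ Y), dagger (dagger f) = f
  dagger_id : ∀ X : C, dagger (𝟙 X) = 𝟙 X
  dagger_comp : ∀ {X Y Z : C} (f : X ⟶ Y) (g : Y ⟶ Z), dagger (f ≫ g) = dagger g ≫ dagger f
  dagger_add : ∀ {X Y : C} (f g : X ⟶ Y), dagger (f + g) = dagger f + dagger g
  dagger_smul : ∀ {X Y : C} (c : ℂ) (f : X ⟶ Y), dagger (c • f) = star c • dagger f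
  /-- The norm on morphism spaces. -/
  homNorm : ∀ X Y : C, AddGroupNorm (X ⟶ Y)
  homNorm_smul : ∀ {X Y : C} (c : ℂ) (f : X ⟶ Y), homNorm X Y (c • f) = ‖c‖ * homNorm X Y f
  homNorm_complete : ∀ {X Y : C} (f : ℕ → (X ⟶ Y)),
    (∀ r : ℝ, 0 < r → ∃ N, ∀ m ≥ N, ∀ n ≥ N, homNorm X Y (f m - f n) < r) →
      ∃ g : X ⟶ Y, ∀ r : ℝ, 0 < r → ∃ N, ∀ n ≥ N, homNorm X Y (f n - g) < r
  homNorm_comp_le : ∀ {X Y Z : C} (f : X ⟶ Y) (g : Y ⟶ Z),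
    homNorm X Z (f ≫ g) ≤ homNorm X Y f * homNorm Y Z g
  homNorm_comp_dagger : ∀ {X Y : C} (f : X ⟶ Y),
    homNorm X X (f ≫ dagger f) = homNorm X Y f ^ 2
  comp_dagger_positive : ∀ {X Y : C} (f : X ⟶ Y), ∃ g : X ⟶ X, f ≫ dagger f = g ≫ dagger g
  dagger_tensor : ∀ {X₁ Y₁ X₂ Y₂ : C} (f : X₁ ⟶ Y₁) (g : X₂ ⟶ Y₂),
    dagger (f ⊗ₘ g) = dagger f ⊗ₘ dagger g
  dagger_associator : ∀ X Y Z : C, dagger (α_ X Y Z).hom = (α_ X Y Z).inv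
  dagger_leftUnitor : ∀ X : C, dagger (λ_ X).hom = (λ_ X).inv
  dagger_rightUnitor : ∀ X : C, dagger (ρ_ X).hom = (ρ_ X).inv

namespace CStarTensor

open CStarTensorCategory

section Basic

variable {C : Type u} [Category.{v} C] [Preadditive C] [Linear ℂ C]

/-- An object is irreducible if its endomorphism algebra is `ℂ`. -/
def IsIrreducible (X : C) : Prop := Module.finrank ℂ (X ⟶ X) = 1

end Basic

end CStarTensor

open CStarTensorCategory in
/-- A rigid C*-tensor category: a C*-tensor category with (unitary) finite direct sums and
subobjects, that is semisimple, with irreducible tensor unit, and such that every object has a dual.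
The two morphisms of `ExactPairing X Y` are `s : 𝟙 ⟶ X ⊗ Y` and `t* : Y ⊗ X ⟶ 𝟙`, where
`(s, t)` solves the conjugate equations; taking adjoints, `Y` is both a left and a right dual. -/
class RigidCStarTensorCategory (C : Type u) [Category.{v} C] [Preadditive C] [Linear ℂ C]
    [MonoidalCategory C] [MonoidalPreadditive C] [MonoidalLinear ℂ C]
    [CStarTensorCategory C] : Prop where
  exists_directSum : ∀ X Y : C, ∃ (Z : C) (p : X ⟶ Z) (q : Y ⟶ Z),
    p ≫ dagger p = 𝟙 X ∧ q ≫ dagger q = 𝟙 Y ∧ p ≫ dagger q = 0 ∧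
      dagger p ≫ p + dagger q ≫ q = 𝟙 Z
  exists_subobject : ∀ (X : C) (e : X ⟶ X), e ≫ e = e → dagger e = e →
    ∃ (Y : C) (p : Y ⟶ X), p ≫ dagger p = 𝟙 Y ∧ dagger p ≫ p = e
  semisimple : ∀ X : C, ∃ (n : ℕ) (S : Fin n → C) (p : ∀ i, S i ⟶ X),
    (∀ i, CStarTensor.IsIrreducible (S i)) ∧ (∀ i, p i ≫ dagger (p i) = 𝟙 (S i)) ∧
      (∀ i j, i ≠ j → p i ≫ dagger (p j) = 0) ∧ ∑ i, dagger (p i) ≫ p i = 𝟙 X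
  unit_irreducible : CStarTensor.IsIrreducible (𝟙_ C)
  exists_dual : ∀ X : C, ∃ Y : C, Nonempty (ExactPairing X Y)

namespace CStarTensor

open CStarTensorCategory

section Irr

variable (C : Type u) [Category.{v} C] [Preadditive C] [Linear ℂ C]

/-- Isomorphism of irreducible objects. -/
def irrSetoid : Setoid {X : C // IsIrreducible X} where
  r X Y := Nonempty (X.1 ≅ Y.1)
  iseqv := ⟨fun X => ⟨Iso.refl X.1⟩, fun ⟨e⟩ => ⟨e.symm⟩, fun ⟨e⟩ ⟨f⟩ => ⟨e.trans f⟩⟩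

/-- The set of isomorphism classes of irreducible objects. -/
def Irr : Type u := Quotient (irrSetoid C)

variable {C}

/-- The class of an irreducible object. -/
def Irr.mk (X : C) (hX : IsIrreducible X) : Irr C := Quotient.mk (irrSetoid C) ⟨X, hX⟩

/-- A representative of a class. -/
def Irr.obj (a : Irr C) : C := (Quotient.out (s := irrSetoid C) a).1

theorem Irr.obj_irreducible (a : Irr C) : IsIrreducible a.obj :=
  (Quotient.out (s := irrSetoid C) a).2

theorem Irr.eq_mk_of_iso (a : Irr C) {X : C} (hX : IsIrreducible X) (e : a.obj ≅ X) :
    a = Irr.mk X hX := by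
  have h : Quotient.mk (irrSetoid C) (Quotient.out (s := irrSetoid C) a) = Irr.mk X hX :=
    Quotient.sound (s := irrSetoid C) ⟨e⟩
  exact (Quotient.out_eq (s := irrSetoid C) a).symm.trans h

/-- The multiplicity of an irreducible object in an arbitrary object. -/
def mult (c : Irr C) (X : C) : ℕ := Module.finrank ℂ (c.obj ⟶ X)

theorem IsIrreducible.id_ne_zero {X : C} (hX : IsIrreducible X) : 𝟙 X ≠ 0 := by
  intro h
  have : Subsingleton (X ⟶ X) :=
    ⟨fun f g => by rw [← Category.comp_id f, ← Category.comp_id g, h]; simp⟩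
  have h0 : Module.finrank ℂ (X ⟶ X) = 0 := Module.finrank_zero_of_subsingleton
  rw [IsIrreducible, h0] at hX
  exact zero_ne_one hX

theorem IsIrreducible.exists_smul_id {X : C} (hX : IsIrreducible X) (f : X ⟶ X) :
    ∃ c : ℂ, f = c • 𝟙 X := by
  obtain ⟨c, hc⟩ := (finrank_eq_one_iff_of_nonzero' (𝟙 X) hX.id_ne_zero).1 hX f
  exact ⟨c, hc.symm⟩

end Irr

section Main

variable {C : Type u} [Category.{v} C] [Preadditive C] [Linear ℂ C]
  [MonoidalCategory C] [MonoidalPreadditive C] [MonoidalLinear ℂ C] [CStarTensorCategory C]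

/-- Schur's lemma. -/
theorem IsIrreducible.nonempty_iso {X Y : C} (hX : IsIrreducible X) (hY : IsIrreducible Y)
    (f : X ⟶ Y) (hf : f ≠ 0) : Nonempty (X ≅ Y) := by
  obtain ⟨a, ha⟩ := hX.exists_smul_id (f ≫ dagger f)
  obtain ⟨b, hb⟩ := hY.exists_smul_id (dagger f ≫ f)
  have h1 : a • f = b • f := by
    have h := Category.assoc f (dagger f) f
    rw [ha, hb] at h
    simpa using h
  have ha0 : a ≠ 0 := by
    rintro rfl
    have h := homNorm_comp_dagger f
    rw [ha, zero_smul, map_zero] at h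
    exact hf (eq_zero_of_map_eq_zero (homNorm X Y) (pow_eq_zero_iff two_ne_zero |>.1 h.symm))
  have hab : a = b := by
    by_contra hne
    have h2 : (a - b) • f = 0 := by rw [sub_smul, h1, sub_self]
    apply hf
    rw [← one_smul ℂ f, ← inv_mul_cancel₀ (sub_ne_zero.2 hne), mul_smul, h2, smul_zero]
  refine ⟨⟨f, a⁻¹ • dagger f, ?_, ?_⟩⟩
  · rw [Linear.comp_smul, ha, smul_smul, inv_mul_cancel₀ ha0, one_smul]
  · rw [Linear.smul_comp, hb, ← hab, smul_smul, inv_mul_cancel₀ ha0, one_smul]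

variable [RigidCStarTensorCategory C]

theorem mult_support_finite (X : C) :
    (Function.support fun c : Irr C => (mult c X : ℂ)).Finite := by
  obtain ⟨n, S, p, hS, -, -, hp⟩ := RigidCStarTensorCategory.semisimple X
  refine (Set.finite_range fun i => Irr.mk (S i) (hS i)).subset ?_
  intro c hc
  have hc' : Module.finrank ℂ (c.obj ⟶ X) ≠ 0 := by simpa [mult] using hc
  have : Nontrivial (c.obj ⟶ X) := Module.nontrivial_of_finrank_pos (Nat.pos_of_ne_zero hc')
  obtain ⟨f, hf⟩ := exists_ne (0 : c.obj ⟶ X)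
  have : ∃ i, f ≫ dagger (p i) ≠ 0 := by
    by_contra! h
    apply hf
    rw [← Category.comp_id f, ← hp, Preadditive.comp_sum]
    refine Finset.sum_eq_zero fun i _ => ?_
    rw [← Category.assoc, h i, Limits.zero_comp]
  obtain ⟨i, hi⟩ := this
  obtain ⟨e⟩ := c.obj_irreducible.nonempty_iso (hS i) _ hi
  exact ⟨i, (c.eq_mk_of_iso (hS i) e).symm⟩

variable (C)

/-- The underlying vector space of the fusion *-algebra `ℂ[C]`, with basis `Irr C`. -/
def FusionAlgebra : Type u := Irr C →₀ ℂ

instance : AddCommGroup (FusionAlgebra C) := inferInstanceAs (AddCommGroup (Irr C →₀ ℂ))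

instance : Module ℂ (FusionAlgebra C) := inferInstanceAs (Module ℂ (Irr C →₀ ℂ))

variable {C}

/-- The basis element of the fusion algebra given by a class of irreducible objects. -/
def basisElt (a : Irr C) : FusionAlgebra C := Finsupp.single a (1 : ℂ)

/-- The element `∑ γ, mult(γ, X) γ` of the fusion algebra given by an arbitrary object `X`. -/
def objClass (X : C) : FusionAlgebra C :=
  Finsupp.ofSupportFinite (fun c : Irr C => (mult c X : ℂ)) (mult_support_finite X)

/-- A choice of dual (conjugate) object. -/
def conj (X : C) : C := (RigidCStarTensorCategory.exists_dual X).choose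

/-- The product of the fusion algebra: bilinear, with `α β = ∑ γ, mult(γ, α ⊗ β) γ`. -/
instance : Mul (FusionAlgebra C) where
  mul x y := Finsupp.sum (show Irr C →₀ ℂ from x) fun a r =>
    Finsupp.sum (show Irr C →₀ ℂ from y) fun b r' => (r * r') • objClass (a.obj ⊗ b.obj)

/-- The unit of the fusion algebra: the class of the tensor unit. -/
instance : One (FusionAlgebra C) where
  one := basisElt (Irr.mk (𝟙_ C) RigidCStarTensorCategory.unit_irreducible)

/-- The involution of the fusion algebra: antilinear, sending `α` to its conjugate. -/
instance : Star (FusionAlgebra C) where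
  star x := Finsupp.sum (show Irr C →₀ ℂ from x) fun a r => star r • objClass (conj a.obj)

/-- `p`, that is `s = η_ X Y : 𝟙 ⟶ X ⊗ Y` and `t = (ε_ X Y)* : 𝟙 ⟶ Y ⊗ X`, is a standard solution
of the conjugate equations: `s* (f ⊗ 1) s = t* (1 ⊗ f) t` for all endomorphisms `f` of `X`. -/
def IsStandard {X Y : C} (p : ExactPairing X Y) : Prop :=
  ∀ f : X ⟶ X,
    p.coevaluation' ≫ f ▷ Y ≫ dagger p.coevaluation' =
      dagger p.evaluation' ≫ Y ◁ f ≫ p.evaluation'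

/-- The categorical dimension `d(X)`: the number `s* s`, for any standard solution `(s, t)` of the
conjugate equations for `X` (the value does not depend on the choice). -/
def catDim (X : C) : ℝ :=
  Classical.epsilon fun r : ℝ => ∃ (Y : C) (p : ExactPairing X Y), IsStandard p ∧
    p.coevaluation' ≫ dagger p.coevaluation' = (r : ℂ) • 𝟙 (𝟙_ C)

/-- For `T ∈ End(X₁ ⊗ Y₁)`, the endomorphism `1 ⊗ T ⊗ 1` of `(X₂ ⊗ X₁) ⊗ (Y₁ ⊗ Y₂)`. -/
def amplify (X₂ Y₂ : C) {X₁ Y₁ : C} (T : X₁ ⊗ Y₁ ⟶ X₁ ⊗ Y₁) :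
    (X₂ ⊗ X₁) ⊗ (Y₁ ⊗ Y₂) ⟶ (X₂ ⊗ X₁) ⊗ (Y₁ ⊗ Y₂) :=
  (α_ X₂ X₁ (Y₁ ⊗ Y₂)).hom ≫
    X₂ ◁ ((α_ X₁ Y₁ Y₂).inv ≫ T ▷ Y₂ ≫ (α_ X₁ Y₁ Y₂).hom) ≫ (α_ X₂ X₁ (Y₁ ⊗ Y₂)).inv

variable (C)

/-- A multiplier on `C`. By linearity it suffices to require the first compatibility for elementary
tensors `f ⊗ g`, `h ⊗ k`. -/
structure Multiplier where
  map : ∀ X Y : C, (X ⊗ Y ⟶ X ⊗ Y) →ₗ[ℂ] (X ⊗ Y ⟶ X ⊗ Y)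
  map_comp : ∀ {X₁ X₂ Y₁ Y₂ : C} (f : X₁ ⟶ X₂) (g : Y₁ ⟶ Y₂) (h : X₂ ⟶ X₁) (k : Y₂ ⟶ Y₁)
    (T : X₁ ⊗ Y₁ ⟶ X₁ ⊗ Y₁),
    map X₂ Y₂ ((h ⊗ₘ k) ≫ T ≫ (f ⊗ₘ g)) = (h ⊗ₘ k) ≫ map X₁ Y₁ T ≫ (f ⊗ₘ g)
  map_amplify : ∀ {X₁ Y₁ : C} (X₂ Y₂ : C) (T : X₁ ⊗ Y₁ ⟶ X₁ ⊗ Y₁),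
    map (X₂ ⊗ X₁) (Y₁ ⊗ Y₂) (amplify X₂ Y₂ T) = amplify X₂ Y₂ (map X₁ Y₁ T)

variable {C}

/-- A linear map `θ` on `End(Z)` is completely positive: for all `n` and every `n × n` matrix `a`
over `End(Z)`, the matrix obtained by applying `θ` entrywise to `a* a` is of the form `b* b`. -/
def IsCompletelyPositive {Z : C} (θ : (Z ⟶ Z) →ₗ[ℂ] (Z ⟶ Z)) : Prop :=
  ∀ (n : ℕ) (a : Fin n → Fin n → (Z ⟶ Z)), ∃ b : Fin n → Fin n → (Z ⟶ Z),
    ∀ i j, θ (∑ k, a k j ≫ dagger (a k i)) = ∑ k, b k j ≫ dagger (b k i)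

/-- The multiplier is of positive type. -/
def Multiplier.IsPositiveType (θ : Multiplier C) : Prop :=
  ∀ X Y : C, IsCompletelyPositive (θ.map X Y)

/-- An extension of a multiplier to all morphism spaces `Z ⊗ W ⟶ X ⊗ Y` (it exists and is unique). -/
structure Multiplier.Extension (θ : Multiplier C) where
  map : ∀ X Y Z W : C, (Z ⊗ W ⟶ X ⊗ Y) →ₗ[ℂ] (Z ⊗ W ⟶ X ⊗ Y)
  map_self : ∀ X Y : C, map X Y X Y = θ.map X Y
  map_comp : ∀ {X₁ X₂ Y₁ Y₂ Z₁ Z₂ W₁ W₂ : C} (f : X₁ ⟶ X₂) (g : Y₁ ⟶ Y₂)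
    (h : Z₂ ⟶ Z₁) (k : W₂ ⟶ W₁) (T : Z₁ ⊗ W₁ ⟶ X₁ ⊗ Y₁),
    map X₂ Y₂ Z₂ W₂ ((h ⊗ₘ k) ≫ T ≫ (f ⊗ₘ g)) = (h ⊗ₘ k) ≫ map X₁ Y₁ Z₁ W₁ T ≫ (f ⊗ₘ g)

/-- The multiplier `θ` is the one given by the function `φ` on `Irr C`: for irreducible `X` with
conjugate `Y`, it acts on the morphisms `𝟙 ⊗ 𝟙 ⟶ X ⊗ Y` as multiplication by `φ(X)`. -/
def Multiplier.HasSymbol (θ : Multiplier C) (φ : Irr C → ℂ) : Prop :=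
  ∃ E : θ.Extension, ∀ (X Y : C) (hX : IsIrreducible X) (_ : ExactPairing X Y)
    (w : 𝟙_ C ⊗ 𝟙_ C ⟶ X ⊗ Y), E.map X Y (𝟙_ C) (𝟙_ C) w = φ (Irr.mk X hX) • w

/-- The function `φ : Irr C → ℂ` is a cp-multiplier. -/
def IsCpMultiplier (φ : Irr C → ℂ) : Prop :=
  ∃ θ : Multiplier C, θ.HasSymbol φ ∧ θ.IsPositiveType

variable (C)

/-- Amenability: there is a net of finitely supported cp-multipliers converging to `1` pointwise. -/
def IsAmenable : Prop :=
  ∃ (ι : Type u) (_ : Preorder ι) (_ : IsDirectedOrder ι) (_ : Nonempty ι) (φ : ι → Irr C → ℂ),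
    (∀ i, (Function.support (φ i)).Finite ∧ IsCpMultiplier (φ i)) ∧
      ∀ a : Irr C, Filter.Tendsto (fun i => φ i a) Filter.atTop (nhds 1)

/-- A *-representation of the fusion *-algebra on a Hilbert space. -/
structure StarRep (K : Type*) [NormedAddCommGroup K] [InnerProductSpace ℂ K] [CompleteSpace K]
    extends FusionAlgebra C →ₗ[ℂ] (K →L[ℂ] K) where
  map_one' : toFun 1 = 1
  map_mul' : ∀ x y, toFun (x * y) = toFun x * toFun y
  map_star' : ∀ x, toFun (star x) = star (toFun x)

variable {C}

instance {K : Type*} [NormedAddCommGroup K] [InnerProductSpace ℂ K] [CompleteSpace K] :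
    CoeFun (StarRep C K) fun _ => FusionAlgebra C → (K →L[ℂ] K) := ⟨fun Θ => Θ.toFun⟩

/-- Admissibility: all functions `α ↦ d(α)⁻¹ ⟨Θ(α) ξ, ξ⟩` are cp-multipliers (Mathlib's inner product
is linear in the second variable). -/
def StarRep.IsAdmissible {K : Type*} [NormedAddCommGroup K] [InnerProductSpace ℂ K]
    [CompleteSpace K] (Θ : StarRep C K) : Prop :=
  ∀ ξ : K, IsCpMultiplier fun a : Irr C =>
    ((catDim a.obj : ℝ) : ℂ)⁻¹ * inner ℂ ξ (Θ (basisElt a) ξ)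

/-- The *-algebra `Θ(ℂ[C])`. -/
def StarRep.range {K : Type*} [NormedAddCommGroup K] [InnerProductSpace ℂ K]
    [CompleteSpace K] (Θ : StarRep C K) : StarSubalgebra ℂ (K →L[ℂ] K) where
  carrier := Set.range Θ
  mul_mem' := by
    rintro _ _ ⟨x, rfl⟩ ⟨y, rfl⟩
    exact ⟨x * y, Θ.map_mul' x y⟩
  add_mem' := by
    rintro _ _ ⟨x, rfl⟩ ⟨y, rfl⟩
    exact ⟨x + y, Θ.map_add' x y⟩
  algebraMap_mem' r := ⟨r • 1, by
    rw [Algebra.algebraMap_eq_smul_one, ← Θ.map_one']; exact Θ.map_smul' r 1⟩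
  star_mem' := by
    rintro _ ⟨x, rfl⟩
    exact ⟨star x, Θ.map_star' x⟩

/-- The C*-algebra generated by a *-representation, the norm closure of `Θ(ℂ[C])`. -/
abbrev StarRep.cstar {K : Type*} [NormedAddCommGroup K] [InnerProductSpace ℂ K]
    [CompleteSpace K] (Θ : StarRep C K) : StarSubalgebra ℂ (K →L[ℂ] K) :=
  Θ.range.topologicalClosure

variable (C)

/-- The collection of all admissible *-representations on nonzero Hilbert spaces in the universe of
the objects of `C`. Cyclic representations are separated completions of `ℂ[C]`, so up to unitary
equivalence every cyclic admissible representation occurs here. -/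
structure AdmissibleRep where
  K : Type u
  [normedAddCommGroup : NormedAddCommGroup K]
  [innerProductSpace : InnerProductSpace ℂ K]
  [completeSpace : CompleteSpace K]
  [nontrivial : Nontrivial K]
  rep : StarRep C K
  admissible : rep.IsAdmissible

attribute [instance] AdmissibleRep.normedAddCommGroup AdmissibleRep.innerProductSpace
  AdmissibleRep.completeSpace AdmissibleRep.nontrivial

/-- The C*-algebra of bounded families of operators, acting diagonally on the direct sum of the
Hilbert spaces of all admissible *-representations. -/
abbrev AdmissibleRep.Prod : Type (u + 1) := lp (fun π : AdmissibleRep C => π.K →L[ℂ] π.K) ∞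

/-- The image of `ℂ[C]` under the universal admissible *-representation `x ↦ (π(x))_π`, where `π`
runs over all admissible *-representations. -/
def universalRange : StarSubalgebra ℂ (AdmissibleRep.Prod C) where
  carrier := {T | ∃ x : FusionAlgebra C, ∀ π : AdmissibleRep C, T π = π.rep x}
  mul_mem' := by
    rintro S T ⟨x, hx⟩ ⟨y, hy⟩
    refine ⟨x * y, fun π => ?_⟩
    rw [lp.infty_coeFn_mul, Pi.mul_apply, hx, hy]
    exact (π.rep.map_mul' x y).symm
  add_mem' := by
    rintro S T ⟨x, hx⟩ ⟨y, hy⟩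
    refine ⟨x + y, fun π => ?_⟩
    rw [lp.coeFn_add, Pi.add_apply, hx, hy]
    exact (π.rep.map_add' x y).symm
  algebraMap_mem' r := ⟨r • 1, fun π => by
    rw [Algebra.algebraMap_eq_smul_one, lp.coeFn_smul, lp.infty_coeFn_one, Pi.smul_apply,
      Pi.one_apply, ← π.rep.map_one']
    exact (π.rep.map_smul' r 1).symm⟩
  star_mem' := by
    rintro T ⟨x, hx⟩
    refine ⟨star x, fun π => ?_⟩
    rw [lp.star_apply, hx]
    exact (π.rep.map_star' x).symm

/-- The universal C*-algebra `C_u(C)`: the completion of `ℂ[C]` in the universal admissible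
*-representation. -/
abbrev universalCStar : StarSubalgebra ℂ (AdmissibleRep.Prod C) :=
  (universalRange C).topologicalClosure

variable {C}

/-- Evaluation at one admissible *-representation. -/
def evalHom (π : AdmissibleRep C) : AdmissibleRep.Prod C →⋆ₐ[ℂ] (π.K →L[ℂ] π.K) where
  toFun T := T π
  map_one' := by rw [lp.infty_coeFn_one, Pi.one_apply]
  map_mul' S T := by rw [lp.infty_coeFn_mul, Pi.mul_apply]
  map_zero' := by rw [lp.coeFn_zero, Pi.zero_apply]
  map_add' S T := by rw [lp.coeFn_add, Pi.add_apply]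
  commutes' r := by
    rw [Algebra.algebraMap_eq_smul_one, lp.coeFn_smul, lp.infty_coeFn_one, Pi.smul_apply,
      Pi.one_apply, Algebra.algebraMap_eq_smul_one]
  map_star' T := lp.star_apply T π

theorem evalHom_mem (π : AdmissibleRep C) (T : universalCStar C) :
    evalHom π (T : AdmissibleRep.Prod C) ∈ π.rep.cstar := by
  have hcont : Continuous (evalHom π) :=
    (lp.evalCLM ℂ (fun π : AdmissibleRep C => π.K →L[ℂ] π.K) ∞ π).continuous
  have hT : (T : AdmissibleRep.Prod C) ∈ closure (universalRange C : Set (AdmissibleRep.Prod C)) :=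
    T.2
  have hmaps : Set.MapsTo (evalHom π) (universalRange C : Set (AdmissibleRep.Prod C))
      (π.rep.range : Set (π.K →L[ℂ] π.K)) := by
    rintro S ⟨x, hx⟩
    exact ⟨x, (hx π).symm⟩
  exact map_mem_closure hcont hT hmaps

/-- The natural *-homomorphism from `C_u(C)` to the C*-algebra generated by an admissible
*-representation `π`; it maps `(π'(x))_π'` to `π(x)` for `x ∈ ℂ[C]`. -/
def naturalHom (π : AdmissibleRep C) : universalCStar C →⋆ₐ[ℂ] π.rep.cstar :=
  ((evalHom π).comp (universalCStar C).subtype).codRestrict π.rep.cstar (evalHom_mem π)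

variable (C)

/-- The Hilbert space `ℓ²(Irr C)`. -/
abbrev L2Irr : Type u := lp (fun _ : Irr C => ℂ) 2

instance : Nontrivial (L2Irr C) := by
  classical
  refine ⟨lp.single 2 (Irr.mk (𝟙_ C) RigidCStarTensorCategory.unit_irreducible) (1 : ℂ), 0, ?_⟩
  intro h
  have h' := congrArg
    (fun f : L2Irr C => f (Irr.mk (𝟙_ C) RigidCStarTensorCategory.unit_irreducible)) h
  simp at h'

variable {C}

open Classical in
/-- `Θ` is the regular representation: `Θ(α) δ_β = ∑ γ, mult(γ, α ⊗ β) δ_γ`. -/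
def IsRegular (Θ : StarRep C (L2Irr C)) : Prop :=
  ∀ a b c : Irr C,
    Θ (basisElt a) (lp.single 2 b (1 : ℂ)) c = (mult c (a.obj ⊗ b.obj) : ℂ)

/-- The trivial representation `ℂ[C] → ℂ`: linear, with `α ↦ d(α)` for `α ∈ Irr C`. -/
def trivialRep (x : FusionAlgebra C) : ℂ :=
  Finsupp.sum (show Irr C →₀ ℂ from x) fun a r => r * ((catDim a.obj : ℝ) : ℂ)

end Main

end CStarTensor

end

/-! A trace formula connects cp-multipliers with the fusion algebra. Let s be the coevaluation of a
standard pairing of `A` with `B`, and bend y : `A ⊗ B ⟶ T` into a coaction `k : A ⟶ T ⊗ A`. For the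
multiplier θ with symbol φ, `symbolMap_bend` evaluates s* θ(y* y) s as the sum over irreducible a of
φ(a) d(a) Tr(f ↦ k*(1 ⊗ f)(k ⊗ 1)), the trace being taken on the morphisms `A ⊗ a ⟶ A`. By Frobenius
reciprocity, θ is completely positive exactly when all these numbers are nonnegative
(`isCpMultiplier_of_symbolForm_nonneg`, `IsCpMultiplier.symbolForm_nonneg`). Suitable choices of φ,
k or y then give three facts; here ω_φ is the functional a ↦ d(a) φ(a) on the fusion algebra.

Coefficients of the regular representation at finitely supported vectors are cp-multipliers:
Frobenius reciprocity turns the sum over a into a combination of traces on the spaces of morphisms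
`A ⊗ c ⟶ A ⊗ b`, and this is a Gram form (`isCpMultiplier_regularCoeff`).

The projection 1 - d(X)⁻¹ s s* gives ω_φ(X̄ X) ≤ d(X)² φ(ε) (`IsCpMultiplier.symbolFunctional_le`).
Applied to matrix coefficients, this bounds the image of an irreducible a by d(a), both in the
regular representation, which is thereby defined on ℓ², and in every admissible one.

An endomorphism of a direct sum of irreducible objects, viewed as a coaction with trivial `T`, gives
ω_φ(x* x) ≥ 0 (`IsCpMultiplier.symbolFunctional_nonneg`).

1 ⇒ 2: a finitely supported cp-multiplier has a functional that is a vector functional of the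
regular representation, so it is positive and bounded on C_r. Products of cp-multipliers are
cp-multipliers; multiplying the coefficients of an admissible π by the net and passing to the limit
yields ‖π(x)‖ ≤ ‖Θ₀(x)‖. 2 ⇒ 3: the trivial representation has constant coefficients, hence is
admissible and dominated by the universal norm. 3 ⇒ 4: ε(X) = d(X) is a lower bound for ‖Θ₀(X)‖ and
admissibility gives the upper bound. 4 ⇒ 1: for a finite set F, the sum X of the unit and of F has
the largest possible norm 1 + ∑ d(a). By strict convexity an almost norming vector ζ satisfies ⟨aζ,
ζ⟩ ≈ d(a) for a in F, so its coefficients are finitely supported cp-multipliers close to 1 on F. -/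

set_option linter.unusedSectionVars false

noncomputable section

namespace CStarTensor

open CStarTensorCategory
open scoped ComplexOrder

/-! ### Traces of linear maps without bases. -/

section LinearAlgebra

/-- The trace of an endomorphism computed with a frame. -/
theorem trace_eq_sum_of_frame {V ι : Type*} [AddCommGroup V] [Module ℂ V] [Fintype ι]
    [Module.Finite ℂ V] (e : ι → V) (ε : ι → V →ₗ[ℂ] ℂ) (h : ∀ x, ∑ i, ε i x • e i = x)
    (L : V →ₗ[ℂ] V) : LinearMap.trace ℂ V L = ∑ i, ε i (L (e i)) := by
  have hL : L = ∑ i, dualTensorHom ℂ V V (ε i ⊗ₜ L (e i)) := by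
    ext x
    conv_lhs => rw [← h x]
    simp [dualTensorHom_apply]
  conv_lhs => rw [hL]
  rw [map_sum]
  refine Finset.sum_congr rfl fun i _ => ?_
  rw [LinearMap.trace_eq_contract_apply, contractLeft_apply]

/-- Additivity of the trace along a decomposition of the underlying space. -/
theorem trace_eq_sum_trace {V ι : Type*} {W : ι → Type*} [AddCommGroup V] [Module ℂ V]
    [Module.Finite ℂ V] [∀ i, AddCommGroup (W i)] [∀ i, Module ℂ (W i)]
    [∀ i, Module.Finite ℂ (W i)] [Fintype ι] (A : ∀ i, W i →ₗ[ℂ] V) (B : ∀ i, V →ₗ[ℂ] W i)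
    (hAB : ∀ x, ∑ i, A i (B i x) = x) (hBA : ∀ i y, B i (A i y) = y)
    (M : V →ₗ[ℂ] V) (N : ∀ i, W i →ₗ[ℂ] W i) (hM : ∀ i x, B i (M x) = N i (B i x)) :
    LinearMap.trace ℂ V M = ∑ i, LinearMap.trace ℂ (W i) (N i) := by
  have h1 : M = ∑ i, (A i) ∘ₗ (B i ∘ₗ M) := by
    ext x
    simp [hAB]
  conv_lhs => rw [h1]
  rw [map_sum]
  refine Finset.sum_congr rfl fun i _ => ?_
  rw [LinearMap.trace_comp_comm']
  congr 1
  ext y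
  simp [hM, hBA]

end LinearAlgebra

/-! ### Endomorphisms of irreducible objects as scalars. -/

section Scalar

variable {C : Type u} [Category.{v} C] [Preadditive C] [Linear ℂ C]

theorem IsIrreducible.smul_id_injective {X : C} (hX : IsIrreducible X) {a b : ℂ}
    (h : a • 𝟙 X = b • 𝟙 X) : a = b := by
  by_contra hne
  have h2 : (a - b) • 𝟙 X = 0 := by rw [sub_smul, h, sub_self]
  rcases smul_eq_zero.1 h2 with h3 | h3
  · exact hne (sub_eq_zero.1 h3)
  · exact hX.id_ne_zero h3

theorem IsIrreducible.choose_spec {X : C} (hX : IsIrreducible X) {a : ℂ} {f : X ⟶ X}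
    (h : f = a • 𝟙 X) : (hX.exists_smul_id f).choose = a :=
  hX.smul_id_injective ((hX.exists_smul_id f).choose_spec.symm.trans h)

/-- The identification of the endomorphisms of an irreducible object with `ℂ`. -/
def IsIrreducible.scalar {X : C} (hX : IsIrreducible X) : (X ⟶ X) →ₗ[ℂ] ℂ where
  toFun f := (hX.exists_smul_id f).choose
  map_add' f g := hX.choose_spec (by
    rw [add_smul, ← (hX.exists_smul_id f).choose_spec, ← (hX.exists_smul_id g).choose_spec])
  map_smul' c f := hX.choose_spec (by
    rw [RingHom.id_apply, smul_eq_mul, mul_smul, ← (hX.exists_smul_id f).choose_spec])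

theorem IsIrreducible.scalar_spec {X : C} (hX : IsIrreducible X) (f : X ⟶ X) :
    f = hX.scalar f • 𝟙 X := (hX.exists_smul_id f).choose_spec

theorem IsIrreducible.scalar_eq {X : C} (hX : IsIrreducible X) {a : ℂ} {f : X ⟶ X}
    (h : f = a • 𝟙 X) : hX.scalar f = a := hX.choose_spec h

@[simp] theorem IsIrreducible.scalar_id {X : C} (hX : IsIrreducible X) : hX.scalar (𝟙 X) = 1 :=
  hX.scalar_eq (one_smul ℂ _).symm

theorem IsIrreducible.scalar_comp {X : C} (hX : IsIrreducible X) (f g : X ⟶ X) :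
    hX.scalar (f ≫ g) = hX.scalar f * hX.scalar g := by
  refine hX.scalar_eq ?_
  conv_lhs => rw [hX.scalar_spec f, hX.scalar_spec g]
  simp [smul_smul, mul_comm]

/-- The two bracketings of `f ≫ g ≫ f` multiply `f` by one scalar or by the other. -/
theorem IsIrreducible.scalar_comp_comm {X Y : C} (hX : IsIrreducible X) (hY : IsIrreducible Y)
    (f : X ⟶ Y) (g : Y ⟶ X) : hX.scalar (f ≫ g) = hY.scalar (g ≫ f) := by
  by_cases hf : f = 0
  · simp [hf]
  have h := Category.assoc f g f
  rw [hX.scalar_spec (f ≫ g), hY.scalar_spec (g ≫ f)] at h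
  simp only [Linear.smul_comp, Category.id_comp, Linear.comp_smul, Category.comp_id] at h
  by_contra hne
  have h2 : (hX.scalar (f ≫ g) - hY.scalar (g ≫ f)) • f = 0 := by rw [sub_smul, h, sub_self]
  rcases smul_eq_zero.1 h2 with h3 | h3
  · exact hne (sub_eq_zero.1 h3)
  · exact hf h3

end Scalar

/-! ### The adjoint, positivity and unitaries between irreducible objects. -/

section Dagger

variable {C : Type u} [Category.{v} C] [Preadditive C] [Linear ℂ C]
  [MonoidalCategory C] [MonoidalPreadditive C] [MonoidalLinear ℂ C] [CStarTensorCategory C]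

attribute [simp] dagger_dagger dagger_id dagger_comp dagger_add dagger_smul dagger_tensor
  dagger_associator dagger_leftUnitor dagger_rightUnitor

/-- The adjoint as an additive map. -/
def daggerHom (X Y : C) : (X ⟶ Y) →+ (Y ⟶ X) := AddMonoidHom.mk' dagger dagger_add

@[simp] theorem dagger_zero (X Y : C) : dagger (0 : X ⟶ Y) = 0 := (daggerHom X Y).map_zero

@[simp] theorem dagger_sub {X Y : C} (f g : X ⟶ Y) : dagger (f - g) = dagger f - dagger g :=
  (daggerHom X Y).map_sub f g

@[simp] theorem dagger_sum {X Y : C} {ι : Type*} (s : Finset ι) (f : ι → (X ⟶ Y)) :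
    dagger (∑ i ∈ s, f i) = ∑ i ∈ s, dagger (f i) := map_sum (daggerHom X Y) f s

@[simp] theorem dagger_whiskerRight {X Y : C} (f : X ⟶ Y) (Z : C) :
    dagger (f ▷ Z) = dagger f ▷ Z := by
  rw [← tensorHom_id, dagger_tensor, dagger_id, tensorHom_id]

@[simp] theorem dagger_whiskerLeft {X Y : C} (Z : C) (f : X ⟶ Y) :
    dagger (Z ◁ f) = Z ◁ dagger f := by
  rw [← id_tensorHom, dagger_tensor, dagger_id, id_tensorHom]

@[simp] theorem dagger_associator_inv (X Y Z : C) : dagger (α_ X Y Z).inv = (α_ X Y Z).hom := by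
  rw [← dagger_associator, dagger_dagger]

@[simp] theorem dagger_leftUnitor_inv (X : C) : dagger (λ_ X).inv = (λ_ X).hom := by
  rw [← dagger_leftUnitor, dagger_dagger]

@[simp] theorem dagger_rightUnitor_inv (X : C) : dagger (ρ_ X).inv = (ρ_ X).hom := by
  rw [← dagger_rightUnitor, dagger_dagger]

theorem dagger_injective {X Y : C} {f g : X ⟶ Y} (h : dagger f = dagger g) : f = g := by
  rw [← dagger_dagger f, h, dagger_dagger]

theorem eq_zero_of_comp_dagger_eq_zero {X Y : C} {f : X ⟶ Y} (h : f ≫ dagger f = 0) : f = 0 := by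
  have h1 := homNorm_comp_dagger f
  rw [h, map_zero] at h1
  exact eq_zero_of_map_eq_zero (homNorm X Y) (pow_eq_zero_iff two_ne_zero |>.1 h1.symm)

theorem eq_zero_of_dagger_comp_eq_zero {X Y : C} {f : X ⟶ Y} (h : dagger f ≫ f = 0) : f = 0 := by
  have : dagger f = 0 := eq_zero_of_comp_dagger_eq_zero (by rwa [dagger_dagger])
  rw [← dagger_dagger f, this, dagger_zero]


theorem IsIrreducible.scalar_dagger {X : C} (hX : IsIrreducible X) (f : X ⟶ X) :
    hX.scalar (dagger f) = star (hX.scalar f) := by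
  refine hX.scalar_eq ?_
  conv_lhs => rw [hX.scalar_spec f]
  simp

theorem IsIrreducible.scalar_comp_dagger_nonneg {X Y : C} (hX : IsIrreducible X) (f : X ⟶ Y) :
    0 ≤ hX.scalar (f ≫ dagger f) := by
  obtain ⟨g, hg⟩ := comp_dagger_positive f
  rw [hg, hX.scalar_comp, hX.scalar_dagger]
  exact mul_star_self_nonneg _

theorem IsIrreducible.eq_zero_of_scalar {X Y : C} (hX : IsIrreducible X) {f : X ⟶ Y}
    (h : hX.scalar (f ≫ dagger f) = 0) : f = 0 :=
  eq_zero_of_comp_dagger_eq_zero (by rw [hX.scalar_spec (f ≫ _), h, zero_smul])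

theorem IsIrreducible.scalar_comp_dagger_pos {X Y : C} (hX : IsIrreducible X) {f : X ⟶ Y}
    (h : f ≠ 0) : 0 < hX.scalar (f ≫ dagger f) :=
  lt_of_le_of_ne (hX.scalar_comp_dagger_nonneg f) fun h0 => h (hX.eq_zero_of_scalar h0.symm)

theorem Irr.hom_eq_zero {a b : Irr C} (h : a ≠ b) (f : a.obj ⟶ b.obj) : f = 0 := by
  by_contra hf
  obtain ⟨e⟩ := a.obj_irreducible.nonempty_iso b.obj_irreducible f hf
  refine h ((a.eq_mk_of_iso b.obj_irreducible e).trans ?_)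
  exact (b.eq_mk_of_iso b.obj_irreducible (Iso.refl _)).symm

theorem Irr.mk_obj (a : Irr C) : Irr.mk a.obj a.obj_irreducible = a :=
  (a.eq_mk_of_iso a.obj_irreducible (Iso.refl _)).symm

theorem Irr.mk_eq_of_hom_ne_zero (a : Irr C) {X : C} (hX : IsIrreducible X) {f : a.obj ⟶ X}
    (hf : f ≠ 0) : a = Irr.mk X hX := by
  obtain ⟨e⟩ := a.obj_irreducible.nonempty_iso hX f hf
  exact a.eq_mk_of_iso hX e

/-- A unitary isomorphism from the chosen representative of a class. -/
theorem Irr.exists_unitary {X : C} (hX : IsIrreducible X) :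
    ∃ w : (Irr.mk X hX).obj ⟶ X, w ≫ dagger w = 𝟙 _ ∧ dagger w ≫ w = 𝟙 X := by
  have h : Nonempty ((Irr.mk X hX).obj ≅ X) :=
    Quotient.exact (s := irrSetoid C) (Quotient.out_eq (s := irrSetoid C) (Irr.mk X hX))
  obtain ⟨e⟩ := h
  set a := Irr.mk X hX
  have he : e.hom ≠ 0 := by
    intro h0
    apply a.obj_irreducible.id_ne_zero
    rw [← e.hom_inv_id, h0, Limits.zero_comp]
  have hpos := a.obj_irreducible.scalar_comp_dagger_pos he
  set r := a.obj_irreducible.scalar (e.hom ≫ dagger e.hom) with hr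
  have hrr : ((r.re : ℝ) : ℂ) = r := by
    have := (Complex.nonneg_iff.1 hpos.le).2
    apply Complex.ext <;> simp [← this]
  have hre : 0 < r.re := (Complex.pos_iff.1 hpos).1
  -- The composites of `e.hom` with its adjoint in both orders are the same positive scalar `r`, so
  -- dividing by its square root makes `e.hom` unitary.
  let q : ℂ := ((Real.sqrt r.re)⁻¹ : ℝ)
  have hq : q * star q * r = 1 := by
    rw [← hrr]
    simp only [q, Complex.star_def, Complex.conj_ofReal]
    rw [← Complex.ofReal_mul, ← Complex.ofReal_mul, ← mul_inv, Real.mul_self_sqrt hre.le,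
      inv_mul_cancel₀ hre.ne', Complex.ofReal_one]
  have h1 : e.hom ≫ dagger e.hom = r • 𝟙 _ := a.obj_irreducible.scalar_spec _
  have h2 : dagger e.hom ≫ e.hom = r • 𝟙 _ := by
    rw [hr, a.obj_irreducible.scalar_comp_comm hX]
    exact hX.scalar_spec _
  refine ⟨q • e.hom, ?_, ?_⟩
  · simp only [dagger_smul, Linear.comp_smul, Linear.smul_comp, h1, smul_smul]
    rw [show star q * (q * r) = 1 by rw [← hq]; ring, one_smul]
  · simp only [dagger_smul, Linear.comp_smul, Linear.smul_comp, h2, smul_smul]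
    rw [show q * (star q * r) = 1 by rw [← hq]; ring, one_smul]

open Classical in
/-- The canonical morphism between chosen representatives: the identity if the classes agree, and
zero otherwise. -/
def Irr.cmp (a b : Irr C) : a.obj ⟶ b.obj := if h : a = b then eqToHom (by rw [h]) else 0

@[simp] theorem Irr.cmp_self (a : Irr C) : a.cmp a = 𝟙 _ := by simp [Irr.cmp]

theorem Irr.cmp_of_ne {a b : Irr C} (h : a ≠ b) : a.cmp b = 0 := by simp [Irr.cmp, h]

end Dagger

/-! ### Orthogonal decompositions, finite-dimensionality of morphism spaces and finite direct sums.
-/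

section Decomposition

variable {C : Type u} [Category.{v} C] [Preadditive C] [Linear ℂ C]
  [MonoidalCategory C] [MonoidalPreadditive C] [MonoidalLinear ℂ C] [CStarTensorCategory C]

/-- An orthogonal decomposition of an object into the chosen irreducible objects. -/
structure IrrDecomp (X : C) where
  n : ℕ
  c : Fin n → Irr C
  v : ∀ i, (c i).obj ⟶ X
  v_self : ∀ i, v i ≫ dagger (v i) = 𝟙 _
  v_orth : ∀ i j, i ≠ j → v i ≫ dagger (v j) = 0
  complete : ∑ i, dagger (v i) ≫ v i = 𝟙 X

variable [RigidCStarTensorCategory C]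

theorem nonempty_irrDecomp (X : C) : Nonempty (IrrDecomp X) := by
  obtain ⟨n, S, p, hS, h1, h2, h3⟩ := RigidCStarTensorCategory.semisimple X
  choose w hw hw' using fun i => Irr.exists_unitary (hS i)
  refine ⟨⟨n, fun i => Irr.mk (S i) (hS i), fun i => w i ≫ p i, fun i => ?_, fun i j hij => ?_, ?_⟩⟩
  · rw [dagger_comp, Category.assoc, ← Category.assoc (p i), h1, Category.id_comp, hw]
  · rw [dagger_comp, Category.assoc, ← Category.assoc (p i), h2 i j hij, Limits.zero_comp,
      Limits.comp_zero]
  · rw [← h3]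
    refine Finset.sum_congr rfl fun i _ => ?_
    rw [dagger_comp, Category.assoc, ← Category.assoc (dagger (w i)), hw', Category.id_comp]

/-- A chosen decomposition into irreducible objects. -/
def irrDecomp (X : C) : IrrDecomp X := (nonempty_irrDecomp X).some

namespace IrrDecomp

variable {X Y : C}

/-- The frame of the morphisms from `a` given by a decomposition. -/
def frame (D : IrrDecomp X) (a : Irr C) (i : Fin D.n) : a.obj ⟶ X := a.cmp (D.c i) ≫ D.v i

/-- The frame is indexed by all summands and vanishes at those of another class. It is thus not a
basis, but it computes traces over one index set common to all `a`. -/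
theorem frame_expand (D : IrrDecomp X) {a : Irr C} (f : a.obj ⟶ X) :
    ∑ i, a.obj_irreducible.scalar (f ≫ dagger (D.frame a i)) • D.frame a i = f := by
  conv_rhs => rw [← Category.comp_id f, ← D.complete, Preadditive.comp_sum]
  refine Finset.sum_congr rfl fun i _ => ?_
  by_cases h : a = D.c i
  · subst h
    simp only [frame, Irr.cmp_self, Category.id_comp]
    conv_rhs => rw [← Category.assoc, (D.c i).obj_irreducible.scalar_spec (f ≫ dagger (D.v i))]
    simp
  · rw [← Category.assoc, Irr.hom_eq_zero h (f ≫ _)]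
    simp [frame, Irr.cmp_of_ne h]

open Classical in
theorem scalar_frame (D : IrrDecomp X) (a : Irr C) (i : Fin D.n) :
    a.obj_irreducible.scalar (D.frame a i ≫ dagger (D.frame a i)) = if D.c i = a then 1 else 0 := by
  split_ifs with h
  · subst h
    simp [frame, D.v_self]
  · simp [frame, Irr.cmp_of_ne (Ne.symm h)]

theorem expand (D : IrrDecomp X) (E : IrrDecomp Y) (f : X ⟶ Y) :
    f = ∑ i, ∑ j, dagger (D.v i) ≫ (D.v i ≫ f ≫ dagger (E.v j)) ≫ E.v j := by
  calc f = 𝟙 X ≫ f ≫ 𝟙 Y := by simp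
    _ = _ := by
      rw [← D.complete, ← E.complete]
      simp only [Preadditive.sum_comp, Preadditive.comp_sum, Category.assoc]
      rw [Finset.sum_comm]

theorem expand_cmp (D : IrrDecomp X) (E : IrrDecomp Y) (f : X ⟶ Y) : ∃ m : Fin D.n → Fin E.n → ℂ,
    f = ∑ i, ∑ j, m i j • (dagger (D.v i) ≫ (D.c i).cmp (E.c j) ≫ E.v j) := by
  have h : ∀ i j, ∃ z : ℂ, D.v i ≫ f ≫ dagger (E.v j) = z • (D.c i).cmp (E.c j) := by
    intro i j
    generalize D.v i ≫ f ≫ dagger (E.v j) = g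
    generalize D.c i = a at g
    generalize E.c j = b at g
    by_cases hab : a = b
    · subst hab
      exact ⟨_, by rw [Irr.cmp_self]; exact a.obj_irreducible.scalar_spec g⟩
    · exact ⟨0, by rw [Irr.hom_eq_zero hab g, zero_smul]⟩
  choose m hm using h
  refine ⟨m, ?_⟩
  conv_lhs => rw [expand D E f]
  simp only [hm, Linear.smul_comp, Linear.comp_smul]

end IrrDecomp

/-- Finite-dimensionality is what gives meaning to multiplicities and traces: `Module.finrank` and
`LinearMap.trace` have the default value zero otherwise. -/
instance finite_hom (X Y : C) : Module.Finite ℂ (X ⟶ Y) := by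
  let D := irrDecomp X
  let E := irrDecomp Y
  refine Module.Finite.of_surjective (M := Fin D.n × Fin E.n → ℂ)
    (∑ ij : Fin D.n × Fin E.n, (LinearMap.proj ij : _ →ₗ[ℂ] ℂ).smulRight
      (dagger (D.v ij.1) ≫ (D.c ij.1).cmp (E.c ij.2) ≫ E.v ij.2)) fun f => ?_
  obtain ⟨m, hm⟩ := D.expand_cmp E f
  refine ⟨fun ij => m ij.1 ij.2, ?_⟩
  conv_rhs => rw [hm]
  rw [← Fintype.sum_prod_type']
  simp [LinearMap.sum_apply]

open Classical in
theorem IrrDecomp.mult_eq {X : C} (D : IrrDecomp X) (a : Irr C) :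
    (mult a X : ℂ) = ∑ i, if D.c i = a then 1 else 0 := by
  rw [mult, ← LinearMap.trace_one ℂ (a.obj ⟶ X), trace_eq_sum_of_frame (D.frame a)
    (fun i => a.obj_irreducible.scalar ∘ₗ Linear.rightComp ℂ a.obj (dagger (D.frame a i)))
    (fun f => D.frame_expand f)]
  exact Finset.sum_congr rfl fun i _ => D.scalar_frame a i

theorem IrrDecomp.objClass_eq {X : C} (D : IrrDecomp X) : objClass X = ∑ i, basisElt (D.c i) := by
  classical
  refine Finsupp.ext fun a => ?_
  refine (D.mult_eq a).trans ?_
  rw [show (∑ i, basisElt (D.c i) : FusionAlgebra C)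
    = ∑ i, (Finsupp.single (D.c i) (1 : ℂ) : Irr C →₀ ℂ) from rfl, Finsupp.finsetSum_apply]
  exact Finset.sum_congr rfl fun i _ => by rw [Finsupp.single_apply]

/-- The subobject cut out by the projection `0` of the unit; it starts the induction for finite
direct sums. -/
theorem exists_zero_object : ∃ Z : C, 𝟙 Z = 0 := by
  obtain ⟨Y, p, h1, h2⟩ := RigidCStarTensorCategory.exists_subobject (𝟙_ C) 0 (by simp) (by simp)
  have hp : p = 0 := eq_zero_of_dagger_comp_eq_zero h2
  exact ⟨Y, by rw [← h1, hp, Limits.zero_comp]⟩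

theorem exists_directSum_fin (n : ℕ) (S : Fin n → C) : ∃ (Z : C) (p : ∀ i, S i ⟶ Z),
    (∀ i, p i ≫ dagger (p i) = 𝟙 _) ∧ (∀ i j, i ≠ j → p i ≫ dagger (p j) = 0) ∧
      ∑ i, dagger (p i) ≫ p i = 𝟙 Z := by
  induction n with
  | zero =>
    obtain ⟨Z, hZ⟩ := exists_zero_object (C := C)
    exact ⟨Z, fun i => i.elim0, fun i => i.elim0, fun i => i.elim0, by simp [hZ]⟩
  | succ n ih =>
    obtain ⟨Z, p, h1, h2, h3⟩ := ih fun i => S i.succ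
    obtain ⟨W, q, r, hq, hr, hqr, hs⟩ := RigidCStarTensorCategory.exists_directSum (S 0) Z
    have hrq : r ≫ dagger q = 0 := dagger_injective (by simpa using hqr)
    refine ⟨W, Fin.cases q fun i => p i ≫ r, ?_, ?_, ?_⟩
    · refine Fin.cases hq fun i => ?_
      simp only [Fin.cases_succ, dagger_comp, Category.assoc]
      rw [← Category.assoc r, hr, Category.id_comp, h1]
    · refine Fin.cases (Fin.cases (fun h => absurd rfl h) fun j _ => ?_)
        fun i => Fin.cases (fun _ => ?_) fun j hij => ?_
      · simp only [Fin.cases_succ, Fin.cases_zero, dagger_comp]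
        rw [← Category.assoc, hqr, Limits.zero_comp]
      · simp only [Fin.cases_succ, Fin.cases_zero, Category.assoc]
        rw [hrq, Limits.comp_zero]
      · simp only [Fin.cases_succ, dagger_comp, Category.assoc]
        rw [← Category.assoc r, hr, Category.id_comp, h2 i j fun h => hij (by rw [h])]
    · rw [Fin.sum_univ_succ]
      simp only [Fin.cases_succ, Fin.cases_zero, dagger_comp, Category.assoc]
      rw [← hs]
      congr 1
      calc _ = dagger r ≫ (∑ i, dagger (p i) ≫ p i) ≫ r := by
            simp [Preadditive.sum_comp, Preadditive.comp_sum]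
        _ = dagger r ≫ r := by rw [h3, Category.id_comp]

/-- Finite orthogonal direct sums. -/
theorem exists_directSum_fintype {ι : Type*} [Fintype ι] (S : ι → C) :
    ∃ (Z : C) (p : ∀ i, S i ⟶ Z), (∀ i, p i ≫ dagger (p i) = 𝟙 _) ∧
      (∀ i j, i ≠ j → p i ≫ dagger (p j) = 0) ∧ ∑ i, dagger (p i) ≫ p i = 𝟙 Z := by
  let e := Fintype.equivFin ι
  obtain ⟨Z, p, h1, h2, h3⟩ := exists_directSum_fin _ fun i => S (e.symm i)
  -- The source `S (e.symm (e i))` equals `S i` only propositionally, so the embeddings are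
  -- transported along that equality.
  have key : ∀ i j, e.symm j = i → ∃ q : S i ⟶ Z, HEq q (p j) := by
    rintro i j rfl
    exact ⟨p j, HEq.rfl⟩
  choose q hq using fun i => key i (e i) (e.symm_apply_apply i)
  have hqp : ∀ j, q (e.symm j) = p j := fun j => by
    have := hq (e.symm j)
    rw [e.apply_symm_apply] at this
    exact eq_of_heq this
  refine ⟨Z, q, fun i => ?_, fun i j hij => ?_, ?_⟩
  · obtain ⟨i, rfl⟩ := e.symm.surjective i
    rw [hqp, h1]
  · obtain ⟨i, rfl⟩ := e.symm.surjective i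
    obtain ⟨j, rfl⟩ := e.symm.surjective j
    rw [hqp, hqp, h2 i j fun h => hij (by rw [h])]
  · rw [← h3, ← e.symm.sum_comp]
    exact Finset.sum_congr rfl fun j _ => by rw [hqp]

end Decomposition

/-! ### Mates and zigzags for exact pairings. -/

section Pairings

variable {C : Type u} [Category.{v} C] [MonoidalCategory C]

/-- Mates with respect to two exact pairings. -/
theorem exists_mate {X Y X' Y' : C} (p : ExactPairing X Y) (q : ExactPairing X' Y') (f : X ⟶ X') :
    ∃ g : Y' ⟶ Y, p.coevaluation' ≫ f ▷ Y = q.coevaluation' ≫ X' ◁ g ∧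
      Y' ◁ f ≫ q.evaluation' = g ▷ X ≫ p.evaluation' := by
  let i : HasRightDual X := ⟨Y⟩
  let j : HasRightDual X' := ⟨Y'⟩
  exact ⟨@rightAdjointMate C _ _ X X' i j f, (@coevaluation_comp_rightAdjointMate C _ _ X X' i j f).symm,
    (@rightAdjointMate_comp_evaluation C _ _ X X' i j f).symm⟩

theorem exists_mate' {X Y X' Y' : C} (p : ExactPairing X Y) (q : ExactPairing X' Y') (g : Y' ⟶ Y) :
    ∃ f : X ⟶ X', p.coevaluation' ≫ f ▷ Y = q.coevaluation' ≫ X' ◁ g ∧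
      Y' ◁ f ≫ q.evaluation' = g ▷ X ≫ p.evaluation' := by
  let i : HasLeftDual Y := ⟨X⟩
  let j : HasLeftDual Y' := ⟨X'⟩
  exact ⟨@leftAdjointMate C _ _ Y' Y j i g, (@coevaluation_comp_leftAdjointMate C _ _ Y' Y j i g),
    (@leftAdjointMate_comp_evaluation C _ _ Y' Y j i g)⟩

/-- The zigzag identity recovers `f` from its bent form. -/
theorem coevaluation_whiskerRight_injective {X Y Z : C} (p : ExactPairing X Y) {f g : X ⟶ Z}
    (h : p.coevaluation' ≫ f ▷ Y = p.coevaluation' ≫ g ▷ Y) : f = g := by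
  have key : ∀ f : X ⟶ Z, (λ_ X).inv ≫ (p.coevaluation' ≫ f ▷ Y) ▷ X ≫ (α_ _ _ _).hom ≫
      Z ◁ p.evaluation' ≫ (ρ_ Z).hom = f := by
    intro f
    have := ExactPairing.evaluation_coevaluation'' X Y
    calc _ = 𝟙 _ ⊗≫ p.coevaluation' ▷ X ⊗≫ (f ▷ (Y ⊗ X) ≫ Z ◁ p.evaluation') ⊗≫ 𝟙 _ := by monoidal
      _ = 𝟙 _ ⊗≫ (η_ X Y ▷ X ⊗≫ X ◁ ε_ X Y) ⊗≫ f := by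
        rw [← whisker_exchange]
        change _ = 𝟙 _ ⊗≫ (p.coevaluation' ▷ X ⊗≫ X ◁ p.evaluation') ⊗≫ f
        monoidal
      _ = f := by rw [this]; monoidal
  rw [← key f, h, key]

theorem coevaluation_whiskerLeft_injective {X Y Z : C} (p : ExactPairing X Y) {f g : Y ⟶ Z}
    (h : p.coevaluation' ≫ X ◁ f = p.coevaluation' ≫ X ◁ g) : f = g := by
  have key : ∀ f : Y ⟶ Z, (ρ_ Y).inv ≫ Y ◁ (p.coevaluation' ≫ X ◁ f) ≫ (α_ _ _ _).inv ≫
      p.evaluation' ▷ Z ≫ (λ_ Z).hom = f := by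
    intro f
    have := ExactPairing.coevaluation_evaluation'' X Y
    calc _ = 𝟙 _ ⊗≫ Y ◁ p.coevaluation' ⊗≫ ((Y ⊗ X) ◁ f ≫ p.evaluation' ▷ Z) ⊗≫ 𝟙 _ := by monoidal
      _ = 𝟙 _ ⊗≫ (Y ◁ η_ X Y ⊗≫ ε_ X Y ▷ Y) ⊗≫ f := by
        rw [whisker_exchange]
        change _ = 𝟙 _ ⊗≫ (Y ◁ p.coevaluation' ⊗≫ p.evaluation' ▷ Y) ⊗≫ f
        monoidal
      _ = f := by rw [this]; monoidal
  rw [← key f, h, key]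

theorem mate_id_inverse {X Y Y₀ : C} (p : ExactPairing X Y) (p₀ : ExactPairing X Y₀)
    {T : Y₀ ⟶ Y} {S : Y ⟶ Y₀} (hT : p.coevaluation' = p₀.coevaluation' ≫ X ◁ T)
    (hS : p₀.coevaluation' = p.coevaluation' ≫ X ◁ S) : T ≫ S = 𝟙 Y₀ ∧ S ≫ T = 𝟙 Y := by
  constructor
  · refine coevaluation_whiskerLeft_injective p₀ ?_
    rw [MonoidalCategory.whiskerLeft_comp, ← Category.assoc, ← hT, ← hS, whiskerLeft_id,
      Category.comp_id]
  · refine coevaluation_whiskerLeft_injective p ?_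
    rw [MonoidalCategory.whiskerLeft_comp, ← Category.assoc, ← hS, ← hT, whiskerLeft_id,
      Category.comp_id]

end Pairings

/-! ### Standard pairings, the categorical trace and the dimension. -/

section Dual

variable {C : Type u} [Category.{v} C] [Preadditive C] [Linear ℂ C]
  [MonoidalCategory C] [MonoidalPreadditive C] [MonoidalLinear ℂ C] [CStarTensorCategory C]

/-- The adjoint of an exact pairing. -/
abbrev daggerPairing {X Y : C} (p : ExactPairing X Y) : ExactPairing Y X where
  coevaluation' := dagger p.evaluation'
  evaluation' := dagger p.coevaluation'
  coevaluation_evaluation' := by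
    have := congrArg dagger p.evaluation_coevaluation'
    simpa using this
  evaluation_coevaluation' := by
    have := congrArg dagger p.coevaluation_evaluation'
    simpa using this

/-- The trace of an endomorphism of `X` closed on the right. -/
def rightTrace {X Y : C} (p : ExactPairing X Y) (f : X ⟶ X) : 𝟙_ C ⟶ 𝟙_ C :=
  p.coevaluation' ≫ f ▷ Y ≫ dagger p.coevaluation'

/-- The trace of an endomorphism of `X` closed on the left. -/
def leftTrace {X Y : C} (p : ExactPairing X Y) (f : X ⟶ X) : 𝟙_ C ⟶ 𝟙_ C :=
  dagger p.evaluation' ≫ Y ◁ f ≫ p.evaluation'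

/-- The partial trace over the second factor. -/
def partialTraceRight {X X' Y' : C} (q : ExactPairing X' Y') (f : X ⊗ X' ⟶ X ⊗ X') : X ⟶ X :=
  (ρ_ X).inv ≫ X ◁ q.coevaluation' ≫ (α_ _ _ _).inv ≫ f ▷ Y' ≫ (α_ _ _ _).hom ≫
    X ◁ dagger q.coevaluation' ≫ (ρ_ X).hom

/-- The partial trace over the first factor. -/
def partialTraceLeft {X Y X' : C} (p : ExactPairing X Y) (f : X ⊗ X' ⟶ X ⊗ X') : X' ⟶ X' :=
  (λ_ X').inv ≫ dagger p.evaluation' ▷ X' ≫ (α_ _ _ _).hom ≫ Y ◁ f ≫ (α_ _ _ _).inv ≫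
    p.evaluation' ▷ X' ≫ (λ_ X').hom

theorem rightTrace_tensor {X Y X' Y' : C} (p : ExactPairing X Y) (q : ExactPairing X' Y')
    (f : X ⊗ X' ⟶ X ⊗ X') :
    rightTrace (@ExactPairing.tensor C _ _ X X' Y Y' p q) f = rightTrace p (partialTraceRight q f) := by
  have h1 : (@ExactPairing.tensor C _ _ X X' Y Y' p q).coevaluation' =
    p.coevaluation' ⊗≫ (X ◁ q.coevaluation') ▷ Y ⊗≫ 𝟙 _ := rfl
  rw [rightTrace, rightTrace, h1, partialTraceRight]
  simp [monoidalComp]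

theorem leftTrace_tensor {X Y X' Y' : C} (p : ExactPairing X Y) (q : ExactPairing X' Y')
    (f : X ⊗ X' ⟶ X ⊗ X') :
    leftTrace (@ExactPairing.tensor C _ _ X X' Y Y' p q) f = leftTrace q (partialTraceLeft p f) := by
  have h1 : (@ExactPairing.tensor C _ _ X X' Y Y' p q).evaluation' =
    𝟙 _ ⊗≫ Y' ◁ (p.evaluation' ▷ X') ⊗≫ q.evaluation' := rfl
  rw [leftTrace, leftTrace, h1, partialTraceLeft]
  simp [monoidalComp]

/-- Both sides close `X` on the left and `X'` on the right; the interchange law lets the two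
closures slide past each other. -/
theorem leftTrace_partialTraceRight {X Y X' Y' : C} (p : ExactPairing X Y) (q : ExactPairing X' Y')
    (f : X ⊗ X' ⟶ X ⊗ X') :
    leftTrace p (partialTraceRight q f) = rightTrace q (partialTraceLeft p f) := by
  rw [leftTrace, rightTrace, partialTraceRight, partialTraceLeft]
  calc _ = 𝟙 _ ⊗≫ (dagger p.evaluation' ▷ 𝟙_ C ≫ (Y ⊗ X) ◁ q.coevaluation') ⊗≫ Y ◁ f ▷ Y' ⊗≫
        ((Y ⊗ X) ◁ dagger q.coevaluation' ≫ p.evaluation' ▷ 𝟙_ C) ⊗≫ 𝟙 _ := by monoidal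
    _ = 𝟙 _ ⊗≫ (𝟙_ C ◁ q.coevaluation' ≫ dagger p.evaluation' ▷ (X' ⊗ Y')) ⊗≫ Y ◁ f ▷ Y' ⊗≫
        (p.evaluation' ▷ (X' ⊗ Y') ≫ 𝟙_ C ◁ dagger q.coevaluation') ⊗≫ 𝟙 _ := by
      rw [whisker_exchange, whisker_exchange]
    _ = _ := by monoidal

/-- The first zigzag of a pairing transported along morphisms. -/
theorem zigzag_left {A A' B B' X Y : C} (η : 𝟙_ C ⟶ A ⊗ A') (ε : B' ⊗ B ⟶ 𝟙_ C) (v : A ⟶ X)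
    (w : A' ⟶ Y) (v' : X ⟶ B) (w' : Y ⟶ B') :
    Y ◁ (η ≫ (v ⊗ₘ w)) ≫ (α_ Y X Y).inv ≫ ((w' ⊗ₘ v') ≫ ε) ▷ Y =
      (ρ_ Y).hom ≫ w' ≫ (ρ_ B').inv ≫ (B' ◁ η ≫ (α_ _ _ _).inv ≫ (B' ◁ (v ≫ v') ≫ ε) ▷ A') ≫
        (λ_ A').hom ≫ w ≫ (λ_ Y).inv := by
  have h1 : Y ◁ (v ⊗ₘ w) ≫ (α_ Y X Y).inv ≫ ((w' ⊗ₘ v') ≫ ε) ▷ Y =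
      w' ▷ (A ⊗ A') ≫ (α_ _ _ _).inv ≫ (B' ◁ (v ≫ v') ≫ ε) ▷ A' ≫ 𝟙_ C ◁ w := by
    rw [← id_tensorHom Y (v ⊗ₘ w), associator_inv_naturality_assoc, ← tensorHom_id _ Y,
      tensorHom_comp_tensorHom, tensorHom_comp_tensorHom_assoc, Category.comp_id, Category.id_comp,
      tensorHom_def (_ ≫ ε), tensorHom_def w']
    simp
  rw [MonoidalCategory.whiskerLeft_comp, Category.assoc, h1, whisker_exchange_assoc]
  simp

/-- The second zigzag of a pairing transported along morphisms. -/
theorem zigzag_right {A A' B B' X Y : C} (η : 𝟙_ C ⟶ A ⊗ A') (ε : B' ⊗ B ⟶ 𝟙_ C) (v : A ⟶ X)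
    (w : A' ⟶ Y) (v' : X ⟶ B) (w' : Y ⟶ B') :
    (η ≫ (v ⊗ₘ w)) ▷ X ≫ (α_ X Y X).hom ≫ X ◁ ((w' ⊗ₘ v') ≫ ε) =
      (λ_ X).hom ≫ v' ≫ (λ_ B).inv ≫ (η ▷ B ≫ (α_ _ _ _).hom ≫ A ◁ ((w ≫ w') ▷ B ≫ ε)) ≫
        (ρ_ A).hom ≫ v ≫ (ρ_ X).inv := by
  have h1 : (v ⊗ₘ w) ▷ X ≫ (α_ X Y X).hom ≫ X ◁ ((w' ⊗ₘ v') ≫ ε) =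
      (A ⊗ A') ◁ v' ≫ (α_ _ _ _).hom ≫ A ◁ ((w ≫ w') ▷ B ≫ ε) ≫ v ▷ 𝟙_ C := by
    rw [← tensorHom_id (v ⊗ₘ w) X, associator_naturality_assoc, ← id_tensorHom X,
      tensorHom_comp_tensorHom, tensorHom_comp_tensorHom_assoc, Category.comp_id, Category.id_comp,
      tensorHom_def' v, tensorHom_def' (w ≫ w')]
    simp
  rw [comp_whiskerRight, Category.assoc, h1, ← whisker_exchange_assoc]
  simp

variable [RigidCStarTensorCategory C]

/-- The trace is moved across one factor at a time: close `X'` on the right, move the closure of `X`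
from right to left by `hp`, exchange the order of the two closures, then move that of `X'` by `hq`.
-/
theorem IsStandard.tensor {X Y X' Y' : C} {p : ExactPairing X Y} {q : ExactPairing X' Y'}
    (hp : IsStandard p) (hq : IsStandard q) :
    IsStandard (@ExactPairing.tensor C _ _ X X' Y Y' p q) := fun f =>
  (rightTrace_tensor p q f).trans <| (hp _).trans <| (leftTrace_partialTraceRight p q f).trans <|
    (hq _).trans (leftTrace_tensor p q f).symm

/-- Every endomorphism of `Y` is the mate of one of `X`, and mates slide around both the
coevaluation and the evaluation. -/
theorem IsStandard.daggerPairing {X Y : C} {p : ExactPairing X Y} (hp : IsStandard p) :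
    IsStandard (CStarTensor.daggerPairing p) := by
  intro g
  obtain ⟨f, h1, h2⟩ := exists_mate' p p g
  change dagger p.evaluation' ≫ g ▷ X ≫ dagger (dagger p.evaluation') =
    dagger (dagger p.coevaluation') ≫ X ◁ g ≫ dagger p.coevaluation'
  rw [dagger_dagger, dagger_dagger]
  have h3 := hp f
  rw [h2, ← Category.assoc, h1, Category.assoc] at h3
  exact h3.symm


/-- A standard pairing exists on every irreducible object. -/
theorem exists_isStandard_of_irreducible {X : C} (hX : IsIrreducible X) :
    ∃ (Y : C) (p : ExactPairing X Y) (r : ℝ), 0 < r ∧ IsStandard p ∧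
      p.coevaluation' ≫ dagger p.coevaluation' = (r : ℂ) • 𝟙 (𝟙_ C) := by
  obtain ⟨Y, ⟨p⟩⟩ := RigidCStarTensorCategory.exists_dual X
  have hu : IsIrreducible (𝟙_ C) := RigidCStarTensorCategory.unit_irreducible
  have hnz : ∀ f : X ⟶ X, (λ_ X).hom ≫ (ρ_ X).inv = 0 → False := by
    intro f h
    apply hX.id_ne_zero
    rw [← Category.comp_id (𝟙 X)]
    have : 𝟙 X = (λ_ X).inv ≫ ((λ_ X).hom ≫ (ρ_ X).inv) ≫ (ρ_ X).hom := by simp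
    rw [this, h]
    simp
  have hc : p.coevaluation' ≠ 0 := by
    intro h
    have := p.evaluation_coevaluation'
    rw [h] at this
    simp only [MonoidalPreadditive.zero_whiskerRight, Limits.zero_comp] at this
    exact hnz (𝟙 X) this.symm
  have he : dagger p.evaluation' ≠ 0 := by
    intro h
    have h' : p.evaluation' = 0 := dagger_injective (by rw [h, dagger_zero])
    have := p.evaluation_coevaluation'
    rw [h'] at this
    simp only [MonoidalPreadditive.whiskerLeft_zero, Limits.comp_zero] at this
    exact hnz (𝟙 X) this.symm
  have ha := hu.scalar_comp_dagger_pos hc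
  have hb := hu.scalar_comp_dagger_pos he
  rw [dagger_dagger] at hb
  obtain ⟨a, ha0, ha'⟩ : ∃ a : ℝ, 0 < a ∧ p.coevaluation' ≫ dagger p.coevaluation' =
      (a : ℂ) • 𝟙 (𝟙_ C) := by
    refine ⟨_, (Complex.pos_iff.1 ha).1, ?_⟩
    conv_lhs => rw [hu.scalar_spec (p.coevaluation' ≫ _)]
    congr 1
    apply Complex.ext <;> simp [← (Complex.pos_iff.1 ha).2]
  obtain ⟨b, hb0, hb'⟩ : ∃ b : ℝ, 0 < b ∧ dagger p.evaluation' ≫ p.evaluation' =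
      (b : ℂ) • 𝟙 (𝟙_ C) := by
    refine ⟨_, (Complex.pos_iff.1 hb).1, ?_⟩
    conv_lhs => rw [hu.scalar_spec (_ ≫ p.evaluation')]
    congr 1
    apply Complex.ext <;> simp [← (Complex.pos_iff.1 hb).2]
  -- Replacing s by l s and t by l⁻¹ t keeps the zigzags and changes s* s = a, t* t = b into l² a,
  -- l⁻² b, which agree when l⁴ = b / a. As all endomorphisms of `X` are scalars, this equality is
  -- standardness.
  let l : ℝ := Real.sqrt (Real.sqrt (b / a))
  have hl2 : l * l = Real.sqrt (b / a) := Real.mul_self_sqrt (Real.sqrt_nonneg _)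
  have hl4 : (l * l) * (l * l) = b / a := by
    rw [hl2]; exact Real.mul_self_sqrt (by positivity)
  have hl0 : 0 < l := Real.sqrt_pos.2 (Real.sqrt_pos.2 (by positivity))
  have hlc : (l : ℂ) ≠ 0 := by exact_mod_cast hl0.ne'
  let q : ExactPairing X Y :=
    { coevaluation' := (l : ℂ) • p.coevaluation'
      evaluation' := (l : ℂ)⁻¹ • p.evaluation'
      coevaluation_evaluation' := by
        simp only [MonoidalLinear.whiskerLeft_smul, MonoidalLinear.smul_whiskerRight,
          Linear.comp_smul, Linear.smul_comp, smul_smul]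
        rw [inv_mul_cancel₀ hlc, one_smul, p.coevaluation_evaluation']
      evaluation_coevaluation' := by
        simp only [MonoidalLinear.whiskerLeft_smul, MonoidalLinear.smul_whiskerRight,
          Linear.comp_smul, Linear.smul_comp, smul_smul]
        rw [inv_mul_cancel₀ hlc, one_smul, p.evaluation_coevaluation'] }
  have hq1 : q.coevaluation' ≫ dagger q.coevaluation' = ((l * l * a : ℝ) : ℂ) • 𝟙 (𝟙_ C) := by
    change ((l : ℂ) • p.coevaluation') ≫ dagger ((l : ℂ) • p.coevaluation') = _
    simp only [dagger_smul, Linear.comp_smul, Linear.smul_comp, ha', smul_smul]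
    congr 1
    simp [mul_assoc]
  have hq2 : dagger q.evaluation' ≫ q.evaluation' = ((l * l * a : ℝ) : ℂ) • 𝟙 (𝟙_ C) := by
    change dagger ((l : ℂ)⁻¹ • p.evaluation') ≫ ((l : ℂ)⁻¹ • p.evaluation') = _
    simp only [dagger_smul, Linear.comp_smul, Linear.smul_comp, hb', smul_smul]
    congr 1
    have h5 : l⁻¹ * (l⁻¹ * b) = l * l * a := by
      field_simp
      field_simp at hl4
      nlinarith [hl4]
    rw [← h5]
    simp
  refine ⟨Y, q, l * l * a, by positivity, fun f => ?_, hq1⟩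
  rw [hX.scalar_spec f]
  simp only [MonoidalLinear.whiskerLeft_smul, MonoidalLinear.smul_whiskerRight,
    Linear.comp_smul, Linear.smul_comp, id_whiskerRight, whiskerLeft_id, Category.id_comp, hq1, hq2]

/-- The dimension of an irreducible object, for a chosen standard pairing. -/
def Irr.dim (a : Irr C) : ℝ :=
  (exists_isStandard_of_irreducible a.obj_irreducible).choose_spec.choose_spec.choose

/-- The dual object of a chosen standard pairing. -/
def Irr.dual (a : Irr C) : C := (exists_isStandard_of_irreducible a.obj_irreducible).choose

/-- A chosen standard pairing. -/
@[reducible] def Irr.pairing (a : Irr C) : ExactPairing a.obj a.dual :=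
  (exists_isStandard_of_irreducible a.obj_irreducible).choose_spec.choose

theorem Irr.dim_pos (a : Irr C) : 0 < a.dim :=
  (exists_isStandard_of_irreducible a.obj_irreducible).choose_spec.choose_spec.choose_spec.1

theorem Irr.pairing_isStandard (a : Irr C) : IsStandard a.pairing :=
  (exists_isStandard_of_irreducible a.obj_irreducible).choose_spec.choose_spec.choose_spec.2.1

theorem Irr.pairing_coevaluation (a : Irr C) :
    a.pairing.coevaluation' ≫ dagger a.pairing.coevaluation' = (a.dim : ℂ) • 𝟙 (𝟙_ C) :=
  (exists_isStandard_of_irreducible a.obj_irreducible).choose_spec.choose_spec.choose_spec.2.2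

theorem Irr.rightTrace_pairing (a : Irr C) (f : a.obj ⟶ a.obj) :
    rightTrace a.pairing f = ((a.dim : ℂ) * a.obj_irreducible.scalar f) • 𝟙 (𝟙_ C) := by
  conv_lhs => rw [a.obj_irreducible.scalar_spec f]
  simp only [rightTrace, MonoidalLinear.smul_whiskerRight, Linear.comp_smul, Linear.smul_comp,
    id_whiskerRight, Category.id_comp, a.pairing_coevaluation, smul_smul]
  rw [mul_comm]

theorem Irr.leftTrace_pairing (a : Irr C) (f : a.obj ⟶ a.obj) :
    leftTrace a.pairing f = ((a.dim : ℂ) * a.obj_irreducible.scalar f) • 𝟙 (𝟙_ C) :=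
  (a.pairing_isStandard f).symm.trans (a.rightTrace_pairing f)

/-- The categorical trace of an endomorphism. -/
def IrrDecomp.tr {X : C} (D : IrrDecomp X) (f : X ⟶ X) : ℂ :=
  ∑ i, ((D.c i).dim : ℂ) * (D.c i).obj_irreducible.scalar (D.v i ≫ f ≫ dagger (D.v i))

theorem Irr.dim_mul_scalar_comm {a b : Irr C} (f : a.obj ⟶ b.obj) (g : b.obj ⟶ a.obj) :
    (a.dim : ℂ) * a.obj_irreducible.scalar (f ≫ g) =
      (b.dim : ℂ) * b.obj_irreducible.scalar (g ≫ f) := by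
  by_cases h : a = b
  · subst h
    rw [a.obj_irreducible.scalar_comp_comm a.obj_irreducible]
  · rw [Irr.hom_eq_zero h f]
    simp

theorem IrrDecomp.tr_comm {X Y : C} (D : IrrDecomp X) (E : IrrDecomp Y) (f : X ⟶ Y) (g : Y ⟶ X) :
    D.tr (f ≫ g) = E.tr (g ≫ f) := by
  have h1 : ∀ i, D.v i ≫ (f ≫ g) ≫ dagger (D.v i) =
      ∑ j, (D.v i ≫ f ≫ dagger (E.v j)) ≫ (E.v j ≫ g ≫ dagger (D.v i)) := by
    intro i
    calc _ = (D.v i ≫ f) ≫ (∑ j, dagger (E.v j) ≫ E.v j) ≫ (g ≫ dagger (D.v i)) := by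
          rw [E.complete]; simp
      _ = _ := by simp [Preadditive.sum_comp, Preadditive.comp_sum]
  have h2 : ∀ j, E.v j ≫ (g ≫ f) ≫ dagger (E.v j) =
      ∑ i, (E.v j ≫ g ≫ dagger (D.v i)) ≫ (D.v i ≫ f ≫ dagger (E.v j)) := by
    intro i
    calc _ = (E.v i ≫ g) ≫ (∑ j, dagger (D.v j) ≫ D.v j) ≫ (f ≫ dagger (E.v i)) := by
          rw [D.complete]; simp
      _ = _ := by simp [Preadditive.sum_comp, Preadditive.comp_sum]
  simp only [IrrDecomp.tr, h1, h2, map_sum, Finset.mul_sum]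
  rw [Finset.sum_comm]
  refine Finset.sum_congr rfl fun j _ => Finset.sum_congr rfl fun i _ => ?_
  exact Irr.dim_mul_scalar_comm _ _

theorem IrrDecomp.tr_sub {X : C} (D : IrrDecomp X) (f g : X ⟶ X) :
    D.tr (f - g) = D.tr f - D.tr g := by
  simp [IrrDecomp.tr, Preadditive.sub_comp, Preadditive.comp_sub, mul_sub, Finset.sum_sub_distrib]

theorem IrrDecomp.tr_neg {X : C} (D : IrrDecomp X) (f : X ⟶ X) : D.tr (-f) = -D.tr f := by
  simp [IrrDecomp.tr, Preadditive.neg_comp, Preadditive.comp_neg]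

theorem IrrDecomp.tr_comp_dagger_nonneg {X Y : C} (D : IrrDecomp X) (f : X ⟶ Y) :
    0 ≤ D.tr (f ≫ dagger f) := by
  refine Finset.sum_nonneg fun i _ => mul_nonneg ?_ ?_
  · exact_mod_cast (D.c i).dim_pos.le
  · have := (D.c i).obj_irreducible.scalar_comp_dagger_nonneg (D.v i ≫ f)
    simpa using this

theorem IrrDecomp.eq_zero_of_tr {X Y : C} (D : IrrDecomp X) {f : X ⟶ Y}
    (h : D.tr (f ≫ dagger f) = 0) : f = 0 := by
  have h1 : ∀ i ∈ Finset.univ, (0 : ℂ) ≤ ((D.c i).dim : ℂ) *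
      (D.c i).obj_irreducible.scalar (D.v i ≫ (f ≫ dagger f) ≫ dagger (D.v i)) := by
    refine fun i _ => mul_nonneg ?_ ?_
    · exact_mod_cast (D.c i).dim_pos.le
    · have := (D.c i).obj_irreducible.scalar_comp_dagger_nonneg (D.v i ≫ f)
      simpa using this
  have h2 := (Finset.sum_eq_zero_iff_of_nonneg h1).1 h
  have h3 : ∀ i, D.v i ≫ f = 0 := by
    intro i
    have h4 := (mul_eq_zero.1 (h2 i (Finset.mem_univ i))).resolve_left
      (by exact_mod_cast (D.c i).dim_pos.ne')
    refine (D.c i).obj_irreducible.eq_zero_of_scalar ?_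
    rw [← h4]
    simp
  rw [← Category.id_comp f, ← D.complete, Preadditive.sum_comp]
  simp [h3]

/-- The direct sum of standard pairings. -/
theorem IrrDecomp.exists_pairing {X : C} (D : IrrDecomp X) : ∃ (Y : C) (p : ExactPairing X Y),
    (∀ f, rightTrace p f = D.tr f • 𝟙 _) ∧ (∀ f, leftTrace p f = D.tr f • 𝟙 _) := by
  classical
  obtain ⟨Y, w, h1, h2, h3⟩ := exists_directSum_fin D.n fun i => (D.c i).dual
  let p : ExactPairing X Y :=
    { coevaluation' := ∑ i, (D.c i).pairing.coevaluation' ≫ (D.v i ⊗ₘ w i)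
      evaluation' := ∑ i, (dagger (w i) ⊗ₘ dagger (D.v i)) ≫ (D.c i).pairing.evaluation'
      coevaluation_evaluation' := by
        simp only [whiskerLeft_sum, sum_whiskerRight, Preadditive.sum_comp, Preadditive.comp_sum,
          zigzag_left]
        -- Cross terms vanish by orthogonality of the `D.v i`, diagonal terms are zigzags of the
        -- irreducible pairings, and completeness of the `w i` assembles them into the identity.
        rw [Finset.sum_congr rfl fun i _ => Finset.sum_eq_single i
          (fun j _ hj => by rw [D.v_orth j i hj]; simp) (by simp)]
        simp only [D.v_self, whiskerLeft_id, Category.id_comp]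
        simp only [(D.c _).pairing.coevaluation_evaluation']
        simp only [Category.assoc, Iso.inv_hom_id_assoc]
        rw [← Preadditive.comp_sum]
        simp only [← Category.assoc]
        rw [← Preadditive.sum_comp, h3]
        simp
      evaluation_coevaluation' := by
        simp only [whiskerLeft_sum, sum_whiskerRight, Preadditive.sum_comp, Preadditive.comp_sum,
          zigzag_right]
        rw [Finset.sum_congr rfl fun i _ => Finset.sum_eq_single i
          (fun j _ hj => by rw [h2 j i hj]; simp) (by simp)]
        simp only [h1, id_whiskerRight, Category.id_comp]
        simp only [(D.c _).pairing.evaluation_coevaluation']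
        simp only [Category.assoc, Iso.inv_hom_id_assoc]
        rw [← Preadditive.comp_sum]
        simp only [← Category.assoc]
        rw [← Preadditive.sum_comp, D.complete]
        simp }
  refine ⟨Y, p, fun f => ?_, fun f => ?_⟩
  · have hp : rightTrace p f = (∑ i, (D.c i).pairing.coevaluation' ≫ (D.v i ⊗ₘ w i)) ≫ f ▷ Y ≫
      dagger (∑ i, (D.c i).pairing.coevaluation' ≫ (D.v i ⊗ₘ w i)) := rfl
    rw [hp, dagger_sum]
    simp only [Preadditive.sum_comp, Preadditive.comp_sum, dagger_comp, dagger_tensor,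
      Category.assoc]
    have key : ∀ i j, (D.v i ⊗ₘ w i) ≫ f ▷ Y ≫ (dagger (D.v j) ⊗ₘ dagger (w j)) =
        (D.v i ≫ f ≫ dagger (D.v j)) ⊗ₘ (w i ≫ dagger (w j)) := by
      intro i j
      rw [← tensorHom_id, tensorHom_comp_tensorHom, tensorHom_comp_tensorHom, Category.id_comp]
    simp only [reassoc_of% key]
    rw [Finset.sum_congr rfl fun i _ => Finset.sum_eq_single i
      (fun j _ hj => by rw [h2 j i hj]; simp [MonoidalCategory.tensorHom_def]) (by simp)]
    simp only [h1, tensorHom_id]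
    rw [IrrDecomp.tr, Finset.sum_smul]
    exact Finset.sum_congr rfl fun i _ => (D.c i).rightTrace_pairing _
  · have hp : leftTrace p f =
      dagger (∑ i, (dagger (w i) ⊗ₘ dagger (D.v i)) ≫ (D.c i).pairing.evaluation') ≫ Y ◁ f ≫
      (∑ i, (dagger (w i) ⊗ₘ dagger (D.v i)) ≫ (D.c i).pairing.evaluation') := rfl
    rw [hp, dagger_sum]
    simp only [Preadditive.sum_comp, Preadditive.comp_sum, dagger_comp, dagger_tensor,
      Category.assoc, dagger_dagger]
    have key : ∀ i j, (w i ⊗ₘ D.v i) ≫ Y ◁ f ≫ (dagger (w j) ⊗ₘ dagger (D.v j)) =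
        (w i ≫ dagger (w j)) ⊗ₘ (D.v i ≫ f ≫ dagger (D.v j)) := by
      intro i j
      rw [← id_tensorHom, tensorHom_comp_tensorHom, tensorHom_comp_tensorHom, Category.id_comp]
    simp only [reassoc_of% key]
    rw [Finset.sum_congr rfl fun i _ => Finset.sum_eq_single i
      (fun j _ hj => by rw [h2 j i hj]; simp [MonoidalCategory.tensorHom_def]) (by simp)]
    simp only [h1, id_tensorHom]
    rw [IrrDecomp.tr, Finset.sum_smul]
    exact Finset.sum_congr rfl fun i _ => (D.c i).leftTrace_pairing _

theorem rightTrace_comp_dagger {X Y Z : C} (p : ExactPairing X Y) (f : X ⟶ Z) :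
    rightTrace p (f ≫ dagger f) =
      (p.coevaluation' ≫ f ▷ Y) ≫ dagger (p.coevaluation' ≫ f ▷ Y) := by
  simp [rightTrace]

/-- The trace given by any standard pairing is the categorical trace. -/
theorem IsStandard.rightTrace_eq {X Y : C} {p : ExactPairing X Y} (hp : IsStandard p)
    (D : IrrDecomp X) (f : X ⟶ X) : rightTrace p f = D.tr f • 𝟙 _ := by
  obtain ⟨Y₀, p₀, hr, hl⟩ := D.exists_pairing
  have hu : IsIrreducible (𝟙_ C) := RigidCStarTensorCategory.unit_irreducible
  -- The pairing `p` differs from the tracial pairing `p₀` by an isomorphism `T` of the duals. With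
  -- `m` and `n` the mates of `T ≫ dagger T` and of its inverse, the right and left traces of `p`
  -- are x ↦ Tr(m x) and x ↦ Tr(n x). Standardness forces `m = n`, hence `m ≫ m = 𝟙 X`, and
  -- positivity then leaves only `m = 𝟙 X`.
  obtain ⟨T, hT1, hT2⟩ := exists_mate p p₀ (𝟙 X)
  obtain ⟨S, hS1, hS2⟩ := exists_mate p₀ p (𝟙 X)
  simp only [id_whiskerRight, whiskerLeft_id, Category.comp_id, Category.id_comp] at hT1 hT2 hS1 hS2
  obtain ⟨hTS, hST⟩ := mate_id_inverse p p₀ hT1 hS1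
  obtain ⟨m, hm1, hm2⟩ := exists_mate' p₀ p₀ (T ≫ dagger T)
  obtain ⟨n, hn1, hn2⟩ := exists_mate' p₀ p₀ (dagger S ≫ S)
  have hmn : m ≫ n = 𝟙 X := by
    refine coevaluation_whiskerRight_injective p₀ ?_
    rw [comp_whiskerRight, ← Category.assoc, hm1, Category.assoc, whisker_exchange,
      ← Category.assoc, hn1, Category.assoc, ← MonoidalCategory.whiskerLeft_comp]
    have : (dagger S ≫ S) ≫ T ≫ dagger T = 𝟙 Y₀ := by
      rw [Category.assoc, ← Category.assoc S, hST, Category.id_comp, ← dagger_comp, hTS, dagger_id]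
    rw [this, whiskerLeft_id, id_whiskerRight]
  have hR : ∀ x, rightTrace p x = D.tr (m ≫ x) • 𝟙 _ := by
    intro x
    rw [← hr, rightTrace, rightTrace, hT1, comp_whiskerRight, ← Category.assoc (p₀.coevaluation'),
      ← Category.assoc (p₀.coevaluation') (m ▷ _), hm1]
    simp [whisker_exchange_assoc]
  have hL : ∀ x, leftTrace p x = D.tr (x ≫ n) • 𝟙 _ := by
    intro x
    rw [← hl, leftTrace, leftTrace, hS2, MonoidalCategory.whiskerLeft_comp, Category.assoc, hn2]
    simp [whisker_exchange_assoc]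
  have hid : ∀ x, D.tr (m ≫ x) = D.tr (n ≫ x) := by
    intro x
    rw [D.tr_comm D n x]
    exact hu.smul_id_injective ((hR x).symm.trans ((hp x).trans (hL x)))
  have hmn' : m = n := by
    refine sub_eq_zero.1 (D.eq_zero_of_tr ?_)
    rw [Preadditive.sub_comp, D.tr_sub, hid, sub_self]
  have hmm : m ≫ m = 𝟙 X := by
    conv_lhs => rw [hmn']
    rw [hmn'] at hmn
    exact hmn
  -- Since `m` acts as -1 on `𝟙 X - m`, the trace of `(𝟙 X - m) ≫ dagger (𝟙 X - m)` is nonnegative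
  -- for `D.tr`, while its negative is a nonnegative value of the right trace of `p`. Hence it
  -- vanishes.
  have hme : m ≫ (𝟙 X - m) = -(𝟙 X - m) := by
    rw [Preadditive.comp_sub, hmm, Category.comp_id, neg_sub]
  have he : 𝟙 X - m = 0 := by
    refine D.eq_zero_of_tr ?_
    have h1 : 0 ≤ D.tr (m ≫ (𝟙 X - m) ≫ dagger (𝟙 X - m)) := by
      have h2 := hR ((𝟙 X - m) ≫ dagger (𝟙 X - m))
      rw [rightTrace_comp_dagger] at h2
      rw [← hu.scalar_eq h2]
      exact hu.scalar_comp_dagger_nonneg _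
    rw [← Category.assoc, hme, Preadditive.neg_comp, D.tr_neg] at h1
    exact le_antisymm (neg_nonneg.1 h1) (D.tr_comp_dagger_nonneg _)
  rw [hR, ← sub_eq_zero.1 he, Category.id_comp]

theorem exists_isStandard (X : C) : ∃ (Y : C) (p : ExactPairing X Y), IsStandard p := by
  obtain ⟨Y, p, hr, hl⟩ := (irrDecomp X).exists_pairing
  exact ⟨Y, p, fun f => (hr f).trans (hl f).symm⟩

theorem IrrDecomp.tr_id {X : C} (D : IrrDecomp X) :
    D.tr (𝟙 X) = ((∑ i, (D.c i).dim : ℝ) : ℂ) := by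
  simp [IrrDecomp.tr, D.v_self]

theorem IsStandard.coevaluation_eq {X Y : C} {p : ExactPairing X Y} (hp : IsStandard p)
    (D : IrrDecomp X) :
    p.coevaluation' ≫ dagger p.coevaluation' = ((∑ i, (D.c i).dim : ℝ) : ℂ) • 𝟙 (𝟙_ C) := by
  rw [← D.tr_id, ← hp.rightTrace_eq D, rightTrace, id_whiskerRight, Category.id_comp]

/-- `catDim` is a choice among admissible values. One standard pairing makes the set of values
nonempty, and `IsStandard.coevaluation_eq` shows that it has a single element. -/
theorem IsStandard.coevaluation_catDim {X Y : C} {p : ExactPairing X Y} (hp : IsStandard p) :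
    p.coevaluation' ≫ dagger p.coevaluation' = (catDim X : ℂ) • 𝟙 (𝟙_ C) := by
  have hu : IsIrreducible (𝟙_ C) := RigidCStarTensorCategory.unit_irreducible
  obtain ⟨Y', p', hp', h'⟩ := Classical.epsilon_spec
    (p := fun r : ℝ => ∃ (Y : C) (p : ExactPairing X Y), IsStandard p ∧
      p.coevaluation' ≫ dagger p.coevaluation' = (r : ℂ) • 𝟙 (𝟙_ C))
    ⟨_, Y, p, hp, hp.coevaluation_eq (irrDecomp X)⟩
  rw [hp.coevaluation_eq (irrDecomp X), ← hp'.coevaluation_eq (irrDecomp X), h']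
  rfl

theorem IsStandard.catDim_eq_of_coevaluation {X Y : C} {p : ExactPairing X Y} (hp : IsStandard p)
    {r : ℝ} (h : p.coevaluation' ≫ dagger p.coevaluation' = (r : ℂ) • 𝟙 (𝟙_ C)) :
    catDim X = r := by
  have hu : IsIrreducible (𝟙_ C) := RigidCStarTensorCategory.unit_irreducible
  exact_mod_cast hu.smul_id_injective (hp.coevaluation_catDim.symm.trans h)

theorem Irr.catDim_obj (a : Irr C) : catDim a.obj = a.dim :=
  a.pairing_isStandard.catDim_eq_of_coevaluation a.pairing_coevaluation

theorem IrrDecomp.catDim_eq {X : C} (D : IrrDecomp X) : catDim X = ∑ i, (D.c i).dim := by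
  obtain ⟨Y, p, hp⟩ := exists_isStandard X
  exact hp.catDim_eq_of_coevaluation (hp.coevaluation_eq D)

theorem catDim_nonneg (X : C) : 0 ≤ catDim X := by
  rw [(irrDecomp X).catDim_eq]
  exact Finset.sum_nonneg fun i _ => (Irr.dim_pos _).le

theorem catDim_tensor (X X' : C) : catDim (X ⊗ X') = catDim X * catDim X' := by
  obtain ⟨Y, p, hp⟩ := exists_isStandard X
  obtain ⟨Y', p', hp'⟩ := exists_isStandard X'
  refine (hp.tensor hp').catDim_eq_of_coevaluation ?_
  have h := rightTrace_tensor p p' (𝟙 _)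
  have h1 : partialTraceRight (X := X) p' (𝟙 (X ⊗ X')) = (catDim X' : ℂ) • 𝟙 X := by
    have h2 : partialTraceRight (X := X) p' (𝟙 (X ⊗ X')) = (ρ_ X).inv ≫
        X ◁ (p'.coevaluation' ≫ dagger p'.coevaluation') ≫ (ρ_ X).hom := by
      simp [partialTraceRight]
    rw [h2, hp'.coevaluation_catDim]
    simp only [MonoidalLinear.whiskerLeft_smul, whiskerLeft_id, Linear.smul_comp, Linear.comp_smul,
      Category.id_comp, Iso.inv_hom_id]
  rw [h1] at h
  simp only [rightTrace, id_whiskerRight, Category.id_comp, MonoidalLinear.smul_whiskerRight,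
    Linear.comp_smul, Linear.smul_comp, hp.coevaluation_catDim, smul_smul] at h
  rw [h]
  push_cast
  rw [mul_comm]

/-- The pairing need not be standard: its dual is isomorphic to that of a standard pairing, the
trace of the identity is invariant under isomorphism, and the adjoint of a standard pairing is
standard. -/
theorem catDim_eq_of_pairing {X Y : C} (p : ExactPairing X Y) : catDim Y = catDim X := by
  obtain ⟨Z, q, hq⟩ := exists_isStandard X
  have hZ : catDim Z = catDim X := by
    refine hq.daggerPairing.catDim_eq_of_coevaluation ?_
    have h := hq (𝟙 X)
    simp only [id_whiskerRight, whiskerLeft_id, Category.id_comp] at h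
    rw [← hq.coevaluation_catDim, h]
    change dagger q.evaluation' ≫ dagger (dagger q.evaluation') = _
    rw [dagger_dagger]
  obtain ⟨T, hT, -⟩ := exists_mate p q (𝟙 X)
  obtain ⟨S, hS, -⟩ := exists_mate q p (𝟙 X)
  simp only [id_whiskerRight, Category.comp_id] at hT hS
  obtain ⟨h1, h2⟩ := mate_id_inverse p q hT hS
  have h3 := (irrDecomp Y).tr_comm (irrDecomp Z) S T
  rw [h1, h2, IrrDecomp.tr_id, IrrDecomp.tr_id, ← IrrDecomp.catDim_eq, ← IrrDecomp.catDim_eq] at h3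
  rw [← hZ]
  exact_mod_cast h3

end Dual

/-! ### The multiplier with a given symbol: existence and uniqueness. -/

section MultiplierOfSymbol

variable {C : Type u} [Category.{v} C] [Preadditive C] [Linear ℂ C]
  [MonoidalCategory C] [MonoidalPreadditive C] [MonoidalLinear ℂ C] [CStarTensorCategory C]
  [RigidCStarTensorCategory C]

/-- The natural endomorphism acting as `φ a` on the `a`-isotypic component of an object. -/
def isotypic (φ : Irr C → ℂ) (X : C) : X ⟶ X :=
  ∑ i, φ ((irrDecomp X).c i) • (dagger ((irrDecomp X).v i) ≫ (irrDecomp X).v i)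

/-- The matrix entries of `f` between summands of different classes vanish; on the others the two
values of `φ` agree. -/
theorem isotypic_naturality (φ : Irr C → ℂ) {X Y : C} (f : X ⟶ Y) :
    f ≫ isotypic φ Y = isotypic φ X ≫ f := by
  set D := irrDecomp X with hD
  set E := irrDecomp Y with hE
  have key : ∀ i j, φ (D.c i) • (D.v i ≫ f ≫ dagger (E.v j)) =
      φ (E.c j) • (D.v i ≫ f ≫ dagger (E.v j)) := by
    intro i j
    by_cases h : D.c i = E.c j
    · exact congrArg (fun a => φ a • (D.v i ≫ f ≫ dagger (E.v j))) h
    · rw [Irr.hom_eq_zero h (D.v i ≫ f ≫ _)]; simp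
  calc f ≫ isotypic φ Y = (∑ i, dagger (D.v i) ≫ D.v i) ≫ f ≫
        (∑ j, φ (E.c j) • (dagger (E.v j) ≫ E.v j)) := by
          rw [D.complete, Category.id_comp, isotypic]
    _ = ∑ i, ∑ j, dagger (D.v i) ≫ (φ (E.c j) • (D.v i ≫ f ≫ dagger (E.v j))) ≫ E.v j := by
          simp only [Preadditive.sum_comp, Preadditive.comp_sum, Category.assoc, Linear.comp_smul,
            Linear.smul_comp, Finset.smul_sum]
          rw [Finset.sum_comm]
    _ = ∑ i, ∑ j, dagger (D.v i) ≫ (φ (D.c i) • (D.v i ≫ f ≫ dagger (E.v j))) ≫ E.v j := by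
          simp only [key]
    _ = (∑ i, φ (D.c i) • (dagger (D.v i) ≫ D.v i)) ≫ f ≫ (∑ j, dagger (E.v j) ≫ E.v j) := by
          simp only [Preadditive.sum_comp, Preadditive.comp_sum, Category.assoc, Linear.comp_smul,
            Linear.smul_comp]
          rw [Finset.sum_comm]
    _ = isotypic φ X ≫ f := by rw [E.complete, Category.comp_id, isotypic]

theorem isotypic_of_irreducible (φ : Irr C → ℂ) {X : C} (hX : IsIrreducible X) :
    isotypic φ X = φ (Irr.mk X hX) • 𝟙 X := by
  rw [isotypic, ← (irrDecomp X).complete, Finset.smul_sum]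
  refine Finset.sum_congr rfl fun i _ => ?_
  have h : (irrDecomp X).v i ≠ 0 := by
    intro h
    have := (irrDecomp X).v_self i
    rw [h, Limits.zero_comp] at this
    exact ((irrDecomp X).c i).obj_irreducible.id_ne_zero this.symm
  exact congrArg (fun a => φ a • (dagger ((irrDecomp X).v i) ≫ (irrDecomp X).v i))
    (((irrDecomp X).c i).mk_eq_of_hom_ne_zero hX h)

/-- The chosen exact pairing between the conjugate of an object and the object. -/
@[reducible] def conjPairing (X : C) : ExactPairing (conj X) X :=
  daggerPairing (RigidCStarTensorCategory.exists_dual X).choose_spec.some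

/-- Evaluation `X ⊗ (conj X ⊗ A) ⟶ A`. -/
def evalConj (X A : C) : X ⊗ (conj X ⊗ A) ⟶ A :=
  (α_ _ _ _).inv ≫ (conjPairing X).evaluation' ▷ A ≫ (λ_ A).hom

/-- Frobenius reciprocity as a linear map. -/
def curryConj (X W A : C) : (X ⊗ W ⟶ A) →ₗ[ℂ] (W ⟶ conj X ⊗ A) where
  toFun f := (λ_ _).inv ≫ (conjPairing X).coevaluation' ▷ _ ≫ (α_ _ _ _).hom ≫ _ ◁ f
  map_add' f g := by simp [MonoidalPreadditive.whiskerLeft_add]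
  map_smul' c f := by simp

theorem curryConj_evalConj {X W A : C} (f : X ⊗ W ⟶ A) :
    X ◁ curryConj X W A f ≫ evalConj X A = f :=
  (@tensorLeftHomEquiv C _ _ W (conj X) X A (conjPairing X)).left_inv f

theorem curryConj_eq {X W A : C} (g : W ⟶ conj X ⊗ A) :
    curryConj X W A (X ◁ g ≫ evalConj X A) = g :=
  (@tensorLeftHomEquiv C _ _ W (conj X) X A (conjPairing X)).right_inv g

theorem evalConj_tensor (Z X Y : C) :
    Z ◁ (α_ (conj Z) X Y).hom ≫ evalConj Z (X ⊗ Y) = (α_ _ _ _).inv ≫ evalConj Z X ▷ Y := by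
  simp [evalConj]

/-- The action of a function on `Irr C` on the morphisms `Z ⊗ W ⟶ X ⊗ Y`. -/
def symbolMap (φ : Irr C → ℂ) (X Y Z W : C) : (Z ⊗ W ⟶ X ⊗ Y) →ₗ[ℂ] (Z ⊗ W ⟶ X ⊗ Y) where
  toFun T := Z ◁ (curryConj Z W (X ⊗ Y) T ≫ (α_ _ _ _).inv ≫ isotypic φ (conj Z ⊗ X) ▷ Y) ≫
    (α_ _ _ _).inv ≫ evalConj Z X ▷ Y
  map_add' S T := by simp [Preadditive.add_comp, MonoidalPreadditive.whiskerLeft_add]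
  map_smul' c T := by simp

theorem exists_factorization {X Y Z W : C} (T : Z ⊗ W ⟶ X ⊗ Y) :
    ∃ (V : C) (h : W ⟶ V ⊗ Y) (e : Z ⊗ V ⟶ X), T = Z ◁ h ≫ (α_ _ _ _).inv ≫ e ▷ Y := by
  refine ⟨conj Z ⊗ X, curryConj Z W (X ⊗ Y) T ≫ (α_ _ _ _).inv, evalConj Z X, ?_⟩
  rw [← evalConj_tensor, ← MonoidalCategory.whiskerLeft_comp_assoc, Category.assoc,
    Iso.inv_hom_id, Category.comp_id, curryConj_evalConj]

/-- The symbol acts on the middle strand `V`, and by naturality of `isotypic` any factorization may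
be used. Every compatibility of `symbolMap` is obtained by exhibiting a convenient one. -/
theorem symbolMap_factorization (φ : Irr C → ℂ) {V X Y Z W : C} (h : W ⟶ V ⊗ Y) (e : Z ⊗ V ⟶ X) :
    symbolMap φ X Y Z W (Z ◁ h ≫ (α_ _ _ _).inv ≫ e ▷ Y) =
      Z ◁ (h ≫ isotypic φ V ▷ Y) ≫ (α_ _ _ _).inv ≫ e ▷ Y := by
  have h1 : Z ◁ h ≫ (α_ _ _ _).inv ≫ e ▷ Y =
      Z ◁ (h ≫ curryConj Z V X e ▷ Y ≫ (α_ _ _ _).hom) ≫ evalConj Z (X ⊗ Y) := by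
    rw [MonoidalCategory.whiskerLeft_comp, MonoidalCategory.whiskerLeft_comp, Category.assoc,
      Category.assoc, evalConj_tensor]
    conv_lhs => rw [← curryConj_evalConj e]
    simp
  change Z ◁ (curryConj Z W (X ⊗ Y) _ ≫ (α_ _ _ _).inv ≫ isotypic φ (conj Z ⊗ X) ▷ Y) ≫
    (α_ _ _ _).inv ≫ evalConj Z X ▷ Y = _
  rw [h1, curryConj_eq]
  conv_rhs => rw [← curryConj_evalConj e]
  simp only [Category.assoc, Iso.hom_inv_id_assoc]
  rw [← comp_whiskerRight, isotypic_naturality]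
  simp

theorem symbolMap_comp (φ : Irr C → ℂ) {X₁ X₂ Y₁ Y₂ Z₁ Z₂ W₁ W₂ : C} (f : X₁ ⟶ X₂) (g : Y₁ ⟶ Y₂)
    (h : Z₂ ⟶ Z₁) (k : W₂ ⟶ W₁) (T : Z₁ ⊗ W₁ ⟶ X₁ ⊗ Y₁) :
    symbolMap φ X₂ Y₂ Z₂ W₂ ((h ⊗ₘ k) ≫ T ≫ (f ⊗ₘ g)) =
      (h ⊗ₘ k) ≫ symbolMap φ X₁ Y₁ Z₁ W₁ T ≫ (f ⊗ₘ g) := by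
  obtain ⟨V, a, e, rfl⟩ := exists_factorization T
  have key : ∀ b : W₁ ⟶ V ⊗ Y₁, (h ⊗ₘ k) ≫ (Z₁ ◁ b ≫ (α_ _ _ _).inv ≫ e ▷ Y₁) ≫ (f ⊗ₘ g) =
      Z₂ ◁ (k ≫ b ≫ V ◁ g) ≫ (α_ _ _ _).inv ≫ (h ▷ V ≫ e ≫ f) ▷ Y₂ := by
    intro b
    calc _ = Z₂ ◁ k ≫ (h ▷ W₁ ≫ Z₁ ◁ b) ⊗≫ e ▷ Y₁ ≫ f ▷ Y₁ ≫ X₂ ◁ g := by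
          rw [MonoidalCategory.tensorHom_def', MonoidalCategory.tensorHom_def f]
          monoidal
      _ = Z₂ ◁ (k ≫ b) ⊗≫ ((h ▷ V ≫ e ≫ f) ▷ Y₁ ≫ X₂ ◁ g) := by
          rw [← whisker_exchange]
          monoidal
      _ = _ := by
          rw [← whisker_exchange]
          monoidal
  rw [key, symbolMap_factorization, symbolMap_factorization, key]
  simp [← whisker_exchange]

theorem symbolMap_amplify (φ : Irr C → ℂ) {X₁ Y₁ : C} (X₂ Y₂ : C) (T : X₁ ⊗ Y₁ ⟶ X₁ ⊗ Y₁) :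
    symbolMap φ _ _ _ _ (amplify X₂ Y₂ T) = amplify X₂ Y₂ (symbolMap φ _ _ _ _ T) := by
  obtain ⟨V, a, e, rfl⟩ := exists_factorization T
  have key : ∀ b : Y₁ ⟶ V ⊗ Y₁, amplify X₂ Y₂ (X₁ ◁ b ≫ (α_ _ _ _).inv ≫ e ▷ Y₁) =
      (X₂ ⊗ X₁) ◁ (b ▷ Y₂ ≫ (α_ _ _ _).hom) ≫ (α_ _ _ _).inv ≫
        ((α_ _ _ _).hom ≫ X₂ ◁ e) ▷ (Y₁ ⊗ Y₂) := by
    intro b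
    rw [amplify]
    monoidal
  rw [key, symbolMap_factorization, symbolMap_factorization, key]
  simp

/-- The multiplier given by a function on `Irr C`. -/
def multiplierOfSymbol (φ : Irr C → ℂ) : Multiplier C where
  map X Y := symbolMap φ X Y X Y
  map_comp f g h k T := symbolMap_comp φ f g h k T
  map_amplify X₂ Y₂ T := symbolMap_amplify φ X₂ Y₂ T

theorem multiplierOfSymbol_hasSymbol (φ : Irr C → ℂ) : (multiplierOfSymbol φ).HasSymbol φ := by
  refine ⟨⟨symbolMap φ, fun _ _ => rfl, fun f g h k T => symbolMap_comp φ f g h k T⟩,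
    fun X Y hX _ w => ?_⟩
  have key : ∀ b : 𝟙_ C ⟶ X ⊗ Y, (λ_ _).hom ≫ b =
      𝟙_ C ◁ b ≫ (α_ _ _ _).inv ≫ (λ_ X).hom ▷ Y := by
    intro b
    simp
  have hw : w = (λ_ _).hom ≫ (λ_ _).inv ≫ w := by simp
  rw [hw, key]
  change symbolMap φ X Y (𝟙_ C) (𝟙_ C) _ = _
  rw [symbolMap_factorization, isotypic_of_irreducible φ hX]
  simp

/-- A multiplier with symbol `φ` acts on the morphisms `𝟙 ⊗ 𝟙 ⟶ P ⊗ Q` through the isotypic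
components of `P`. -/
theorem extension_map_unit {θ : Multiplier C} (E : θ.Extension) {φ : Irr C → ℂ}
    (hE : ∀ (X Y : C) (hX : IsIrreducible X) (_ : ExactPairing X Y)
      (w : 𝟙_ C ⊗ 𝟙_ C ⟶ X ⊗ Y), E.map X Y (𝟙_ C) (𝟙_ C) w = φ (Irr.mk X hX) • w)
    {P Q : C} (w : 𝟙_ C ⊗ 𝟙_ C ⟶ P ⊗ Q) :
    E.map P Q (𝟙_ C) (𝟙_ C) w = w ≫ isotypic φ P ▷ Q := by
  have h1 : ∀ (a : Irr C) (w : 𝟙_ C ⊗ 𝟙_ C ⟶ a.obj ⊗ Q),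
      E.map a.obj Q (𝟙_ C) (𝟙_ C) w = φ a • w := by
    intro a w
    -- The hypothesis concerns only an irreducible object and its conjugate. A zigzag factors `w`
    -- through the coevaluation of `a`, and the extension commutes with the remaining morphism `g`.
    obtain ⟨g, hg⟩ : ∃ g : a.dual ⟶ Q, w = ((λ_ _).hom ≫ a.pairing.coevaluation') ≫ a.obj ◁ g := by
      have h := (@tensorLeftHomEquiv C _ _ (𝟙_ C) a.obj a.dual Q a.pairing).right_inv ((λ_ _).inv ≫ w)
      refine ⟨(ρ_ _).inv ≫ a.dual ◁ ((λ_ _).inv ≫ w) ≫ (α_ _ _ _).inv ≫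
        a.pairing.evaluation' ▷ _ ≫ (λ_ _).hom, ?_⟩
      have h2 : (λ_ _).inv ≫ w = (λ_ _).inv ≫ a.pairing.coevaluation' ▷ _ ≫ (α_ _ _ _).hom ≫
        a.obj ◁ (a.dual ◁ ((λ_ _).inv ≫ w) ≫ (α_ _ _ _).inv ≫
          a.pairing.evaluation' ▷ _ ≫ (λ_ _).hom) := h.symm
      rw [← cancel_epi (λ_ _).inv]
      refine h2.trans ?_
      generalize (a.dual ◁ ((λ_ _).inv ≫ w) ≫ (α_ _ _ _).inv ≫
          a.pairing.evaluation' ▷ _ ≫ (λ_ _).hom) = k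
      simp
      monoidal
    have h2 := E.map_comp (𝟙 a.obj) g (𝟙 (𝟙_ C)) (𝟙 (𝟙_ C)) ((λ_ _).hom ≫ a.pairing.coevaluation')
    simp only [id_tensorHom, whiskerLeft_id, Category.id_comp] at h2
    rw [hg, h2, hE _ _ a.obj_irreducible a.pairing, Irr.mk_obj, Linear.smul_comp]
  set D := irrDecomp P with hD
  have hw : w = ∑ i, (w ≫ dagger (D.v i) ▷ Q) ≫ D.v i ▷ Q := by
    simp only [Category.assoc, ← comp_whiskerRight]
    rw [← Preadditive.comp_sum, ← sum_whiskerRight, D.complete, id_whiskerRight, Category.comp_id]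
  have h3 : ∀ i, E.map P Q (𝟙_ C) (𝟙_ C) ((w ≫ dagger (D.v i) ▷ Q) ≫ D.v i ▷ Q) =
      φ (D.c i) • ((w ≫ dagger (D.v i) ▷ Q) ≫ D.v i ▷ Q) := by
    intro i
    have h2 := E.map_comp (D.v i) (𝟙 Q) (𝟙 (𝟙_ C)) (𝟙 (𝟙_ C)) (w ≫ dagger (D.v i) ▷ Q)
    simp only [tensorHom_id, id_whiskerRight, Category.id_comp] at h2
    rw [h2, h1, Linear.smul_comp]
  conv_lhs => rw [hw]
  rw [map_sum, isotypic, sum_whiskerRight, Preadditive.comp_sum]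
  refine Finset.sum_congr rfl fun i _ => ?_
  rw [h3]
  simp only [MonoidalLinear.smul_whiskerRight, comp_whiskerRight, Linear.comp_smul, Category.assoc]
  rfl

/-- Bending both incoming legs is a composite of two Frobenius bijections. A multiplier commutes
with this operation, so it is determined by its action on morphisms out of `𝟙 ⊗ 𝟙`. -/
theorem rotate_injective {X Y X' Y' : C} (p : ExactPairing X' X) (q : ExactPairing Y Y')
    {S T : X ⊗ Y ⟶ X ⊗ Y} (h : (p.coevaluation' ⊗ₘ q.coevaluation') ≫ amplify X' Y' S =
      (p.coevaluation' ⊗ₘ q.coevaluation') ≫ amplify X' Y' T) : S = T := by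
  apply (@tensorLeftHomEquiv C _ _ Y X' X (X ⊗ Y) p).injective
  apply (Iso.homCongr (λ_ Y) (Iso.refl _)).symm.injective
  apply (@tensorRightHomEquiv C _ _ (𝟙_ C) Y Y' _ q).injective
  have key : ∀ S : X ⊗ Y ⟶ X ⊗ Y, (@tensorRightHomEquiv C _ _ (𝟙_ C) Y Y' _ q)
      ((Iso.homCongr (λ_ Y) (Iso.refl _)).symm ((@tensorLeftHomEquiv C _ _ Y X' X (X ⊗ Y) p) S)) =
      (λ_ _).inv ≫ ((p.coevaluation' ⊗ₘ q.coevaluation') ≫ amplify X' Y' S) ≫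
        (α_ _ _ _).hom ≫ X' ◁ (α_ _ _ _).inv ≫ (α_ _ _ _).inv := by
    intro S
    change (ρ_ _).inv ≫ _ ◁ q.coevaluation' ≫ (α_ _ _ _).inv ≫ ((λ_ Y).hom ≫ ((λ_ _).inv ≫
      p.coevaluation' ▷ _ ≫ (α_ _ _ _).hom ≫ _ ◁ S) ≫ 𝟙 _) ▷ _ = _
    rw [amplify, MonoidalCategory.tensorHom_def']
    monoidal
  rw [key, key, h]

/-- A multiplier is determined by its symbol. -/
theorem Multiplier.HasSymbol.map_eq {θ : Multiplier C} {φ : Irr C → ℂ} (hθ : θ.HasSymbol φ)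
    (X Y : C) (T : X ⊗ Y ⟶ X ⊗ Y) : θ.map X Y T = symbolMap φ X Y X Y T := by
  obtain ⟨Y', ⟨q⟩⟩ := RigidCStarTensorCategory.exists_dual Y
  have key : ∀ {θ : Multiplier C}, θ.HasSymbol φ →
      ((conjPairing X).coevaluation' ⊗ₘ q.coevaluation') ≫ amplify (conj X) Y' (θ.map X Y T) =
      (((conjPairing X).coevaluation' ⊗ₘ q.coevaluation') ≫ amplify (conj X) Y' T) ≫
        isotypic φ _ ▷ _ := by
    intro θ hθ
    obtain ⟨E, hE⟩ := hθ
    rw [← extension_map_unit E hE, ← θ.map_amplify, ← E.map_self]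
    have := E.map_comp (𝟙 _) (𝟙 _) (conjPairing X).coevaluation' q.coevaluation'
      (amplify (conj X) Y' T)
    simp only [id_tensorHom, whiskerLeft_id, Category.comp_id] at this
    exact this.symm
  exact rotate_injective (conjPairing X) q ((key hθ).trans (key (multiplierOfSymbol_hasSymbol φ)).symm)

end MultiplierOfSymbol

/-! ### The trace formula for the quadratic form of a multiplier. -/

section TraceFormula

variable {C : Type u} [Category.{v} C] [Preadditive C] [Linear ℂ C]
  [MonoidalCategory C] [MonoidalPreadditive C] [MonoidalLinear ℂ C] [CStarTensorCategory C]

/-- The operator `f ↦ k₂* (1 ⊗ f) k₁`. -/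
def sandwich {T N N' : C} (k₁ : N ⟶ T ⊗ N) (k₂ : N' ⟶ T ⊗ N') : (N ⟶ N') →ₗ[ℂ] (N ⟶ N') where
  toFun f := k₁ ≫ T ◁ f ≫ dagger k₂
  map_add' f g := by simp [MonoidalPreadditive.whiskerLeft_add]
  map_smul' c f := by simp

theorem sandwich_apply {T N N' : C} (k₁ : N ⟶ T ⊗ N) (k₂ : N' ⟶ T ⊗ N') (f : N ⟶ N') :
    sandwich k₁ k₂ f = k₁ ≫ T ◁ f ≫ dagger k₂ := rfl

/-- The morphism `k ⊗ 1`. -/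
def tensorCoaction {T A : C} (k : A ⟶ T ⊗ A) (Q : C) : A ⊗ Q ⟶ T ⊗ (A ⊗ Q) :=
  k ▷ Q ≫ (α_ _ _ _).hom

theorem whiskerLeft_tensorCoaction {T A : C} (k : A ⟶ T ⊗ A) {Q R : C} (g : Q ⟶ R) :
    A ◁ g ≫ tensorCoaction k R = tensorCoaction k Q ≫ T ◁ (A ◁ g) := by
  rw [tensorCoaction, tensorCoaction, whisker_exchange_assoc]
  simp

theorem sandwich_precomp {T A N : C} (k : A ⟶ T ⊗ A) (l : N ⟶ T ⊗ N) {Q R : C} (g : Q ⟶ R)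
    (f : A ⊗ R ⟶ N) :
    sandwich (tensorCoaction k Q) l (A ◁ g ≫ f) = A ◁ g ≫ sandwich (tensorCoaction k R) l f := by
  rw [sandwich_apply, sandwich_apply, ← Category.assoc (A ◁ g), whiskerLeft_tensorCoaction]
  simp

/-- The morphism `A ⊗ B ⟶ T` corresponding to `k : A ⟶ T ⊗ A`. -/
def bend {A B T : C} (p : ExactPairing A B) (k : A ⟶ T ⊗ A) : A ⊗ B ⟶ T :=
  k ▷ B ≫ (α_ _ _ _).hom ≫ T ◁ dagger p.coevaluation' ≫ (ρ_ T).hom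

theorem exists_bend {A B T : C} (p : ExactPairing A B) (y : A ⊗ B ⟶ T) :
    ∃ k : A ⟶ T ⊗ A, bend p k = y := by
  let q := daggerPairing p
  exact ⟨(@tensorRightHomEquiv C _ _ A B A T q) y,
    (@tensorRightHomEquiv C _ _ A B A T q).left_inv y⟩

/-- The evaluation `A ⊗ (B ⊗ A) ⟶ A`. -/
def evalPair {A B : C} (p : ExactPairing A B) : A ⊗ (B ⊗ A) ⟶ A :=
  (α_ _ _ _).inv ≫ dagger p.coevaluation' ▷ A ≫ (λ_ A).hom

/-- Frobenius reciprocity for the adjoint pairing. -/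
def curryPair {A B : C} (p : ExactPairing A B) (Q : C) : (A ⊗ Q ⟶ A) →ₗ[ℂ] (Q ⟶ B ⊗ A) where
  toFun f := (λ_ _).inv ≫ dagger p.evaluation' ▷ _ ≫ (α_ _ _ _).hom ≫ _ ◁ f
  map_add' f g := by simp [MonoidalPreadditive.whiskerLeft_add]
  map_smul' c f := by simp

theorem curryPair_evalPair {A B Q : C} (p : ExactPairing A B) (f : A ⊗ Q ⟶ A) :
    A ◁ curryPair p Q f ≫ evalPair p = f :=
  (@tensorLeftHomEquiv C _ _ Q B A A (daggerPairing p)).left_inv f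

theorem curryPair_eq {A B Q : C} (p : ExactPairing A B) (g : Q ⟶ B ⊗ A) :
    curryPair p Q (A ◁ g ≫ evalPair p) = g :=
  (@tensorLeftHomEquiv C _ _ Q B A A (daggerPairing p)).right_inv g

theorem partialTraceLeft_comp_dagger {A B Q : C} (p : ExactPairing A B) (f g : A ⊗ Q ⟶ A) :
    partialTraceLeft p (f ≫ dagger g) = curryPair p Q f ≫ dagger (curryPair p Q g) := by
  change _ = ((λ_ _).inv ≫ dagger p.evaluation' ▷ _ ≫ (α_ _ _ _).hom ≫ _ ◁ f) ≫
    dagger ((λ_ _).inv ≫ dagger p.evaluation' ▷ _ ≫ (α_ _ _ _).hom ≫ _ ◁ g)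
  simp [partialTraceLeft]

/-- This is the factorization needed by `symbolMap_factorization`, with middle object `B ⊗ A`: the
symbol then acts through the irreducible summands of `B ⊗ A`. -/
theorem bend_comp_dagger {A B T : C} (p : ExactPairing A B) (k : A ⟶ T ⊗ A) :
    bend p k ≫ dagger (bend p k) = A ◁ ((ρ_ B).inv ≫ B ◁ p.coevaluation' ≫ (α_ _ _ _).inv) ≫
      (α_ _ _ _).inv ≫ (sandwich (tensorCoaction k (B ⊗ A)) k (evalPair p)) ▷ B := by
  rw [sandwich_apply, tensorCoaction, evalPair, bend]
  simp only [dagger_comp, dagger_rightUnitor, dagger_whiskerLeft, dagger_dagger,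
    dagger_associator, dagger_whiskerRight]
  symm
  calc _ = 𝟙 _ ⊗≫ ((A ⊗ B) ◁ p.coevaluation' ≫
        (k ▷ B ≫ (α_ _ _ _).hom ≫ T ◁ dagger p.coevaluation') ▷ (A ⊗ B)) ⊗≫ dagger k ▷ B := by monoidal
    _ = 𝟙 _ ⊗≫ ((k ▷ B ≫ (α_ _ _ _).hom ≫ T ◁ dagger p.coevaluation') ▷ 𝟙_ C ≫
        (T ⊗ 𝟙_ C) ◁ p.coevaluation') ⊗≫ dagger k ▷ B := by rw [whisker_exchange]
    _ = _ := by monoidal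

theorem coevaluation_expand {A B Q : C} (p : ExactPairing A B) (g : B ⊗ A ⟶ Q) :
    p.coevaluation' ≫ A ◁ (((ρ_ B).inv ≫ B ◁ p.coevaluation' ≫ (α_ _ _ _).inv) ≫ g ▷ B) ≫
      (α_ _ _ _).inv = p.coevaluation' ≫ (dagger (evalPair p) ≫ A ◁ g) ▷ B := by
  rw [evalPair]
  simp only [dagger_comp, dagger_leftUnitor, dagger_dagger, dagger_associator_inv,
    dagger_whiskerRight]
  calc _ = 𝟙 _ ⊗≫ (p.coevaluation' ▷ 𝟙_ C ≫ (A ⊗ B) ◁ p.coevaluation') ⊗≫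
        A ◁ g ▷ B ⊗≫ 𝟙 _ := by monoidal
    _ = 𝟙 _ ⊗≫ (𝟙_ C ◁ p.coevaluation' ≫ p.coevaluation' ▷ (A ⊗ B)) ⊗≫
        A ◁ g ▷ B ⊗≫ 𝟙 _ := by rw [whisker_exchange]
    _ = _ := by monoidal

variable [RigidCStarTensorCategory C]

theorem isotypic_eq_sum_frame (φ : Irr C → ℂ) (X : C) {F : Finset (Irr C)}
    (hF : ∀ i, (irrDecomp X).c i ∈ F) :
    isotypic φ X = ∑ a ∈ F, φ a • ∑ i, dagger ((irrDecomp X).frame a i) ≫ (irrDecomp X).frame a i := by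
  simp only [Finset.smul_sum]
  rw [Finset.sum_comm, isotypic]
  refine Finset.sum_congr rfl fun i _ => ?_
  rw [Finset.sum_eq_single_of_mem _ (hF i)]
  · simp [IrrDecomp.frame]
  · intro b _ hb
    simp [IrrDecomp.frame, Irr.cmp_of_ne hb]

/-- Cyclicity moves the trace from `A` to `A ⊗ a.obj`, where it may be closed on the left. Closing
`A` first produces the Frobenius transforms of `f` and `g`; closing `a.obj` then produces the weight
d(a). -/
theorem rightTrace_dagger_comp {A B : C} {p : ExactPairing A B} (hp : IsStandard p) (a : Irr C)
    (f g : A ⊗ a.obj ⟶ A) :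
    rightTrace p (dagger g ≫ f) = ((a.dim : ℂ) * a.obj_irreducible.scalar
      (curryPair p a.obj f ≫ dagger (curryPair p a.obj g))) • 𝟙 (𝟙_ C) := by
  have hs := hp.tensor a.pairing_isStandard
  rw [hp.rightTrace_eq (irrDecomp A), IrrDecomp.tr_comm _ (irrDecomp (A ⊗ a.obj)),
    ← hs.rightTrace_eq, ← partialTraceLeft_comp_dagger, ← a.leftTrace_pairing,
    ← leftTrace_tensor p a.pairing]
  exact hs _

/-- The quadratic form of a symbol on the coactions `k : A ⟶ T ⊗ A`. -/
def symbolForm (φ : Irr C → ℂ) {T A : C} (F : Finset (Irr C)) (k : A ⟶ T ⊗ A) : ℂ :=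
  ∑ a ∈ F, φ a * (a.dim * LinearMap.trace ℂ _ (sandwich (tensorCoaction k a.obj) k))

/-- Expand the isotypic projections of `B ⊗ A` in the frames U : `a.obj ⟶ B ⊗ A`. The morphisms `A ◁
U ≫ evalPair p` form a frame of the morphisms `A ⊗ a.obj ⟶ A`, and each term of the expansion is
d(a) times a diagonal coefficient of the sandwich operator. -/
theorem symbolMap_bend {A B T : C} {p : ExactPairing A B} (hp : IsStandard p) (φ : Irr C → ℂ)
    {F : Finset (Irr C)} (hF : ∀ i, (irrDecomp (B ⊗ A)).c i ∈ F) (k : A ⟶ T ⊗ A) :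
    p.coevaluation' ≫ symbolMap φ A B A B (bend p k ≫ dagger (bend p k)) ≫
      dagger p.coevaluation' = symbolForm φ F k • 𝟙 (𝟙_ C) := by
  have htr : ∀ a : Irr C, LinearMap.trace ℂ _ (sandwich (tensorCoaction k a.obj) k) =
      ∑ i, a.obj_irreducible.scalar (curryPair p a.obj (sandwich (tensorCoaction k a.obj) k
        (A ◁ (irrDecomp (B ⊗ A)).frame a i ≫ evalPair p)) ≫
          dagger ((irrDecomp (B ⊗ A)).frame a i)) := by
    intro a
    refine trace_eq_sum_of_frame (fun i => A ◁ (irrDecomp (B ⊗ A)).frame a i ≫ evalPair p)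
      (fun i => a.obj_irreducible.scalar ∘ₗ Linear.rightComp ℂ a.obj
        (dagger ((irrDecomp (B ⊗ A)).frame a i)) ∘ₗ curryPair p a.obj) (fun x => ?_) _
    conv_rhs => rw [← curryPair_evalPair p x, ← (irrDecomp (B ⊗ A)).frame_expand (curryPair p _ x),
      whiskerLeft_sum, Preadditive.sum_comp]
    refine Finset.sum_congr rfl fun i _ => ?_
    rw [MonoidalLinear.whiskerLeft_smul, Linear.smul_comp]
    rfl
  rw [bend_comp_dagger, symbolMap_factorization, isotypic_eq_sum_frame φ _ hF, symbolForm,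
    Finset.sum_smul]
  simp only [sum_whiskerRight, MonoidalLinear.smul_whiskerRight, whiskerLeft_sum,
    MonoidalLinear.whiskerLeft_smul, Preadditive.sum_comp, Preadditive.comp_sum, Linear.smul_comp,
    Linear.comp_smul]
  refine Finset.sum_congr rfl fun a _ => ?_
  rw [mul_smul]
  congr 1
  rw [htr, Finset.mul_sum, Finset.sum_smul]
  refine Finset.sum_congr rfl fun i _ => ?_
  set U := (irrDecomp (B ⊗ A)).frame a i
  have h := rightTrace_dagger_comp hp a (sandwich (tensorCoaction k a.obj) k
        (A ◁ U ≫ evalPair p)) (A ◁ U ≫ evalPair p)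
  rw [curryPair_eq p U] at h
  rw [← h, rightTrace, sandwich_precomp, dagger_comp, dagger_whiskerLeft]
  have h2 := coevaluation_expand p (dagger U)
  have e1 : A ◁ (((ρ_ B).inv ≫ B ◁ p.coevaluation' ≫ (α_ _ _ _).inv) ≫ (dagger U ≫ U) ▷ B) ≫
      (α_ _ _ _).inv = (A ◁ (((ρ_ B).inv ≫ B ◁ p.coevaluation' ≫ (α_ _ _ _).inv) ≫
        dagger U ▷ B) ≫ (α_ _ _ _).inv) ≫ (A ◁ U) ▷ B := by
    simp
  simp only [Category.assoc] at e1 h2 ⊢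
  rw [reassoc_of% e1, reassoc_of% h2]
  simp

end TraceFormula

/-! ### Complete positivity in terms of the quadratic forms. -/

section CompletePositivity

variable {C : Type u} [Category.{v} C] [Preadditive C] [Linear ℂ C]
  [MonoidalCategory C] [MonoidalPreadditive C] [MonoidalLinear ℂ C] [CStarTensorCategory C]
  [RigidCStarTensorCategory C]

-- Over ℂ a form with real values is automatically Hermitian, so nonnegativity is the only
-- assumption; the factor `G` comes from writing a positive element of the matrix C*-algebra as
-- `star G * G`.
open scoped MatrixOrder Matrix.Norms.L2Operator in
theorem exists_gram_matrix {m : Type*} [Fintype m] [DecidableEq m] (M : Matrix m m ℂ)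
    (h : ∀ x : m → ℂ, 0 ≤ ∑ i, ∑ j, star (x i) * M i j * x j) :
    ∃ G : Matrix m m ℂ, ∀ i j, M i j = ∑ r, star (G r i) * G r j := by
  have h' : ∀ x : m → ℂ, 0 ≤ star x ⬝ᵥ (M.mulVec x) := by
    intro x
    convert h x using 1
    simp only [dotProduct, Matrix.mulVec, Finset.mul_sum, Pi.star_apply, mul_assoc]
  have hH : M.IsHermitian := by
    rw [← Matrix.isSymmetric_toEuclideanLin_iff, LinearMap.isSymmetric_iff_inner_map_self_real]
    intro v
    have h2 := h' v.ofLp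
    have h3 : inner ℂ v (Matrix.toEuclideanLin M v) = star v.ofLp ⬝ᵥ (M.mulVec v.ofLp) := by
      rw [EuclideanSpace.inner_eq_star_dotProduct, dotProduct_comm]
      rfl
    rw [inner_conj_symm, h3, ← inner_conj_symm, h3]
    exact (Complex.conj_eq_iff_im.2 (Complex.nonneg_iff.1 h2).2.symm).symm
  obtain ⟨G, hG⟩ := CStarAlgebra.nonneg_iff_eq_star_mul_self.1
    (Matrix.PosSemidef.of_dotProduct_mulVec_nonneg hH h').nonneg
  refine ⟨G, fun i j => ?_⟩
  rw [hG, Matrix.mul_apply]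
  simp

/-- A Gram matrix of morphisms to arbitrary objects is the Gram matrix of endomorphisms. -/
theorem exists_square_gram {Z : C} {n : ℕ} {R : Type*} [Fintype R] {S : R → C}
    (x : Fin n → Fin n → (Z ⟶ Z)) (B : ∀ r, Fin n → (Z ⟶ S r))
    (hx : ∀ i j, x i j = ∑ r, B r j ≫ dagger (B r i)) :
    ∃ b : Fin n → Fin n → (Z ⟶ Z), ∀ i j, x i j = ∑ k, b k j ≫ dagger (b k i) := by
  classical
  -- Gathering the targets into `T` and `n` copies of `Z` into `W` makes the Gram matrix come from
  -- one morphism `f : W ⟶ T`. The axiom `comp_dagger_positive` replaces it by an endomorphism of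
  -- `W`, which is an `n × n` matrix over the endomorphisms of `Z`.
  obtain ⟨T, p, hp1, hp2, -⟩ := exists_directSum_fintype S
  obtain ⟨W, q, hq1, hq2, hq3⟩ := exists_directSum_fin n fun _ => Z
  let b' : Fin n → (Z ⟶ T) := fun j => ∑ r, B r j ≫ p r
  have hb' : ∀ i j, x i j = b' j ≫ dagger (b' i) := by
    intro i j
    simp only [b', hx, dagger_sum, Preadditive.sum_comp, Preadditive.comp_sum, dagger_comp,
      Category.assoc]
    refine Finset.sum_congr rfl fun r _ => ?_
    rw [Finset.sum_eq_single_of_mem r (Finset.mem_univ r)]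
    · rw [← Category.assoc (p r), hp1, Category.id_comp]
    · intro r' _ hr
      rw [← Category.assoc (p _), hp2 _ _ hr]
      simp
  let f : W ⟶ T := ∑ j, dagger (q j) ≫ b' j
  have hqf : ∀ j, q j ≫ f = b' j := by
    intro j
    simp only [f, Preadditive.comp_sum]
    rw [Finset.sum_eq_single_of_mem j (Finset.mem_univ j)]
    · rw [← Category.assoc, hq1, Category.id_comp]
    · intro r' _ hr
      rw [← Category.assoc, hq2 _ _ hr.symm]
      simp
  obtain ⟨g, hg⟩ := comp_dagger_positive f
  refine ⟨fun k j => q j ≫ g ≫ dagger (q k), fun i j => ?_⟩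
  calc x i j = q j ≫ (f ≫ dagger f) ≫ dagger (q i) := by
        rw [hb', ← hqf, ← hqf]
        simp
    _ = q j ≫ (g ≫ (∑ k, dagger (q k) ≫ q k) ≫ dagger g) ≫ dagger (q i) := by
        rw [hg, hq3]
        simp
    _ = _ := by
        simp [Preadditive.sum_comp, Preadditive.comp_sum]

theorem isotypic_one (X : C) : isotypic (fun _ => 1) X = 𝟙 X := by
  simp [isotypic, (irrDecomp X).complete]

theorem expand_frame {Z Z' : C} (x : Z ⟶ Z') {F : Finset (Irr C)}
    (hF : ∀ i, (irrDecomp Z).c i ∈ F) :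
    x = ∑ c ∈ F, ∑ q, ∑ r, c.obj_irreducible.scalar ((irrDecomp Z).frame c q ≫ x ≫
      dagger ((irrDecomp Z').frame c r)) • (dagger ((irrDecomp Z).frame c q) ≫
        (irrDecomp Z').frame c r) := by
  have h1 := isotypic_eq_sum_frame (fun _ => (1 : ℂ)) Z hF
  rw [isotypic_one] at h1
  calc x = 𝟙 Z ≫ x := by simp
    _ = ∑ c ∈ F, ∑ q, dagger ((irrDecomp Z).frame c q) ≫ ((irrDecomp Z).frame c q ≫ x) := by
      conv_lhs => rw [h1]
      simp [Preadditive.sum_comp]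
    _ = _ := by
      refine Finset.sum_congr rfl fun c _ => Finset.sum_congr rfl fun q _ => ?_
      conv_lhs => rw [← (irrDecomp Z').frame_expand ((irrDecomp Z).frame c q ≫ x)]
      simp [Preadditive.comp_sum]

/-- A matrix of endomorphisms that is positive on all irreducible objects is a Gram matrix. -/
theorem exists_gram_of_forall {Z : C} {n : ℕ} (x : Fin n → Fin n → (Z ⟶ Z))
    (h : ∀ (c : Irr C) (f : Fin n → (c.obj ⟶ Z)),
      0 ≤ c.obj_irreducible.scalar (∑ i, ∑ j, f j ≫ x i j ≫ dagger (f i))) :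
    ∃ b : Fin n → Fin n → (Z ⟶ Z), ∀ i j, x i j = ∑ k, b k j ≫ dagger (b k i) := by
  classical
  let D := irrDecomp Z
  -- `M c` is the action of `x` on the frame of morphisms from `c`. The hypothesis, applied to
  -- combinations of frame elements, says that this scalar matrix is positive.
  let M : Irr C → Matrix (Fin n × Fin D.n) (Fin n × Fin D.n) ℂ := fun c ip jq =>
    c.obj_irreducible.scalar (D.frame c jq.2 ≫ x ip.1 jq.1 ≫ dagger (D.frame c ip.2))
  have hM : ∀ c, ∃ G : Matrix (Fin n × Fin D.n) (Fin n × Fin D.n) ℂ, ∀ i j,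
      M c i j = ∑ r, star (G r i) * G r j := by
    intro c
    refine exists_gram_matrix (M c) fun y => ?_
    convert h c (fun j => ∑ q, y (j, q) • D.frame c q) using 1
    simp only [Fintype.sum_prod_type, dagger_sum, dagger_smul, Preadditive.sum_comp,
      Preadditive.comp_sum, Linear.smul_comp, Linear.comp_smul, map_sum, map_smul, smul_eq_mul, M]
    refine Finset.sum_congr rfl fun i _ => ?_
    rw [Finset.sum_comm]
    refine Finset.sum_congr rfl fun j _ => ?_
    refine Finset.sum_congr rfl fun q _ => ?_
    rw [Finset.mul_sum]
    refine Finset.sum_congr rfl fun p _ => ?_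
    ring
  choose G hG using hM
  let F : Finset (Irr C) := Finset.univ.image D.c
  refine exists_square_gram (R := F × (Fin n × Fin D.n)) (S := fun r => (r.1 : Irr C).obj) x
    (fun r j => ∑ q, G r.1 r.2 (j, q) • dagger (D.frame r.1 q)) fun i j => ?_
  rw [expand_frame (x i j) (F := F) (fun i => Finset.mem_image_of_mem _ (Finset.mem_univ i)),
    Fintype.sum_prod_type, ← Finset.sum_coe_sort F]
  refine Finset.sum_congr rfl fun c _ => ?_
  have h1 : ∀ q r, (c : Irr C).obj_irreducible.scalar (D.frame c q ≫ x i j ≫ dagger (D.frame c r)) =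
      ∑ s, star (G c s (i, r)) * G c s (j, q) := fun q r => hG c (i, r) (j, q)
  simp only [D] at h1
  simp only [h1, Finset.sum_smul, dagger_sum, dagger_smul, dagger_dagger, Preadditive.sum_comp,
    Preadditive.comp_sum, Linear.smul_comp, Linear.comp_smul, Finset.smul_sum, smul_smul]
  rw [Finset.sum_comm]
  conv_rhs => rw [Finset.sum_comm]
  refine Finset.sum_congr rfl fun r _ => ?_
  rw [Finset.sum_comm]

theorem symbolMap_whiskerRight (φ : Irr C → ℂ) {X Y : C} (Q : C) (S : X ⊗ Y ⟶ X ⊗ Y) :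
    symbolMap φ X (Y ⊗ Q) X (Y ⊗ Q) ((α_ _ _ _).inv ≫ S ▷ Q ≫ (α_ _ _ _).hom) =
      (α_ _ _ _).inv ≫ symbolMap φ X Y X Y S ▷ Q ≫ (α_ _ _ _).hom := by
  obtain ⟨V, a, e, rfl⟩ := exists_factorization S
  have key : ∀ b : Y ⟶ V ⊗ Y, (α_ _ _ _).inv ≫ (X ◁ b ≫ (α_ _ _ _).inv ≫ e ▷ Y) ▷ Q ≫
      (α_ _ _ _).hom = X ◁ (b ▷ Q ≫ (α_ _ _ _).hom) ≫ (α_ _ _ _).inv ≫ e ▷ (Y ⊗ Q) := by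
    intro b
    monoidal
  rw [key, symbolMap_factorization, symbolMap_factorization, key]
  simp

/-- Positivity on `1 × 1` matrices suffices, once `comp_dagger_positive` has replaced `y` by an
endomorphism. -/
theorem IsCpMultiplier.map_nonneg {φ : Irr C → ℂ} (hφ : IsCpMultiplier φ) {A B T : C}
    (w : 𝟙_ C ⟶ A ⊗ B) (y : A ⊗ B ⟶ T) :
    0 ≤ (RigidCStarTensorCategory.unit_irreducible (C := C)).scalar
      (w ≫ symbolMap φ A B A B (y ≫ dagger y) ≫ dagger w) := by
  obtain ⟨θ, hθ, hpos⟩ := hφ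
  obtain ⟨g, hg⟩ := comp_dagger_positive y
  obtain ⟨b, hb⟩ := hpos A B 1 fun _ _ => g
  have hb := hb 0 0
  simp only [Finset.univ_unique, Finset.sum_singleton] at hb
  rw [hg, ← hθ.map_eq, hb]
  have := (RigidCStarTensorCategory.unit_irreducible (C := C)).scalar_comp_dagger_nonneg
    (w ≫ b default 0)
  simpa using this

theorem IsCpMultiplier.symbolForm_nonneg {φ : Irr C → ℂ} (hφ : IsCpMultiplier φ) {A B T : C}
    {p : ExactPairing A B} (hp : IsStandard p) {F : Finset (Irr C)}
    (hF : ∀ i, (irrDecomp (B ⊗ A)).c i ∈ F) (k : A ⟶ T ⊗ A) : 0 ≤ symbolForm φ F k := by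
  have h := hφ.map_nonneg p.coevaluation' (bend p k)
  rwa [symbolMap_bend hp φ hF, map_smul, IsIrreducible.scalar_id, smul_eq_mul, mul_one] at h

/-- A function on `Irr C` is a cp-multiplier if its quadratic forms are positive. -/
theorem isCpMultiplier_of_symbolForm_nonneg {φ : Irr C → ℂ}
    (h : ∀ {A B T : C} {p : ExactPairing A B} (_ : IsStandard p) (k : A ⟶ T ⊗ A),
      ∃ F : Finset (Irr C), (∀ i, (irrDecomp (B ⊗ A)).c i ∈ F) ∧ 0 ≤ symbolForm φ F k) :
    IsCpMultiplier φ := by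
  have hu : IsIrreducible (𝟙_ C) := RigidCStarTensorCategory.unit_irreducible
  refine ⟨multiplierOfSymbol φ, multiplierOfSymbol_hasSymbol φ, fun X Y n a => ?_⟩
  change ∃ b : Fin n → Fin n → (X ⊗ Y ⟶ X ⊗ Y), ∀ i j,
    symbolMap φ X Y X Y (∑ k, a k j ≫ dagger (a k i)) = ∑ k, b k j ≫ dagger (b k i)
  refine exists_gram_of_forall _ fun c f => ?_
  obtain ⟨B, p, hp⟩ := exists_isStandard X
  -- After `c` is closed with its dual, Frobenius reciprocity moves `f j` to a morphism `g j` on the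
  -- second leg only, and the multiplier commutes with such morphisms.
  have hg : ∀ j, ∃ g : B ⟶ Y ⊗ c.dual, c.pairing.coevaluation' ≫ f j ▷ c.dual ≫ (α_ _ _ _).hom =
      p.coevaluation' ≫ X ◁ g := by
    intro j
    set w := c.pairing.coevaluation' ≫ f j ▷ c.dual ≫ (α_ _ _ _).hom
    refine ⟨(ρ_ _).inv ≫ (@tensorLeftHomEquiv C _ _ (𝟙_ C) X B (Y ⊗ c.dual) p).symm w, ?_⟩
    have h1 : (λ_ _).inv ≫ p.coevaluation' ▷ _ ≫ (α_ _ _ _).hom ≫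
        X ◁ ((@tensorLeftHomEquiv C _ _ (𝟙_ C) X B (Y ⊗ c.dual) p).symm w) = w :=
      (@tensorLeftHomEquiv C _ _ (𝟙_ C) X B (Y ⊗ c.dual) p).right_inv w
    conv_lhs => rw [← h1]
    generalize (@tensorLeftHomEquiv C _ _ (𝟙_ C) X B (Y ⊗ c.dual) p).symm w = k
    monoidal
  choose g hg using hg
  have key : ∀ k, 0 ≤ c.obj_irreducible.scalar
      (∑ i, ∑ j, f j ≫ symbolMap φ X Y X Y (a k j ≫ dagger (a k i)) ≫ dagger (f i)) := by
    intro k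
    -- The `g j` and `a k j` combine into one morphism `y`, so that d(c) times the required scalar
    -- is the value of the quadratic form at the coaction bent from `y`.
    let y : X ⊗ B ⟶ (X ⊗ Y) ⊗ c.dual := ∑ j, X ◁ g j ≫ (α_ _ _ _).inv ≫ a k j ▷ c.dual
    obtain ⟨l, hl⟩ := exists_bend p y
    obtain ⟨F, hF, hpos⟩ := h hp l
    have h1 := symbolMap_bend hp φ hF l
    have h2 : rightTrace c.pairing
        (∑ i, ∑ j, f j ≫ symbolMap φ X Y X Y (a k j ≫ dagger (a k i)) ≫ dagger (f i)) =
        p.coevaluation' ≫ symbolMap φ X B X B (y ≫ dagger y) ≫ dagger p.coevaluation' := by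
      simp only [rightTrace, y, dagger_sum, Preadditive.sum_comp, Preadditive.comp_sum, map_sum,
        sum_whiskerRight]
      refine Finset.sum_congr rfl fun i _ => Finset.sum_congr rfl fun j _ => ?_
      have h3 := symbolMap_comp φ (𝟙 X) (dagger (g i)) (𝟙 X) (g j)
        ((α_ X Y c.dual).inv ≫ (a k j ≫ dagger (a k i)) ▷ c.dual ≫ (α_ _ _ _).hom)
      rw [symbolMap_whiskerRight] at h3
      have e1 : (X ◁ g j ≫ (α_ _ _ _).inv ≫ a k j ▷ c.dual) ≫
          dagger (X ◁ g i ≫ (α_ _ _ _).inv ≫ a k i ▷ c.dual) = (𝟙 X ⊗ₘ g j) ≫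
          ((α_ X Y c.dual).inv ≫ (a k j ≫ dagger (a k i)) ▷ c.dual ≫ (α_ _ _ _).hom) ≫
            (𝟙 X ⊗ₘ dagger (g i)) := by
        simp
      rw [e1, h3, id_tensorHom, id_tensorHom]
      have e2 := congrArg dagger (hg i)
      simp only [dagger_comp, dagger_whiskerLeft, dagger_associator, dagger_whiskerRight] at e2
      simp only [Category.assoc] at e2
      simp only [Category.assoc]
      rw [← e2, ← Category.assoc p.coevaluation', ← hg j]
      simp
    rw [c.rightTrace_pairing, ← hl, h1] at h2
    have h3 := hu.smul_id_injective h2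
    rw [← h3] at hpos
    have hd : (0 : ℂ) < (c.dim : ℂ) := by exact_mod_cast c.dim_pos
    have h5 := mul_nonneg (inv_pos.2 hd).le hpos
    rwa [inv_mul_cancel_left₀ hd.ne'] at h5
  have h4 : (∑ i, ∑ j, f j ≫ symbolMap φ X Y X Y (∑ k, a k j ≫ dagger (a k i)) ≫ dagger (f i)) =
      ∑ k, ∑ i, ∑ j, f j ≫ symbolMap φ X Y X Y (a k j ≫ dagger (a k i)) ≫ dagger (f i) := by
    simp only [map_sum, Preadditive.sum_comp, Preadditive.comp_sum]
    conv_rhs => rw [Finset.sum_comm]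
    refine Finset.sum_congr rfl fun i _ => ?_
    rw [Finset.sum_comm]
  rw [h4, map_sum]
  exact Finset.sum_nonneg fun k _ => key k

end CompletePositivity

/-! ### Frobenius reciprocity and additivity of multiplicities. -/

section Multiplicities

variable {C : Type u} [Category.{v} C] [Preadditive C] [Linear ℂ C]
  [MonoidalCategory C] [MonoidalPreadditive C] [MonoidalLinear ℂ C] [CStarTensorCategory C]

/-- The adjoint is only conjugate-linear, but a bijection that is semilinear over conjugation still
preserves the rank. -/
theorem finrank_hom_symm (X Y : C) : Module.finrank ℂ (X ⟶ Y) = Module.finrank ℂ (Y ⟶ X) := by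
  have h := rank_eq_of_equiv_equiv (R := ℂ) (R' := ℂ) (M := X ⟶ Y) (M₁ := Y ⟶ X) star
    { daggerHom X Y with
      invFun := dagger
      left_inv := fun f => dagger_dagger f
      right_inv := fun f => dagger_dagger f }
    star_involutive.bijective fun r f => dagger_smul r f
  exact congrArg Cardinal.toNat h

theorem finrank_hom_congr_right (W : C) {X Y : C} (e : X ≅ Y) :
    Module.finrank ℂ (W ⟶ X) = Module.finrank ℂ (W ⟶ Y) :=
  LinearEquiv.finrank_eq (LinearEquiv.ofLinearMap (Linear.rightComp ℂ W e.hom)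
    (Linear.rightComp ℂ W e.inv) (by ext; simp) (by ext; simp))

theorem finrank_hom_congr_left (W : C) {X Y : C} (e : X ≅ Y) :
    Module.finrank ℂ (X ⟶ W) = Module.finrank ℂ (Y ⟶ W) := by
  rw [finrank_hom_symm, finrank_hom_congr_right W e, finrank_hom_symm]

theorem finrank_tensorRight {X Y : C}
    (q : ExactPairing X Y) (W A : C) :
    Module.finrank ℂ (W ⊗ X ⟶ A) = Module.finrank ℂ (W ⟶ A ⊗ Y) := by
  refine LinearEquiv.finrank_eq { @tensorRightHomEquiv C _ _ W X Y A q with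
    map_add' := fun f g => ?_
    map_smul' := fun c f => ?_ }
  · simp [tensorRightHomEquiv]
  · simp [tensorRightHomEquiv]

variable [RigidCStarTensorCategory C]

theorem finrank_tensorLeft (X W A : C) :
    Module.finrank ℂ (X ⊗ W ⟶ A) = Module.finrank ℂ (W ⟶ conj X ⊗ A) :=
  LinearEquiv.finrank_eq { curryConj X W A with
    invFun := fun g => X ◁ g ≫ evalConj X A
    left_inv := curryConj_evalConj
    right_inv := curryConj_eq }

theorem mult_congr (c : Irr C) {X Y : C} (e : X ≅ Y) : mult c X = mult c Y :=
  finrank_hom_congr_right _ e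

/-- Frobenius reciprocity. -/
theorem mult_conj_tensor (X : C) (b c : Irr C) :
    mult b (conj X ⊗ c.obj) = mult c (X ⊗ b.obj) := by
  rw [mult, mult, ← finrank_tensorLeft, finrank_hom_symm]

theorem mult_tensor_dual (a b c : Irr C) :
    mult c (a.obj ⊗ b.dual) = mult a (c.obj ⊗ b.obj) := by
  rw [mult, mult, finrank_hom_symm a.obj, finrank_tensorRight b.pairing]

theorem mult_conj_conj_tensor (X Y : C) (b c : Irr C) :
    mult b (conj (X ⊗ Y) ⊗ c.obj) = mult b (conj Y ⊗ (conj X ⊗ c.obj)) := by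
  rw [mult, mult, ← finrank_tensorLeft, ← finrank_tensorLeft, ← finrank_tensorLeft,
    finrank_hom_congr_left _ (α_ _ _ _)]

/-- Additivity of multiplicities. -/
theorem mult_eq_sum_of_directSum (c : Irr C) {X : C} {ι : Type*} [Fintype ι] {S : ι → C}
    (p : ∀ i, S i ⟶ X) (h1 : ∀ i, p i ≫ dagger (p i) = 𝟙 _) (h3 : ∑ i, dagger (p i) ≫ p i = 𝟙 X) :
    (mult c X : ℂ) = ∑ i, (mult c (S i) : ℂ) := by
  have h := trace_eq_sum_trace (fun i => Linear.rightComp ℂ c.obj (p i))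
    (fun i => Linear.rightComp ℂ c.obj (dagger (p i))) (fun x => ?_) (fun i y => ?_) LinearMap.id
    (fun i => LinearMap.id) (fun i x => rfl)
  · simpa [mult] using h
  · simp [← Preadditive.comp_sum, h3]
  · simp [h1]

theorem IrrDecomp.mult_tensor_right {X : C} (D : IrrDecomp X) (Y : C) (b : Irr C) :
    (mult b (Y ⊗ X) : ℂ) = ∑ i, (mult b (Y ⊗ (D.c i).obj) : ℂ) := by
  refine mult_eq_sum_of_directSum b (fun i => Y ◁ D.v i) (fun i => ?_) ?_
  · rw [dagger_whiskerLeft, ← MonoidalCategory.whiskerLeft_comp, D.v_self, whiskerLeft_id]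
  · simp only [dagger_whiskerLeft, ← MonoidalCategory.whiskerLeft_comp]
    rw [← whiskerLeft_sum, D.complete, whiskerLeft_id]

theorem IrrDecomp.mult_tensor_left {X : C} (D : IrrDecomp X) (Y : C) (b : Irr C) :
    (mult b (X ⊗ Y) : ℂ) = ∑ i, (mult b ((D.c i).obj ⊗ Y) : ℂ) := by
  refine mult_eq_sum_of_directSum b (fun i => D.v i ▷ Y) (fun i => ?_) ?_
  · rw [dagger_whiskerRight, ← comp_whiskerRight, D.v_self, id_whiskerRight]
  · simp only [dagger_whiskerRight, ← comp_whiskerRight]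
    rw [← sum_whiskerRight, D.complete, id_whiskerRight]

/-- A sum over the irreducible summands of an object, by multiplicities. -/
theorem IrrDecomp.sum_eq {X : C} (D : IrrDecomp X) {M : Type*} [AddCommMonoid M] [Module ℂ M]
    (f : Irr C → M) {F : Finset (Irr C)} (hF : ∀ i, D.c i ∈ F) :
    ∑ i, f (D.c i) = ∑ c ∈ F, (mult c X : ℂ) • f c := by
  classical
  simp only [D.mult_eq, Finset.sum_smul]
  rw [Finset.sum_comm]
  refine Finset.sum_congr rfl fun i _ => ?_
  simp [hF i]

/-- The irreducible objects that occur in an object. -/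
def irrSupport (X : C) : Finset (Irr C) := by
  classical exact Finset.univ.image (irrDecomp X).c

theorem mem_irrSupport (X : C) (i) : (irrDecomp X).c i ∈ irrSupport X := by
  classical exact Finset.mem_image_of_mem _ (Finset.mem_univ i)

theorem mult_eq_zero_of_notMem {X : C} {F : Finset (Irr C)} (hF : irrSupport X ⊆ F) {c : Irr C}
    (hc : c ∉ F) : mult c X = 0 := by
  classical
  have h := (irrDecomp X).mult_eq c
  rw [Finset.sum_eq_zero] at h
  · exact_mod_cast h
  · intro i _
    rw [if_neg]
    rintro rfl
    exact hc (hF (mem_irrSupport X i))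

theorem mult_tensor_right_eq {X : C} (Y : C) (b : Irr C) {F : Finset (Irr C)}
    (hF : irrSupport X ⊆ F) :
    (mult b (Y ⊗ X) : ℂ) = ∑ c ∈ F, (mult c X : ℂ) * mult b (Y ⊗ c.obj) := by
  rw [(irrDecomp X).mult_tensor_right, (irrDecomp X).sum_eq (fun c => (mult b (Y ⊗ c.obj) : ℂ))
    fun i => hF (mem_irrSupport X i)]
  rfl

theorem mult_tensor_left_eq {X : C} (Y : C) (b : Irr C) {F : Finset (Irr C)}
    (hF : irrSupport X ⊆ F) :
    (mult b (X ⊗ Y) : ℂ) = ∑ c ∈ F, (mult c X : ℂ) * mult b (c.obj ⊗ Y) := by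
  rw [(irrDecomp X).mult_tensor_left, (irrDecomp X).sum_eq (fun c => (mult b (c.obj ⊗ Y) : ℂ))
    fun i => hF (mem_irrSupport X i)]
  rfl

variable (C) in
/-- The class of the tensor unit. -/
def Irr.unit : Irr C := Irr.mk (𝟙_ C) RigidCStarTensorCategory.unit_irreducible

variable (C) in
theorem Irr.unit_iso : Nonempty ((Irr.unit C).obj ≅ 𝟙_ C) := by
  obtain ⟨w, h1, h2⟩ := Irr.exists_unitary (RigidCStarTensorCategory.unit_irreducible (C := C))
  exact ⟨⟨w, dagger w, h1, h2⟩⟩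

open Classical in
theorem mult_obj (b c : Irr C) : mult c b.obj = if c = b then 1 else 0 := by
  split_ifs with h
  · subst h
    exact c.obj_irreducible
  · have : Subsingleton (c.obj ⟶ b.obj) :=
      ⟨fun f g => by rw [Irr.hom_eq_zero h f, Irr.hom_eq_zero h g]⟩
    exact Module.finrank_zero_of_subsingleton

open Classical in
theorem mult_tensor_unit (b c : Irr C) :
    mult c (b.obj ⊗ (Irr.unit C).obj) = if c = b then 1 else 0 := by
  obtain ⟨e⟩ := Irr.unit_iso C
  rw [mult_congr c (whiskerLeftIso b.obj e ≪≫ ρ_ _), mult_obj]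

open Classical in
theorem mult_unit_tensor (b c : Irr C) :
    mult c ((Irr.unit C).obj ⊗ b.obj) = if c = b then 1 else 0 := by
  obtain ⟨e⟩ := Irr.unit_iso C
  rw [mult_congr c (whiskerRightIso e b.obj ≪≫ λ_ _), mult_obj]

end Multiplicities

/-! ### Coefficients of the regular representation are cp-multipliers. -/

section Positivity

variable {C : Type u} [Category.{v} C] [Preadditive C] [Linear ℂ C]
  [MonoidalCategory C] [MonoidalPreadditive C] [MonoidalLinear ℂ C] [CStarTensorCategory C]
  [RigidCStarTensorCategory C]

theorem trace_sandwich_eq_sum {T A : C} (k : A ⟶ T ⊗ A) {Q : C} (D : IrrDecomp Q) :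
    LinearMap.trace ℂ _ (sandwich (tensorCoaction k Q) k) =
      ∑ i, LinearMap.trace ℂ _ (sandwich (tensorCoaction k (D.c i).obj) k) := by
  refine trace_eq_sum_trace (fun i => Linear.leftComp ℂ A (A ◁ dagger (D.v i)))
    (fun i => Linear.leftComp ℂ A (A ◁ D.v i)) (fun x => ?_) (fun i y => ?_) _ _ fun i x => ?_
  · simp only [Linear.leftComp_apply, ← MonoidalCategory.whiskerLeft_comp_assoc]
    rw [← Preadditive.sum_comp, ← whiskerLeft_sum, D.complete]
    simp
  · simp only [Linear.leftComp_apply, ← MonoidalCategory.whiskerLeft_comp_assoc, D.v_self]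
    simp
  · simp only [Linear.leftComp_apply, sandwich_precomp]

/-- The coaction touches only the leg `A`, so Frobenius reciprocity in the leg `b` conjugates one
operator into the other. -/
theorem trace_sandwich_tensor_dual {T A : C} (k : A ⟶ T ⊗ A) (c b : Irr C) :
    LinearMap.trace ℂ _ (sandwich (tensorCoaction k (c.obj ⊗ b.dual)) k) =
      LinearMap.trace ℂ _ (sandwich (tensorCoaction k c.obj) (tensorCoaction k b.obj)) := by
  let q := daggerPairing b.pairing
  let e₀ := @tensorRightHomEquiv C _ _ (A ⊗ c.obj) b.dual b.obj A q
  have he₀ : ∀ f, e₀ f = (ρ_ _).inv ≫ _ ◁ q.coevaluation' ≫ (α_ _ _ _).inv ≫ f ▷ b.obj :=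
    fun f => rfl
  let e₁ : (A ⊗ (c.obj ⊗ b.dual) ⟶ A) ≃ₗ[ℂ] (A ⊗ c.obj ⟶ A ⊗ b.obj) :=
    { toFun := fun f => e₀ ((α_ _ _ _).hom ≫ f)
      invFun := fun g => (α_ _ _ _).inv ≫ e₀.symm g
      left_inv := fun f => by simp
      right_inv := fun g => by simp
      map_add' := fun f g => by simp [he₀]
      map_smul' := fun c f => by simp [he₀] }
  rw [← LinearMap.trace_conj' _ e₁]
  congr 1
  refine LinearMap.ext fun g => ?_
  obtain ⟨f, rfl⟩ := e₁.surjective g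
  rw [LinearEquiv.conj_apply_apply, LinearEquiv.symm_apply_apply]
  change e₀ ((α_ _ _ _).hom ≫ sandwich (tensorCoaction k (c.obj ⊗ b.dual)) k f) =
    sandwich (tensorCoaction k c.obj) (tensorCoaction k b.obj) (e₀ ((α_ _ _ _).hom ≫ f))
  rw [he₀, he₀, sandwich_apply, sandwich_apply]
  simp only [tensorCoaction, dagger_comp, dagger_whiskerRight, dagger_associator]
  symm
  calc _ = 𝟙 _ ⊗≫ ((k ▷ c.obj) ▷ 𝟙_ C ≫ ((T ⊗ A) ⊗ c.obj) ◁ q.coevaluation') ⊗≫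
        T ◁ f ▷ b.obj ⊗≫ dagger k ▷ b.obj := by monoidal
    _ = 𝟙 _ ⊗≫ ((A ⊗ c.obj) ◁ q.coevaluation' ≫ (k ▷ c.obj) ▷ (b.dual ⊗ b.obj)) ⊗≫
        T ◁ f ▷ b.obj ⊗≫ dagger k ▷ b.obj := by rw [whisker_exchange]
    _ = _ := by monoidal

/-- The `g`-component of a coaction. -/
def coactionComponent {T N : C} (k : N ⟶ T ⊗ N) (g : Irr C) : g.obj ⟶ T ⊗ g.obj :=
  ∑ j, (irrDecomp N).frame g j ≫ k ≫ T ◁ dagger ((irrDecomp N).frame g j)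

/-- For matrix units through an irreducible `g`, the diagonal coefficients of the sandwich operator
factor into a part from `k` and a part from `l`. This separation of variables makes the trace an
inner product. -/
theorem trace_sandwich {T N N' : C} (k : N ⟶ T ⊗ N) (l : N' ⟶ T ⊗ N') {G : Finset (Irr C)}
    (hG : irrSupport N ⊆ G) :
    LinearMap.trace ℂ _ (sandwich k l) = ∑ g ∈ G,
      g.obj_irreducible.scalar (coactionComponent k g ≫ dagger (coactionComponent l g)) := by
  rw [trace_eq_sum_of_frame (ι := G × Fin (irrDecomp N).n × Fin (irrDecomp N').n)
    (fun x => dagger ((irrDecomp N).frame x.1 x.2.1) ≫ (irrDecomp N').frame x.1 x.2.2)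
    (fun x => (x.1 : Irr C).obj_irreducible.scalar ∘ₗ
      Linear.leftComp ℂ _ ((irrDecomp N).frame x.1 x.2.1) ∘ₗ
      Linear.rightComp ℂ _ (dagger ((irrDecomp N').frame x.1 x.2.2))) (fun x => ?_),
    Fintype.sum_prod_type, ← Finset.sum_coe_sort G]
  · refine Finset.sum_congr rfl fun g _ => ?_
    rw [Fintype.sum_prod_type]
    simp only [coactionComponent, dagger_sum, Preadditive.sum_comp, Preadditive.comp_sum, map_sum,
      LinearMap.comp_apply, Linear.leftComp_apply, Linear.rightComp_apply, sandwich_apply]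
    conv_rhs => rw [Finset.sum_comm]
    simp
  · rw [Fintype.sum_prod_type, Finset.sum_coe_sort G (fun g => ∑ y : Fin _ × Fin _,
      ((g.obj_irreducible.scalar ∘ₗ Linear.leftComp ℂ _ ((irrDecomp N).frame g y.1) ∘ₗ
      Linear.rightComp ℂ _ (dagger ((irrDecomp N').frame g y.2))) x) •
      (dagger ((irrDecomp N).frame g y.1) ≫ (irrDecomp N').frame g y.2))]
    conv_rhs => rw [expand_frame x fun i => hG (mem_irrSupport N i)]
    refine Finset.sum_congr rfl fun g _ => ?_
    rw [Fintype.sum_prod_type]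
    rfl

/-- The matrix coefficients `γ ↦ d(γ)⁻¹ ⟨γ ξ, ξ⟩` of the regular representation, for finitely
supported `ξ`. -/
def regularCoeff (S : Finset (Irr C)) (ξ : Irr C → ℂ) (a : Irr C) : ℂ :=
  (a.dim : ℂ)⁻¹ * ∑ b ∈ S, ∑ c ∈ S, star (ξ c) * ξ b * mult c (a.obj ⊗ b.obj)

/-- The dimensions cancel. Since `mult c (a.obj ⊗ b.obj)` is the multiplicity of `a` in `c.obj ⊗
b.dual`, summing over `a` reassembles the trace on the morphisms out of `A ⊗ (c.obj ⊗ b.dual)`. -/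
theorem symbolForm_regularCoeff {T A : C} (S : Finset (Irr C)) (ξ : Irr C → ℂ) (k : A ⟶ T ⊗ A)
    {F : Finset (Irr C)} (hF : ∀ b ∈ S, ∀ c ∈ S, irrSupport (c.obj ⊗ b.dual) ⊆ F) :
    symbolForm (regularCoeff S ξ) F k = ∑ b ∈ S, ∑ c ∈ S, star (ξ c) * ξ b *
      LinearMap.trace ℂ _ (sandwich (tensorCoaction k c.obj) (tensorCoaction k b.obj)) := by
  have h2 : ∀ b ∈ S, ∀ c ∈ S, LinearMap.trace ℂ _
      (sandwich (tensorCoaction k c.obj) (tensorCoaction k b.obj)) =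
      ∑ a ∈ F, (mult c (a.obj ⊗ b.obj) : ℂ) *
        LinearMap.trace ℂ _ (sandwich (tensorCoaction k a.obj) k) := by
    intro b hb c hc
    rw [← trace_sandwich_tensor_dual, trace_sandwich_eq_sum k (irrDecomp _),
      (irrDecomp (c.obj ⊗ b.dual)).sum_eq (fun a => LinearMap.trace ℂ _
        (sandwich (tensorCoaction k a.obj) k)) fun i => hF b hb c hc (mem_irrSupport _ i)]
    refine Finset.sum_congr rfl fun a _ => ?_
    rw [mult_tensor_dual, smul_eq_mul]
  have h3 : ∀ a ∈ F, regularCoeff S ξ a * (a.dim * LinearMap.trace ℂ _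
      (sandwich (tensorCoaction k a.obj) k)) = ∑ b ∈ S, ∑ c ∈ S, star (ξ c) * ξ b *
        ((mult c (a.obj ⊗ b.obj) : ℂ) *
          LinearMap.trace ℂ _ (sandwich (tensorCoaction k a.obj) k)) := by
    intro a _
    have hd : (a.dim : ℂ) ≠ 0 := by exact_mod_cast a.dim_pos.ne'
    generalize LinearMap.trace ℂ _ (sandwich (tensorCoaction k a.obj) k) = t
    rw [regularCoeff, mul_comm (a.dim : ℂ)⁻¹, mul_assoc, inv_mul_cancel_left₀ hd]
    simp only [Finset.sum_mul, mul_assoc]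
  rw [symbolForm, Finset.sum_congr rfl h3, Finset.sum_comm]
  refine Finset.sum_congr rfl fun b hb => ?_
  rw [Finset.sum_comm]
  refine Finset.sum_congr rfl fun c hc => ?_
  rw [h2 b hb c hc, Finset.mul_sum]

/-- With each trace written as an inner product by `trace_sandwich`, the double sum becomes a sum
over `g` of squared lengths. -/
theorem sum_trace_sandwich_nonneg {T A : C} (S : Finset (Irr C)) (ξ : Irr C → ℂ) (k : A ⟶ T ⊗ A) :
    0 ≤ ∑ b ∈ S, ∑ c ∈ S, star (ξ c) * ξ b *
      LinearMap.trace ℂ _ (sandwich (tensorCoaction k c.obj) (tensorCoaction k b.obj)) := by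
  classical
  let G : Finset (Irr C) := S.biUnion fun c => irrSupport (A ⊗ c.obj)
  have hG : ∀ c ∈ S, irrSupport (A ⊗ c.obj) ⊆ G := fun c hc =>
    Finset.subset_biUnion_of_mem (fun c => irrSupport (A ⊗ c.obj)) hc
  have h3 : ∑ b ∈ S, ∑ c ∈ S, star (ξ c) * ξ b *
      LinearMap.trace ℂ _ (sandwich (tensorCoaction k c.obj) (tensorCoaction k b.obj)) =
      ∑ g ∈ G, g.obj_irreducible.scalar
        ((∑ c ∈ S, star (ξ c) • coactionComponent (tensorCoaction k c.obj) g) ≫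
          dagger (∑ b ∈ S, star (ξ b) • coactionComponent (tensorCoaction k b.obj) g)) := by
    simp only [dagger_sum, dagger_smul, star_star, Preadditive.sum_comp, Preadditive.comp_sum,
      Linear.smul_comp, Linear.comp_smul, map_sum, map_smul, smul_eq_mul, Finset.mul_sum]
    rw [Finset.sum_comm (s := G)]
    refine Finset.sum_congr rfl fun b _ => ?_
    rw [Finset.sum_comm (s := G)]
    refine Finset.sum_congr rfl fun c hc => ?_
    rw [trace_sandwich _ _ (hG c hc), Finset.mul_sum]
    exact Finset.sum_congr rfl fun g _ => by ring
  rw [h3]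
  exact Finset.sum_nonneg fun g _ => g.obj_irreducible.scalar_comp_dagger_nonneg _

theorem exists_finset_irrSupport (X : C) {ι : Type*} (S : Finset ι) (Y : ι → ι → C) :
    ∃ F : Finset (Irr C), irrSupport X ⊆ F ∧ ∀ b ∈ S, ∀ c ∈ S, irrSupport (Y b c) ⊆ F := by
  classical
  refine ⟨irrSupport X ∪ (S ×ˢ S).biUnion fun x => irrSupport (Y x.1 x.2),
    Finset.subset_union_left, fun b hb c hc => ?_⟩
  exact (Finset.subset_biUnion_of_mem (fun x : ι × ι => irrSupport (Y x.1 x.2))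
    (Finset.mk_mem_product hb hc)).trans Finset.subset_union_right

theorem isCpMultiplier_regularCoeff (S : Finset (Irr C)) (ξ : Irr C → ℂ) :
    IsCpMultiplier (regularCoeff S ξ) := by
  refine isCpMultiplier_of_symbolForm_nonneg ?_
  intro A B T p _ k
  obtain ⟨F, hF1, hF2⟩ := exists_finset_irrSupport (B ⊗ A) S fun b c => c.obj ⊗ b.dual
  refine ⟨F, fun i => hF1 (mem_irrSupport _ i), ?_⟩
  rw [symbolForm_regularCoeff S ξ k hF2]
  exact sum_trace_sandwich_nonneg S ξ k

end Positivity

/-! ### The fusion algebra and the functionals given by symbols. -/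

section FusionAlgebra

variable {C : Type u} [Category.{v} C] [Preadditive C] [Linear ℂ C]
  [MonoidalCategory C] [MonoidalPreadditive C] [MonoidalLinear ℂ C] [CStarTensorCategory C]
  [RigidCStarTensorCategory C]

namespace FusionAlgebra

/-- The linear map on the fusion algebra with given values on the basis. -/
def lift {M : Type*} [AddCommGroup M] [Module ℂ M] (f : Irr C → M) : FusionAlgebra C →ₗ[ℂ] M :=
  Finsupp.linearCombination ℂ f

variable {M : Type*} [AddCommGroup M] [Module ℂ M]

theorem lift_apply (f : Irr C → M) (x : FusionAlgebra C) :
    lift f x = Finsupp.sum (show Irr C →₀ ℂ from x) fun a r => r • f a := rfl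

@[simp] theorem lift_basisElt (f : Irr C → M) (a : Irr C) : lift f (basisElt a) = f a := by
  rw [lift, basisElt]
  exact (Finsupp.linearCombination_single ℂ 1 a).trans (one_smul _ _)

theorem lift_objClass (f : Irr C → M) {X : C} (D : IrrDecomp X) :
    lift f (objClass X) = ∑ i, f (D.c i) := by
  rw [D.objClass_eq, map_sum]
  simp

theorem hom_ext {f g : FusionAlgebra C →ₗ[ℂ] M} (h : ∀ a, f (basisElt a) = g (basisElt a)) :
    f = g :=
  Finsupp.lhom_ext' fun a => LinearMap.ext_ring (h a)

theorem eq_sum (x : FusionAlgebra C) : ∃ (S : Finset (Irr C)) (r : Irr C → ℂ),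
    x = ∑ a ∈ S, r a • basisElt a := by
  refine ⟨(show Irr C →₀ ℂ from x).support, (show Irr C →₀ ℂ from x), ?_⟩
  refine (Finsupp.sum_single (show Irr C →₀ ℂ from x)).symm.trans ?_
  refine Finset.sum_congr rfl fun a _ => ?_
  exact ((Finsupp.smul_single _ _ _).trans (by rw [smul_eq_mul, mul_one])).symm

/-- The product as a bilinear map. -/
def mulHom : FusionAlgebra C →ₗ[ℂ] FusionAlgebra C →ₗ[ℂ] FusionAlgebra C :=
  lift fun a => lift fun b => objClass (a.obj ⊗ b.obj)

theorem mul_eq (x y : FusionAlgebra C) : x * y = mulHom x y := by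
  rw [mulHom]
  rw [lift_apply, Finsupp.sum, LinearMap.sum_apply]
  refine Finset.sum_congr rfl fun a _ => ?_
  rw [LinearMap.smul_apply, lift_apply, Finsupp.sum, Finset.smul_sum]
  refine Finset.sum_congr rfl fun b _ => ?_
  rw [smul_smul]

theorem basisElt_mul_basisElt (a b : Irr C) :
    basisElt a * basisElt b = objClass (a.obj ⊗ b.obj) := by
  simp [mul_eq, mulHom]

theorem objClass_mul_basisElt (X : C) (b : Irr C) :
    objClass X * basisElt b = objClass (X ⊗ b.obj) := by
  rw [(irrDecomp X).objClass_eq, mul_eq, map_sum, LinearMap.sum_apply]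
  simp only [← mul_eq, basisElt_mul_basisElt]
  refine Finsupp.ext fun c => ?_
  rw [show (∑ i, objClass (((irrDecomp X).c i).obj ⊗ b.obj) : FusionAlgebra C) =
    ∑ i, (show Irr C →₀ ℂ from objClass (((irrDecomp X).c i).obj ⊗ b.obj)) from rfl,
    Finsupp.finsetSum_apply]
  exact ((irrDecomp X).mult_tensor_left b.obj c).symm

/-- The involution as an antilinear map. -/
def starHom : FusionAlgebra C →ₛₗ[starRingEnd ℂ] FusionAlgebra C where
  toFun := star
  map_add' x y := Finsupp.sum_add_index' (fun a => by simp) fun a r s => by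
    rw [star_add, add_smul]
  map_smul' c x := (Finsupp.sum_smul_index (fun a => by simp)).trans
    ((Finset.sum_congr rfl fun a _ =>
      (congrArg (· • objClass (conj a.obj)) (star_mul' c _)).trans (mul_smul _ _ _)).trans
      Finset.smul_sum.symm)

theorem star_basisElt (a : Irr C) : star (basisElt a) = objClass (conj a.obj) :=
  (Finsupp.sum_single_index (by simp)).trans (by simp)

theorem star_sum_mul_sum (S : Finset (Irr C)) (r : Irr C → ℂ) :
    star (∑ a ∈ S, r a • basisElt a) * (∑ b ∈ S, r b • basisElt b) =
      ∑ a ∈ S, ∑ b ∈ S, (star (r a) * r b) • objClass (conj a.obj ⊗ b.obj) := by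
  have h : star (∑ a ∈ S, r a • basisElt a : FusionAlgebra C) =
      ∑ a ∈ S, star (r a) • objClass (conj a.obj) := by
    change starHom _ = _
    rw [map_sum]
    refine Finset.sum_congr rfl fun a _ => ?_
    rw [map_smulₛₗ]
    exact congrArg _ (star_basisElt a)
  rw [h, mul_eq]
  simp only [map_sum, LinearMap.sum_apply, map_smul, LinearMap.smul_apply, ← mul_eq,
    objClass_mul_basisElt, Finset.smul_sum, smul_smul]
  rw [Finset.sum_comm]
  exact Finset.sum_congr rfl fun a _ => Finset.sum_congr rfl fun b _ => by rw [mul_comm]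

end FusionAlgebra

open FusionAlgebra

/-- The linear functional `α ↦ d(α) φ(α)` on the fusion algebra. -/
def symbolFunctional (φ : Irr C → ℂ) : FusionAlgebra C →ₗ[ℂ] ℂ := lift fun a => a.dim * φ a

theorem symbolFunctional_objClass (φ : Irr C → ℂ) {X : C} {F : Finset (Irr C)}
    (hF : irrSupport X ⊆ F) :
    symbolFunctional φ (objClass X) = ∑ c ∈ F, (mult c X : ℂ) * (c.dim * φ c) := by
  rw [symbolFunctional, lift_objClass _ (irrDecomp X),
    (irrDecomp X).sum_eq (fun c => (c.dim : ℂ) * φ c) fun i => hF (mem_irrSupport X i)]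
  rfl

theorem symbolMap_id (φ : Irr C → ℂ) (X Y : C) :
    symbolMap φ X Y X Y (𝟙 _) = φ (Irr.unit C) • 𝟙 _ := by
  have h := symbolMap_factorization φ (λ_ Y).inv (ρ_ X).hom
  rw [isotypic_of_irreducible φ RigidCStarTensorCategory.unit_irreducible] at h
  have h1 : X ◁ (λ_ Y).inv ≫ (α_ _ _ _).inv ≫ (ρ_ X).hom ▷ Y = 𝟙 _ := by monoidal
  simp only [MonoidalLinear.smul_whiskerRight, Linear.comp_smul, MonoidalLinear.whiskerLeft_smul,
    Linear.smul_comp, id_whiskerRight, Category.comp_id] at h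
  rwa [h1] at h

/-- Positivity is applied to the projection 1 - d⁻¹ s s*, with s a standard coevaluation and d =
d(X). The identity contributes d φ(ε). The term s s* comes from the trivial coaction, whose traces
are the multiplicities in `conj X ⊗ X`. Matrix coefficients turn this inequality into norm bounds by
the dimension. -/
theorem IsCpMultiplier.symbolFunctional_le {φ : Irr C → ℂ} (hφ : IsCpMultiplier φ) {X : C}
    (hX : 0 < catDim X) :
    symbolFunctional φ (objClass (conj X ⊗ X)) ≤ (catDim X : ℂ) ^ 2 * φ (Irr.unit C) := by
  classical
  have hu : IsIrreducible (𝟙_ C) := RigidCStarTensorCategory.unit_irreducible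
  obtain ⟨B, p, hp⟩ := exists_isStandard X
  have hs := hp.coevaluation_catDim
  set d : ℂ := (catDim X : ℂ) with hd
  have hd0 : (0 : ℂ) < d := by rw [hd]; exact_mod_cast hX
  have hds : star d = d := Complex.conj_ofReal _
  set s := p.coevaluation' with hsdef
  have hpos := hφ.map_nonneg s (𝟙 (X ⊗ B) - d⁻¹ • (dagger s ≫ s))
  have h1 : (𝟙 (X ⊗ B) - d⁻¹ • (dagger s ≫ s)) ≫ dagger (𝟙 (X ⊗ B) - d⁻¹ • (dagger s ≫ s)) =
      𝟙 (X ⊗ B) - d⁻¹ • (dagger s ≫ s) := by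
    have h2 : (dagger s ≫ s) ≫ (dagger s ≫ s) = d • (dagger s ≫ s) := by
      rw [Category.assoc, ← Category.assoc s, hs]
      simp
    simp only [dagger_sub, dagger_smul, dagger_comp, dagger_dagger, dagger_id, star_inv₀, hds,
      Preadditive.sub_comp, Preadditive.comp_sub, Category.id_comp, Category.comp_id,
      Linear.smul_comp, Linear.comp_smul, h2, smul_smul]
    rw [inv_mul_cancel₀ hd0.ne', one_smul, sub_self, smul_zero, sub_zero]
  let F := irrSupport (B ⊗ X) ∪ irrSupport (conj X ⊗ X)
  have h3 := symbolMap_bend hp φ (F := F)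
    (fun i => Finset.subset_union_left (mem_irrSupport _ i)) (λ_ X).inv
  have h4 : bend p (λ_ X).inv = dagger s := by
    rw [bend, ← hsdef]
    simp [unitors_inv_equal]
  have h5 : symbolForm φ F (λ_ X).inv = symbolFunctional φ (objClass (conj X ⊗ X)) := by
    rw [symbolFunctional_objClass φ (F := F) Finset.subset_union_right, symbolForm]
    refine Finset.sum_congr rfl fun a _ => ?_
    have h6 : sandwich (tensorCoaction (λ_ X).inv a.obj) (λ_ X).inv = LinearMap.id := by
      ext f
      rw [sandwich_apply, tensorCoaction]
      simp
    rw [h6, LinearMap.trace_id, finrank_tensorLeft, ← mult]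
    ring
  rw [h1, map_sub, map_smul, symbolMap_id] at hpos
  rw [h4, dagger_dagger, h5] at h3
  have h7 : s ≫ (φ (Irr.unit C) • 𝟙 (X ⊗ B) - d⁻¹ • symbolMap φ X B X B (dagger s ≫ s)) ≫
      dagger s = (d * φ (Irr.unit C) - d⁻¹ * symbolFunctional φ (objClass (conj X ⊗ X))) •
        𝟙 (𝟙_ C) := by
    rw [Preadditive.sub_comp, Preadditive.comp_sub, Linear.smul_comp, Linear.smul_comp,
      Linear.comp_smul, Linear.comp_smul, h3, Category.id_comp, hs, smul_smul, smul_smul, sub_smul,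
      mul_comm d]
  rw [h7, map_smul, IsIrreducible.scalar_id, smul_eq_mul, mul_one] at hpos
  have h8 := mul_nonneg hd0.le hpos
  rw [mul_sub, mul_inv_cancel_left₀ hd0.ne', ← mul_assoc, ← sq] at h8
  exact sub_nonneg.1 h8

/-- The functional given by a cp-multiplier is positive. -/
theorem IsCpMultiplier.symbolFunctional_nonneg {φ : Irr C → ℂ} (hφ : IsCpMultiplier φ)
    (x : FusionAlgebra C) : 0 ≤ symbolFunctional φ (star x * x) := by
  obtain ⟨S, r, rfl⟩ := eq_sum x
  obtain ⟨A, p, hp1, hp2, hp3⟩ := exists_directSum_fintype fun a : S => (a : Irr C).obj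
  obtain ⟨B, q, hq⟩ := exists_isStandard A
  obtain ⟨F, hF1, hF2⟩ := exists_finset_irrSupport (B ⊗ A) S fun a b => conj a.obj ⊗ b.obj
  -- The coefficients of the element of the fusion algebra form a diagonal endomorphism, read as a
  -- coaction with `T` the unit. On morphisms from `a ⊗ c` to `b` the sandwich operator is
  -- multiplication by `star (r a) * r b`, and that space has dimension `mult c (conj a ⊗ b)`.
  let m : A ⟶ A := ∑ a : S, star (r a) • (dagger (p a) ≫ p a)
  have hm : ∀ a, p a ≫ m = star (r a) • p a := by
    intro a
    rw [Preadditive.comp_sum, Finset.sum_eq_single_of_mem a (Finset.mem_univ a)]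
    · rw [Linear.comp_smul, ← Category.assoc, hp1, Category.id_comp]
    · intro b _ hb
      rw [Linear.comp_smul, ← Category.assoc, hp2 _ _ hb.symm, Limits.zero_comp, smul_zero]
  have hm' : ∀ a, dagger m ≫ dagger (p a) = r a • dagger (p a) := by
    intro a
    rw [← dagger_comp, hm, dagger_smul, star_star]
  have htr : ∀ c : Irr C, LinearMap.trace ℂ _
      (sandwich (tensorCoaction (m ≫ (λ_ A).inv) c.obj) (m ≫ (λ_ A).inv)) =
      ∑ a ∈ S, ∑ b ∈ S, star (r a) * r b * mult c (conj a.obj ⊗ b.obj) := by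
    intro c
    have h := trace_eq_sum_trace (ι := S × S) (W := fun x => (x.1 : Irr C).obj ⊗ c.obj ⟶ x.2.1.obj)
      (fun x => Linear.leftComp ℂ _ (dagger (p x.1) ▷ c.obj) ∘ₗ Linear.rightComp ℂ _ (p x.2))
      (fun x => Linear.leftComp ℂ _ (p x.1 ▷ c.obj) ∘ₗ Linear.rightComp ℂ _ (dagger (p x.2)))
      (fun x => ?_) (fun x y => ?_)
      (sandwich (tensorCoaction (m ≫ (λ_ A).inv) c.obj) (m ≫ (λ_ A).inv))
      (fun x => (star (r x.1) * r x.2) • LinearMap.id) fun x f => ?_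
    · rw [h, Fintype.sum_prod_type, ← Finset.sum_coe_sort S]
      refine Finset.sum_congr rfl fun a _ => ?_
      rw [← Finset.sum_coe_sort S]
      refine Finset.sum_congr rfl fun b _ => ?_
      rw [map_smul, LinearMap.trace_id, finrank_tensorLeft, mult, smul_eq_mul]
    · calc _ = ∑ a : S, ∑ b : S, (dagger (p a) ≫ p a) ▷ c.obj ≫ x ≫ (dagger (p b) ≫ p b) := by
            rw [Fintype.sum_prod_type]
            simp
        _ = x := by
            simp only [← Preadditive.comp_sum, ← Preadditive.sum_comp, hp3, ← sum_whiskerRight]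
            simp
    · simp only [LinearMap.comp_apply, Linear.leftComp_apply, Linear.rightComp_apply,
        Category.assoc, hp1, Category.comp_id]
      rw [← comp_whiskerRight_assoc, hp1, id_whiskerRight, Category.id_comp]
    · have e : sandwich (tensorCoaction (m ≫ (λ_ A).inv) c.obj) (m ≫ (λ_ A).inv) f =
          m ▷ c.obj ≫ f ≫ dagger m := by
        rw [sandwich_apply, tensorCoaction]
        simp
      simp only [LinearMap.comp_apply, Linear.leftComp_apply, Linear.rightComp_apply, e,
        Category.assoc, hm', Linear.comp_smul, LinearMap.smul_apply, LinearMap.id_apply]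
      rw [← comp_whiskerRight_assoc, hm, MonoidalLinear.smul_whiskerRight, Linear.smul_comp,
        smul_smul, mul_comm]
  have h := hφ.symbolForm_nonneg hq (fun i => hF1 (mem_irrSupport _ i)) (m ≫ (λ_ A).inv)
  convert h using 1
  rw [star_sum_mul_sum, symbolForm]
  simp only [htr, map_sum, map_smul, smul_eq_mul, Finset.mul_sum]
  rw [Finset.sum_comm (s := F)]
  refine Finset.sum_congr rfl fun a ha => ?_
  rw [Finset.sum_comm (s := F)]
  refine Finset.sum_congr rfl fun b hb => ?_
  rw [symbolFunctional_objClass φ (hF2 a ha b hb), Finset.mul_sum]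
  exact Finset.sum_congr rfl fun c _ => by ring

end FusionAlgebra

/-! ### Products, constants and pointwise limits of cp-multipliers. -/

section CpMultipliers

variable {C : Type u} [Category.{v} C] [Preadditive C] [Linear ℂ C]
  [MonoidalCategory C] [MonoidalPreadditive C] [MonoidalLinear ℂ C] [CStarTensorCategory C]
  [RigidCStarTensorCategory C]

/-- The composition of two multipliers. -/
def Multiplier.comp (θ ψ : Multiplier C) : Multiplier C where
  map X Y := θ.map X Y ∘ₗ ψ.map X Y
  map_comp f g h k T := by
    rw [LinearMap.comp_apply, LinearMap.comp_apply, ψ.map_comp, θ.map_comp]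
  map_amplify X₂ Y₂ T := by
    rw [LinearMap.comp_apply, LinearMap.comp_apply, ψ.map_amplify, θ.map_amplify]

/-- Composing the multipliers multiplies the symbols, and complete positivity passes to composites.
-/
theorem IsCpMultiplier.mul {φ ψ : Irr C → ℂ} (hφ : IsCpMultiplier φ) (hψ : IsCpMultiplier ψ) :
    IsCpMultiplier fun a => φ a * ψ a := by
  obtain ⟨θ, ⟨E, hE⟩, hθ⟩ := hφ
  obtain ⟨θ', ⟨E', hE'⟩, hθ'⟩ := hψ
  refine ⟨θ.comp θ', ⟨⟨fun X Y Z W => E.map X Y Z W ∘ₗ E'.map X Y Z W, fun X Y => ?_,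
    fun f g h k T => ?_⟩, fun X Y hX p w => ?_⟩, fun X Y n a => ?_⟩
  · rw [E.map_self, E'.map_self]
    rfl
  · rw [LinearMap.comp_apply, LinearMap.comp_apply, E'.map_comp, E.map_comp]
  · change E.map X Y _ _ (E'.map X Y _ _ w) = _
    rw [hE' X Y hX p, map_smul, hE X Y hX p, smul_smul, mul_comm]
  · obtain ⟨b, hb⟩ := hθ' X Y n a
    obtain ⟨c, hc⟩ := hθ X Y n b
    refine ⟨c, fun i j => ?_⟩
    rw [← hc, ← hb]
    rfl

/-- Nonnegative constants are cp-multipliers. -/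
theorem isCpMultiplier_const {r : ℝ} (hr : 0 ≤ r) : IsCpMultiplier fun _ : Irr C => (r : ℂ) := by
  obtain ⟨z, hz⟩ : ∃ z : ℂ, (r : ℂ) = z := ⟨_, rfl⟩
  rw [hz]
  refine ⟨⟨fun X Y => z • LinearMap.id, fun f g h k T => by simp,
    fun X₂ Y₂ T => by simp [amplify]⟩, ⟨⟨fun X Y Z W => z • LinearMap.id, fun X Y => rfl,
    fun f g h k T => by simp⟩, fun X Y hX p w => rfl⟩, fun X Y n a => ?_⟩
  refine ⟨fun k j => (Real.sqrt r : ℂ) • a k j, fun i j => ?_⟩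
  simp only [LinearMap.smul_apply, LinearMap.id_apply, Finset.smul_sum, dagger_smul,
    Linear.smul_comp, Linear.comp_smul, smul_smul]
  refine Finset.sum_congr rfl fun k _ => ?_
  congr 1
  rw [← hz, Complex.star_def, Complex.conj_ofReal, ← Complex.ofReal_mul, Real.mul_self_sqrt hr]

/-- Pointwise limits of cp-multipliers are cp-multipliers. -/
theorem isCpMultiplier_of_tendsto {ι : Type*} {l : Filter ι} [l.NeBot] {φ : ι → Irr C → ℂ}
    {ψ : Irr C → ℂ} (hφ : ∀ i, IsCpMultiplier (φ i))
    (h : ∀ a, Filter.Tendsto (fun i => φ i a) l (nhds (ψ a))) : IsCpMultiplier ψ := by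
  refine isCpMultiplier_of_symbolForm_nonneg ?_
  intro A B T p hp k
  refine ⟨irrSupport (B ⊗ A), mem_irrSupport _, ?_⟩
  -- Each quadratic form is a finite sum over the fixed constituents of `B ⊗ A`, hence continuous
  -- for pointwise convergence of symbols.
  refine ge_of_tendsto' (f := fun i => symbolForm (φ i) (irrSupport (B ⊗ A)) k) (x := l) ?_
    fun i => (hφ i).symbolForm_nonneg hp (mem_irrSupport _) k
  exact tendsto_finsetSum _ fun a _ => (h a).mul_const _

end CpMultipliers

open FusionAlgebra

/-! ### The regular representation on ℓ². -/

section RegularRepresentation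

variable {C : Type u} [Category.{v} C] [Preadditive C] [Linear ℂ C]
  [MonoidalCategory C] [MonoidalPreadditive C] [MonoidalLinear ℂ C] [CStarTensorCategory C]
  [RigidCStarTensorCategory C]

/-- The additive extension of a function on `Irr C` to all objects. -/
def objectSum (ξ : Irr C → ℂ) (Z : C) : ℂ := ∑ i, ξ ((irrDecomp Z).c i)

theorem objectSum_eq (ξ : Irr C → ℂ) {Z : C} {F : Finset (Irr C)} (hF : irrSupport Z ⊆ F) :
    objectSum ξ Z = ∑ c ∈ F, (mult c Z : ℂ) * ξ c :=
  (irrDecomp Z).sum_eq ξ fun i => hF (mem_irrSupport Z i)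

theorem objectSum_eq_of_support {ξ : Irr C → ℂ} {R : Finset (Irr C)} (hξ : ∀ b, b ∉ R → ξ b = 0)
    (Z : C) : objectSum ξ Z = ∑ c ∈ R, (mult c Z : ℂ) * ξ c := by
  classical
  rw [objectSum_eq ξ (F := irrSupport Z ∪ R) Finset.subset_union_left]
  refine (Finset.sum_subset Finset.subset_union_right fun c _ hc => ?_).symm
  rw [hξ c hc, mul_zero]

theorem objectSum_congr {ξ : Irr C → ℂ} {X Y : C} (h : ∀ b : Irr C, mult b X = mult b Y) :
    objectSum ξ X = objectSum ξ Y := by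
  classical
  rw [objectSum_eq ξ (F := irrSupport X ∪ irrSupport Y) Finset.subset_union_left,
    objectSum_eq ξ (F := irrSupport X ∪ irrSupport Y) Finset.subset_union_right]
  simp only [h]

theorem sum_objectSum {ι : Type*} (S : Finset ι) (X : ι → C) (Y : C) (ξ : Irr C → ℂ)
    (h : ∀ b : Irr C, (mult b Y : ℂ) = ∑ i ∈ S, (mult b (X i) : ℂ)) :
    ∑ i ∈ S, objectSum ξ (X i) = objectSum ξ Y := by
  classical
  obtain ⟨F, h1, h2⟩ := exists_finset_irrSupport Y S fun i _ => X i
  rw [objectSum_eq ξ h1, Finset.sum_congr rfl fun i hi => objectSum_eq ξ (h2 i hi i hi),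
    Finset.sum_comm]
  simp only [h, Finset.sum_mul]

theorem objectSum_objectSum (ξ : Irr C → ℂ) (Y Z : C) :
    objectSum (fun c => objectSum ξ (Y ⊗ c.obj)) Z = objectSum ξ (Y ⊗ Z) :=
  sum_objectSum _ _ _ ξ fun b => (irrDecomp Z).mult_tensor_right Y b

/-- The chosen representative is only isomorphic to the unit, but its tensor square has the class of
the unit, so its positive dimension satisfies d² = d. -/
theorem Irr.dim_unit : (Irr.unit C).dim = 1 := by
  classical
  have h1 := catDim_tensor (Irr.unit C).obj (Irr.unit C).obj
  have h2 : (catDim ((Irr.unit C).obj ⊗ (Irr.unit C).obj) : ℂ) = (Irr.unit C).dim := by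
    rw [(irrDecomp _).catDim_eq]
    push_cast
    rw [(irrDecomp ((Irr.unit C).obj ⊗ (Irr.unit C).obj)).sum_eq (fun c => (c.dim : ℂ))
      (F := irrSupport ((Irr.unit C).obj ⊗ (Irr.unit C).obj) ∪ {Irr.unit C})
      fun i => Finset.subset_union_left (mem_irrSupport _ i)]
    rw [Finset.sum_eq_single_of_mem (Irr.unit C) (by simp)]
    · simp [mult_tensor_unit]
    · intro b _ hb
      simp [mult_tensor_unit, hb]
  rw [h1, Irr.catDim_obj] at h2
  have h3 : (Irr.unit C).dim * (Irr.unit C).dim = (Irr.unit C).dim := by exact_mod_cast h2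
  exact mul_left_cancel₀ (Irr.unit C).dim_pos.ne' (h3.trans (mul_one _).symm)

theorem regularCoeff_unit (S : Finset (Irr C)) (ξ : Irr C → ℂ) :
    regularCoeff S ξ (Irr.unit C) = ((∑ b ∈ S, ‖ξ b‖ ^ 2 : ℝ) : ℂ) := by
  classical
  rw [regularCoeff, Irr.dim_unit]
  push_cast
  rw [inv_one, one_mul]
  refine Finset.sum_congr rfl fun b hb => ?_
  rw [Finset.sum_eq_single_of_mem b hb]
  · rw [mult_unit_tensor, if_pos rfl, Nat.cast_one, mul_one, Complex.star_def, Complex.conj_mul']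
  · intro c _ hc
    rw [mult_unit_tensor, if_neg hc, Nat.cast_zero, mul_zero]

/-- The squared norm of a ξ is the functional of the coefficient of ξ at ā a. By
`IsCpMultiplier.symbolFunctional_le` it is at most d(a)² times the value at the unit, which is ‖ξ‖²:
boundedness follows from complete positivity of the coefficients. -/
theorem sum_norm_objectSum_le (a : Irr C) {ξ : Irr C → ℂ} {R : Finset (Irr C)}
    (hξ : ∀ b, b ∉ R → ξ b = 0) (S : Finset (Irr C)) :
    ∑ c ∈ S, ‖objectSum ξ (conj a.obj ⊗ c.obj)‖ ^ 2 ≤ a.dim ^ 2 * ∑ b ∈ R, ‖ξ b‖ ^ 2 := by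
  classical
  -- Enlarging `S` until it contains the support of a ξ turns the partial sum into the full squared
  -- norm.
  obtain ⟨S', hS, hS'⟩ : ∃ S' : Finset (Irr C), S ⊆ S' ∧ ∀ b ∈ R, irrSupport (a.obj ⊗ b.obj) ⊆ S' :=
    ⟨S ∪ R.biUnion fun b => irrSupport (a.obj ⊗ b.obj), Finset.subset_union_left, fun b hb =>
      (Finset.subset_biUnion_of_mem (fun b => irrSupport (a.obj ⊗ b.obj)) hb).trans
        Finset.subset_union_right⟩
  refine (Finset.sum_le_sum_of_subset_of_nonneg hS fun _ _ _ => by positivity).trans ?_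
  have h1 := (isCpMultiplier_regularCoeff R ξ).symbolFunctional_le (X := a.obj)
    (by rw [a.catDim_obj]; exact a.dim_pos)
  have h2 : symbolFunctional (regularCoeff R ξ) (objClass (conj a.obj ⊗ a.obj)) =
      ((∑ c ∈ S', ‖objectSum ξ (conj a.obj ⊗ c.obj)‖ ^ 2 : ℝ) : ℂ) := by
    have h3 : ∀ b ∈ R, ∀ b', ∑ c ∈ S', (mult b' (conj a.obj ⊗ c.obj) : ℂ) *
        mult b (conj a.obj ⊗ c.obj) = ∑ g ∈ irrSupport (conj a.obj ⊗ a.obj),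
          (mult g (conj a.obj ⊗ a.obj) : ℂ) * mult b' (g.obj ⊗ b.obj) := by
      intro b hb b'
      rw [← mult_tensor_left_eq b.obj b' subset_rfl, mult_congr b' (α_ _ _ _),
        mult_tensor_right_eq _ _ (hS' b hb)]
      refine Finset.sum_congr rfl fun c _ => ?_
      rw [mult_conj_tensor a.obj b c, mul_comm]
    rw [symbolFunctional_objClass _ subset_rfl]
    push_cast
    calc _ = ∑ g ∈ irrSupport (conj a.obj ⊗ a.obj), ∑ b ∈ R, ∑ b' ∈ R, star (ξ b') * ξ b *
          ((mult g (conj a.obj ⊗ a.obj) : ℂ) * mult b' (g.obj ⊗ b.obj)) := by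
          refine Finset.sum_congr rfl fun g _ => ?_
          have hd : (g.dim : ℂ) ≠ 0 := by exact_mod_cast g.dim_pos.ne'
          rw [regularCoeff, mul_inv_cancel_left₀ hd, Finset.mul_sum]
          refine Finset.sum_congr rfl fun b _ => ?_
          rw [Finset.mul_sum]
          exact Finset.sum_congr rfl fun b' _ => by ring
      _ = ∑ c ∈ S', ∑ b ∈ R, ∑ b' ∈ R, star (ξ b') * ξ b *
          ((mult b' (conj a.obj ⊗ c.obj) : ℂ) * mult b (conj a.obj ⊗ c.obj)) := by
          rw [Finset.sum_comm]
          conv_rhs => rw [Finset.sum_comm]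
          refine Finset.sum_congr rfl fun b hb => ?_
          rw [Finset.sum_comm]
          conv_rhs => rw [Finset.sum_comm]
          refine Finset.sum_congr rfl fun b' _ => ?_
          rw [← Finset.mul_sum, ← Finset.mul_sum, h3 b hb b']
      _ = _ := by
          refine Finset.sum_congr rfl fun c _ => ?_
          rw [← Complex.conj_mul', objectSum_eq_of_support hξ, map_sum, Finset.sum_mul_sum,
            Finset.sum_comm]
          refine Finset.sum_congr rfl fun b _ => Finset.sum_congr rfl fun b' _ => ?_
          rw [map_mul, Complex.conj_natCast, ← Complex.star_def]
          ring
  rw [h2, regularCoeff_unit, a.catDim_obj] at h1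
  exact_mod_cast h1

/-- Only finitely many coordinates of `ξ` enter a sum over `S`, so truncation reduces to finite
support. -/
theorem sum_norm_objectSum_le_norm (a : Irr C) (ξ : L2Irr C) (S : Finset (Irr C)) :
    ∑ c ∈ S, ‖objectSum ξ (conj a.obj ⊗ c.obj)‖ ^ 2 ≤ (a.dim * ‖ξ‖) ^ 2 := by
  classical
  let R := S.biUnion fun c => irrSupport (conj a.obj ⊗ c.obj)
  let ξ' : Irr C → ℂ := fun b => if b ∈ R then ξ b else 0
  have h := sum_norm_objectSum_le a (ξ := ξ') (R := R) (fun b hb => by simp [ξ', hb]) S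
  have h1 : ∀ c ∈ S, objectSum ξ' (conj a.obj ⊗ c.obj) = objectSum ξ (conj a.obj ⊗ c.obj) := by
    intro c hc
    refine Finset.sum_congr rfl fun i _ => ?_
    exact if_pos (Finset.mem_biUnion.2 ⟨c, hc, mem_irrSupport _ i⟩)
  rw [Finset.sum_congr rfl fun c hc => by rw [h1 c hc]] at h
  refine h.trans ?_
  rw [mul_pow]
  gcongr
  have h2 := lp.sum_rpow_le_norm_rpow (p := 2) (by norm_num) ξ R
  simp only [ENNReal.toReal_ofNat, Real.rpow_two] at h2
  refine le_trans (le_of_eq (Finset.sum_congr rfl fun b hb => ?_)) h2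
  simp [ξ', hb]

/-- The operators of the regular representation. -/
def regularOp (a : Irr C) : L2Irr C →L[ℂ] L2Irr C :=
  LinearMap.mkContinuous
    -- By Frobenius reciprocity the coordinate at `c` is a sum over the constituents of `conj a.obj
    -- ⊗ c.obj`, finite for every `ξ`.
    { toFun := fun ξ => ⟨fun c => objectSum ξ (conj a.obj ⊗ c.obj), memℓp_gen'
        (C := (a.dim * ‖ξ‖) ^ 2) fun S => by
          simpa using sum_norm_objectSum_le_norm a ξ S⟩
      map_add' := fun ξ η => lp.ext <| funext fun c => by
        change objectSum (fun c => ξ c + η c) _ = objectSum ξ _ + objectSum η _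
        simp [objectSum, Finset.sum_add_distrib]
      map_smul' := fun z ξ => lp.ext <| funext fun c => by
        simp [objectSum, Finset.mul_sum] }
    a.dim fun ξ => lp.norm_le_of_forall_sum_le (by norm_num)
      (mul_nonneg a.dim_pos.le (norm_nonneg _)) fun S => by
        simpa using sum_norm_objectSum_le_norm a ξ S

theorem regularOp_apply (a : Irr C) (ξ : L2Irr C) (c : Irr C) :
    regularOp a ξ c = objectSum ξ (conj a.obj ⊗ c.obj) := rfl

theorem lift_regularOp_objClass (X : C) (ξ : L2Irr C) (c : Irr C) :
    lift regularOp (objClass X) ξ c = objectSum ξ (conj X ⊗ c.obj) := by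
  rw [lift_objClass _ (irrDecomp X), sum_apply, lp.coeFn_sum,
    Finset.sum_apply]
  simp only [regularOp_apply]
  refine sum_objectSum _ _ _ _ fun b => ?_
  rw [mult_conj_tensor, (irrDecomp X).mult_tensor_left]
  simp only [mult_conj_tensor]

open Classical in
theorem regularOp_single (a b c : Irr C) :
    regularOp a (lp.single 2 b (1 : ℂ)) c = (mult c (a.obj ⊗ b.obj) : ℂ) := by
  rw [regularOp_apply, objectSum_eq_of_support (R := {b})]
  · rw [Finset.sum_singleton, lp.single_apply_self, mul_one, mult_conj_tensor]
  · intro c hc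
    rw [lp.single_apply_ne _ _ _ (by simpa using hc)]

open Classical in
theorem ext_of_single {S T : L2Irr C →L[ℂ] L2Irr C}
    (h : ∀ b c : Irr C, S (lp.single 2 b (1 : ℂ)) c = T (lp.single 2 b (1 : ℂ)) c) : S = T := by
  refine lp.ext_continuousLinearMap (by norm_num) fun b => ?_
  refine ContinuousLinearMap.ext_ring ?_
  exact lp.ext (funext fun c => h b c)

theorem lift_regularOp_star (a : Irr C) :
    lift regularOp (star (basisElt a)) = star (regularOp a) := by
  classical
  refine ext_of_single fun b c => ?_
  rw [star_basisElt, lift_regularOp_objClass, ContinuousLinearMap.star_eq_adjoint]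
  have h1 : (ContinuousLinearMap.adjoint (regularOp a) (lp.single 2 b (1 : ℂ))) c =
      inner ℂ (lp.single 2 c (1 : ℂ) : L2Irr C)
        (ContinuousLinearMap.adjoint (regularOp a) (lp.single 2 b (1 : ℂ))) := by
    rw [lp.inner_single_left]
    simp
  rw [h1, ContinuousLinearMap.adjoint_inner_right, lp.inner_single_right, regularOp_single,
    objectSum_eq_of_support (R := {b})]
  · rw [Finset.sum_singleton, lp.single_apply_self, mul_one, mult_conj_tensor, mult_conj_tensor]
    simp
  · intro c hc
    rw [lp.single_apply_ne _ _ _ (by simpa using hc)]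

variable (C) in
/-- The regular representation. -/
def regularRep : StarRep C (L2Irr C) where
  toLinearMap := lift regularOp
  map_one' := by
    classical
    refine ext_of_single fun b c => ?_
    change lift regularOp (basisElt (Irr.unit C)) _ _ = _
    rw [lift_basisElt, regularOp_single, mult_unit_tensor]
    simp [lp.single_apply, Pi.single_apply]
  map_mul' x y := by
    have h : ∀ a b, lift (regularOp (C := C)) (basisElt a * basisElt b) =
        regularOp a * regularOp b := by
      intro a b
      refine ContinuousLinearMap.ext fun ξ => lp.ext (funext fun c => ?_)
      rw [basisElt_mul_basisElt, lift_regularOp_objClass]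
      change _ = regularOp a (regularOp b ξ) c
      rw [regularOp_apply]
      refine (objectSum_congr (mult_conj_conj_tensor _ _ · _)).trans ?_
      exact (objectSum_objectSum ξ _ _).symm
    obtain ⟨S, r, rfl⟩ := eq_sum x
    obtain ⟨S', r', rfl⟩ := eq_sum y
    change lift regularOp _ = lift regularOp _ * lift regularOp _
    rw [mul_eq]
    simp only [map_sum, LinearMap.sum_apply, map_smul, LinearMap.smul_apply, ← mul_eq, h,
      lift_basisElt, Finset.sum_mul, Finset.mul_sum, smul_mul_assoc, mul_smul_comm,
      Finset.smul_sum]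
  map_star' x := by
    obtain ⟨S, r, rfl⟩ := eq_sum x
    change lift regularOp (starHom _) = star (lift regularOp _)
    simp only [map_sum, map_smul, star_sum, star_smul, map_smulₛₗ, lift_basisElt,
      ← lift_regularOp_star]
    rfl

theorem isRegular_regularRep : IsRegular (regularRep C) := by
  intro a b c
  change lift regularOp (basisElt a) _ _ = _
  rw [lift_basisElt]
  exact regularOp_single a b c

theorem IsRegular.eq_regularRep {Θ : StarRep C (L2Irr C)} (hΘ : IsRegular Θ) : Θ = regularRep C := by
  have h : Θ.toLinearMap = (regularRep C).toLinearMap := hom_ext fun a =>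
    ext_of_single fun b c => (hΘ a b c).trans (isRegular_regularRep a b c).symm
  cases Θ
  congr

open Classical in
theorem IsRegular.inner_eq_regularCoeff {Θ : StarRep C (L2Irr C)} (hΘ : IsRegular Θ) (a : Irr C)
    (S : Finset (Irr C)) (ξ : Irr C → ℂ) :
    ((catDim a.obj : ℝ) : ℂ)⁻¹ * inner ℂ (∑ c ∈ S, (lp.single 2 c (ξ c) : L2Irr C))
      (Θ (basisElt a) (∑ b ∈ S, (lp.single 2 b (ξ b) : L2Irr C))) = regularCoeff S ξ a := by
  rw [regularCoeff, a.catDim_obj]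
  congr 1
  rw [map_sum, inner_sum]
  refine Finset.sum_congr rfl fun b _ => ?_
  rw [sum_inner]
  refine Finset.sum_congr rfl fun c _ => ?_
  have h : (lp.single 2 b (ξ b) : L2Irr C) = ξ b • lp.single 2 b (1 : ℂ) := by
    rw [← lp.single_smul, smul_eq_mul, mul_one]
  rw [h, map_smul, inner_smul_right, lp.inner_single_left, hΘ a b c]
  simp
  ring

/-- Finitely supported vectors have cp coefficients; the partial sums of `ξ` converge, and
cp-multipliers are closed under pointwise limits. -/
theorem IsRegular.isAdmissible {Θ : StarRep C (L2Irr C)} (hΘ : IsRegular Θ) : Θ.IsAdmissible := by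
  classical
  intro ξ
  refine isCpMultiplier_of_tendsto (l := Filter.atTop)
    (fun S : Finset (Irr C) => isCpMultiplier_regularCoeff S ξ) fun a => ?_
  have h : Filter.Tendsto (fun S : Finset (Irr C) => ∑ b ∈ S, (lp.single 2 b (ξ b) : L2Irr C))
      Filter.atTop (nhds ξ) := lp.hasSum_single (by norm_num) ξ
  simp only [← hΘ.inner_eq_regularCoeff]
  exact (h.inner (((Θ (basisElt a)).continuous.tendsto ξ).comp h)).const_mul _

end RegularRepresentation

/-! ### Norm bounds for admissible representations, and the effect of amenability. -/

section Representations

variable {C : Type u} [Category.{v} C] [Preadditive C] [Linear ℂ C]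
  [MonoidalCategory C] [MonoidalPreadditive C] [MonoidalLinear ℂ C] [CStarTensorCategory C]
  [RigidCStarTensorCategory C]

variable {K : Type*} [NormedAddCommGroup K] [InnerProductSpace ℂ K] [CompleteSpace K]

/-- The matrix coefficient `α ↦ d(α)⁻¹ ⟨Θ(α) ξ, ξ⟩`. -/
def StarRep.coeff (Θ : StarRep C K) (ξ : K) (a : Irr C) : ℂ :=
  ((catDim a.obj : ℝ) : ℂ)⁻¹ * inner ℂ ξ (Θ (basisElt a) ξ)

theorem StarRep.coeff_unit (Θ : StarRep C K) (ξ : K) :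
    Θ.coeff ξ (Irr.unit C) = ((‖ξ‖ ^ 2 : ℝ) : ℂ) := by
  have h : Θ (basisElt (Irr.unit C)) = 1 := Θ.map_one'
  rw [StarRep.coeff, Irr.catDim_obj, Irr.dim_unit, h]
  simp [inner_self_eq_norm_sq_to_K]

theorem StarRep.symbolFunctional_coeff (Θ : StarRep C K) (ξ : K) (x : FusionAlgebra C) :
    symbolFunctional (Θ.coeff ξ) x = inner ℂ ξ (Θ x ξ) := by
  let f : FusionAlgebra C →ₗ[ℂ] ℂ :=
    { toFun := fun x => inner ℂ ξ (Θ x ξ)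
      map_add' := fun x y => by
        rw [Θ.map_add', add_apply, inner_add_right]
      map_smul' := fun c x => by
        rw [Θ.map_smul', smul_apply, inner_smul_right]
        rfl }
  have h : symbolFunctional (Θ.coeff ξ) = f := hom_ext fun a => by
    have hd : (a.dim : ℂ) ≠ 0 := by exact_mod_cast a.dim_pos.ne'
    rw [symbolFunctional, lift_basisElt, StarRep.coeff, a.catDim_obj, mul_inv_cancel_left₀ hd]
    rfl
  rw [h]
  rfl

theorem StarRep.symbolFunctional_coeff_star_mul (Θ : StarRep C K) (ξ : K) (x : FusionAlgebra C) :
    symbolFunctional (Θ.coeff ξ) (star x * x) = ((‖Θ x ξ‖ ^ 2 : ℝ) : ℂ) := by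
  rw [StarRep.symbolFunctional_coeff, Θ.map_mul', Θ.map_star', mul_apply_eq_comp,
    ContinuousLinearMap.star_eq_adjoint, ContinuousLinearMap.adjoint_inner_right,
    inner_self_eq_norm_sq_to_K]
  simp

/-- For the coefficient of ξ, the inequality of `IsCpMultiplier.symbolFunctional_le` reads ‖Θ(a) ξ‖²
≤ d(a)² ‖ξ‖². -/
theorem StarRep.IsAdmissible.norm_basisElt_le {Θ : StarRep C K} (hΘ : Θ.IsAdmissible) (a : Irr C) :
    ‖Θ (basisElt a)‖ ≤ a.dim := by
  refine ContinuousLinearMap.opNorm_le_bound _ a.dim_pos.le fun ξ => ?_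
  have h := IsCpMultiplier.symbolFunctional_le (φ := Θ.coeff ξ) (hΘ ξ) (X := a.obj)
    (by rw [a.catDim_obj]; exact a.dim_pos)
  rw [← objClass_mul_basisElt, ← star_basisElt, Θ.symbolFunctional_coeff_star_mul, Θ.coeff_unit,
    a.catDim_obj] at h
  have h' : ‖Θ (basisElt a) ξ‖ ^ 2 ≤ a.dim ^ 2 * ‖ξ‖ ^ 2 := by exact_mod_cast h
  rw [← mul_pow] at h'
  exact le_of_sq_le_sq h' (mul_nonneg a.dim_pos.le (norm_nonneg _))

theorem StarRep.IsAdmissible.norm_sum_le {Θ : StarRep C K} (hΘ : Θ.IsAdmissible)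
    {ι : Type*} (S : Finset ι) (r : ι → ℂ) (c : ι → Irr C) :
    ‖Θ (∑ i ∈ S, r i • basisElt (c i))‖ ≤ ∑ i ∈ S, ‖r i‖ * (c i).dim := by
  change ‖Θ.toLinearMap (∑ i ∈ S, r i • basisElt (c i))‖ ≤ _
  rw [map_sum]
  refine (_root_.norm_sum_le _ _).trans (Finset.sum_le_sum fun i _ => ?_)
  rw [map_smul, norm_smul]
  exact mul_le_mul_of_nonneg_left (hΘ.norm_basisElt_le (c i)) (norm_nonneg _)

theorem StarRep.IsAdmissible.norm_objClass_le {Θ : StarRep C K} (hΘ : Θ.IsAdmissible) (X : C) :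
    ‖Θ (objClass X)‖ ≤ catDim X := by
  have h := hΘ.norm_sum_le Finset.univ (fun _ => 1) (irrDecomp X).c
  simp only [one_smul, ← (irrDecomp X).objClass_eq, norm_one, one_mul,
    ← (irrDecomp X).catDim_eq] at h
  exact h

/-- The bound ∑ ‖r a‖ d(a) is the same for all admissible representations. -/
theorem exists_universal (x : FusionAlgebra C) : ∃ T : universalCStar C,
    ∀ π : AdmissibleRep C, (T : AdmissibleRep.Prod C) π = π.rep x := by
  obtain ⟨S, r, hx⟩ := eq_sum x
  let T : AdmissibleRep.Prod C := ⟨fun π => π.rep x, memℓp_infty ⟨∑ a ∈ S, ‖r a‖ * a.dim, by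
    rintro _ ⟨π, rfl⟩
    simp only [hx]
    exact π.admissible.norm_sum_le S r id⟩⟩
  exact ⟨⟨T, (universalRange C).le_topologicalClosure ⟨x, fun π => rfl⟩⟩, fun π => rfl⟩

theorem exists_norm_sub_eq_star_mul_self {A : Type*} [CStarAlgebra A] {b : A}
    (hb : IsSelfAdjoint b) : ∃ y, algebraMap ℝ A ‖b‖ - b = star y * y := by
  let _ : PartialOrder A := CStarAlgebra.spectralOrder A
  have _ : StarOrderedRing A := CStarAlgebra.spectralOrderedRing A
  exact CStarAlgebra.nonneg_iff_eq_star_mul_self.1 (sub_nonneg.2 hb.le_algebraMap_norm_self)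

/-- A positive functional on a dense *-subalgebra of a C*-algebra that is bounded satisfies
`ω(x* x) ≤ ‖x‖² ω(1)`. -/
theorem StarRep.functional_le (Θ : StarRep C K) (Ω : (K →L[ℂ] K) →L[ℂ] ℂ)
    (h : ∀ x, 0 ≤ Ω (Θ (star x * x))) (x : FusionAlgebra C) :
    Ω (Θ (star x * x)) ≤ ((‖Θ x‖ ^ 2 : ℝ) : ℂ) * Ω 1 := by
  have hcl : IsClosed (Θ.cstar : Set (K →L[ℂ] K)) := Θ.range.isClosed_topologicalClosure
  have hpos : ∀ y ∈ Θ.cstar, 0 ≤ Ω (star y * y) := by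
    intro y hy
    have hy' : y ∈ closure (Θ.range : Set (K →L[ℂ] K)) := hy
    refine closure_minimal (t := {y | 0 ≤ Ω (star y * y)}) ?_ ?_ hy'
    · rintro _ ⟨z, rfl⟩
      have := h z
      rwa [Θ.map_mul', Θ.map_star'] at this
    · exact isClosed_le continuous_const (by fun_prop)
  have hxm : Θ x ∈ Θ.cstar := Θ.range.le_topologicalClosure ⟨x, rfl⟩
  let b : Θ.cstar := star ⟨Θ x, hxm⟩ * ⟨Θ x, hxm⟩
  have hb : IsSelfAdjoint b := IsSelfAdjoint.star_mul_self _
  -- The square root `y` of ‖b‖ - b lies in the closure and in general not in the image of the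
  -- fusion algebra; positivity of `Ω` was extended to the closure for this reason.
  obtain ⟨y, hy⟩ := exists_norm_sub_eq_star_mul_self hb
  have h1 := congrArg (Subtype.val : Θ.cstar → (K →L[ℂ] K)) hy
  have h2 := hpos y y.2
  have h3 : ‖b‖ = ‖Θ x‖ ^ 2 := by
    rw [CStarRing.norm_star_mul_self, sq]
    rfl
  have h4 : ((‖Θ x‖ ^ 2 : ℝ) : ℂ) • 1 - star (Θ x) * Θ x = star (y : K →L[ℂ] K) * y := by
    rw [← h3]
    exact h1
  rw [← h4, map_sub, map_smul, smul_eq_mul, sub_nonneg] at h2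
  rwa [Θ.map_mul', Θ.map_star']

/-- Since Θ(a) δ_ε = δ_a, finite support makes the functional equal to x ↦ ⟨η, Θ(x) δ_ε⟩ with η the
conjugate of d φ. It is thus norm continuous, and `StarRep.functional_le` applies. -/
theorem IsRegular.symbolFunctional_le {Θ : StarRep C (L2Irr C)} (hΘ : IsRegular Θ)
    {φ : Irr C → ℂ} (hφ : IsCpMultiplier φ) (hfin : (Function.support φ).Finite)
    (x : FusionAlgebra C) :
    symbolFunctional φ (star x * x) ≤ ((‖Θ x‖ ^ 2 : ℝ) : ℂ) * φ (Irr.unit C) := by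
  classical
  let δ : L2Irr C := lp.single 2 (Irr.unit C) (1 : ℂ)
  let η : L2Irr C := ∑ a ∈ hfin.toFinset, lp.single 2 a (star ((a.dim : ℂ) * φ a))
  let Ω : (L2Irr C →L[ℂ] L2Irr C) →L[ℂ] ℂ :=
    (innerSL ℂ η).comp (ContinuousLinearMap.apply ℂ (L2Irr C) δ)
  have hΩ : ∀ x, Ω (Θ x) = symbolFunctional φ x := by
    have h : Ω.toLinearMap ∘ₗ Θ.toLinearMap = symbolFunctional φ := hom_ext fun a => by
      rw [symbolFunctional, lift_basisElt]
      change inner ℂ η (Θ (basisElt a) δ) = _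
      have h1 : Θ (basisElt a) δ = lp.single 2 a (1 : ℂ) := lp.ext <| funext fun c => by
        rw [hΘ a (Irr.unit C) c, mult_tensor_unit, lp.single_apply, Pi.single_apply]
        split_ifs <;> simp
      rw [h1, lp.inner_single_right]
      have h2 : η a = star ((a.dim : ℂ) * φ a) := by
        simp only [η, lp.coeFn_sum, Finset.sum_apply, lp.single_apply, Pi.single_apply]
        rw [Finset.sum_ite_eq]
        split_ifs with h
        · rfl
        · have : φ a = 0 := by simpa using h
          simp [this]
      rw [h2]
      simp
    exact fun x => LinearMap.congr_fun h x
  have h := Θ.functional_le Ω (fun x => by rw [hΩ]; exact hφ.symbolFunctional_nonneg x) x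
  have h1 : Ω 1 = φ (Irr.unit C) := by
    have : Θ (basisElt (Irr.unit C)) = 1 := Θ.map_one'
    rw [← this, hΩ, symbolFunctional, lift_basisElt, Irr.dim_unit]
    simp
  rwa [hΩ, h1] at h

/-- The coefficient of `ξ` multiplied by `φ i` is a finitely supported cp-multiplier, so its
functional is controlled by ‖Θ(x)‖²; the limit along the net gives ‖π(x) ξ‖² ≤ ‖Θ(x)‖² ‖ξ‖². -/
theorem IsRegular.norm_le_of_isAmenable {Θ : StarRep C (L2Irr C)} (hΘ : IsRegular Θ)
    (hC : IsAmenable C) {π : StarRep C K} (hπ : π.IsAdmissible) (x : FusionAlgebra C) :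
    ‖π x‖ ≤ ‖Θ x‖ := by
  obtain ⟨ι, _, _, _, φ, hφ, hlim⟩ := hC
  refine ContinuousLinearMap.opNorm_le_bound _ (norm_nonneg _) fun ξ => ?_
  have h1 : ∀ i, symbolFunctional (fun a => φ i a * π.coeff ξ a) (star x * x) ≤
      ((‖Θ x‖ ^ 2 : ℝ) : ℂ) * (φ i (Irr.unit C) * π.coeff ξ (Irr.unit C)) := fun i =>
    hΘ.symbolFunctional_le (IsCpMultiplier.mul (hφ i).2 (hπ ξ))
      ((hφ i).1.subset (Function.support_mul_subset_left _ _)) x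
  have h2 : ∀ y, Filter.Tendsto (fun i => symbolFunctional (fun a => φ i a * π.coeff ξ a) y)
      Filter.atTop (nhds (symbolFunctional (π.coeff ξ) y)) := by
    intro y
    obtain ⟨S, r, rfl⟩ := eq_sum y
    simp only [map_sum, map_smul, symbolFunctional, lift_basisElt]
    refine tendsto_finsetSum _ fun a _ => (Filter.Tendsto.const_mul _ ?_).const_smul _
    simpa using (hlim a).mul_const (π.coeff ξ a)
  have h3 := le_of_tendsto_of_tendsto' (h2 (star x * x))
    (((hlim (Irr.unit C)).mul_const (π.coeff ξ (Irr.unit C))).const_mul _) h1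
  rw [π.symbolFunctional_coeff_star_mul, one_mul, π.coeff_unit] at h3
  have h4 : ‖π x ξ‖ ^ 2 ≤ ‖Θ x‖ ^ 2 * ‖ξ‖ ^ 2 := by exact_mod_cast h3
  rw [← mul_pow] at h4
  exact le_of_sq_le_sq h4 (by positivity)

end Representations

/-! ### The implications between the four conditions. -/

section Amenability

variable {C : Type u} [Category.{v} C] [Preadditive C] [Linear ℂ C]
  [MonoidalCategory C] [MonoidalPreadditive C] [MonoidalLinear ℂ C] [CStarTensorCategory C]
  [RigidCStarTensorCategory C]

/-- If an admissible representation dominates all others, then it is universal. -/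
theorem naturalHom_bijective (π : AdmissibleRep C)
    (h : ∀ (π' : AdmissibleRep C) (x : FusionAlgebra C), ‖π'.rep x‖ ≤ ‖π.rep x‖) :
    Function.Bijective (naturalHom π) := by
  have hcont : Continuous (evalHom π) :=
    (lp.evalCLM ℂ (fun π : AdmissibleRep C => π.K →L[ℂ] π.K) ∞ π).continuous
  -- Domination makes evaluation at `π` isometric on the dense image of the fusion algebra, hence on
  -- the closure. Its range is then closed and contains the image of the fusion algebra under `π`.
  have hnorm : ∀ T ∈ universalCStar C, ‖evalHom π T‖ = ‖T‖ := by
    intro T hT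
    have hT' : T ∈ closure (universalRange C : Set (AdmissibleRep.Prod C)) := hT
    refine le_antisymm (lp.norm_apply_le_norm ENNReal.top_ne_zero T π) ?_
    refine closure_minimal (t := {T | ‖T‖ ≤ ‖evalHom π T‖}) ?_ ?_ hT'
    · rintro S ⟨x, hx⟩
      refine lp.norm_le_of_forall_le (norm_nonneg _) fun π' => ?_
      change _ ≤ ‖S π‖
      rw [hx, hx]
      exact h π' x
    · exact isClosed_le continuous_norm hcont.norm
  have hiso : Isometry fun T : universalCStar C => (naturalHom π T : π.K →L[ℂ] π.K) :=
    Isometry.of_dist_eq fun S T => by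
      change dist (evalHom π S) (evalHom π T) = dist (S : AdmissibleRep.Prod C) T
      rw [dist_eq_norm, dist_eq_norm, ← map_sub, hnorm _ (sub_mem S.2 T.2)]
  refine ⟨fun S T hST => hiso.injective (congrArg Subtype.val hST), fun S => ?_⟩
  have hcl : IsClosed (universalCStar C : Set (AdmissibleRep.Prod C)) :=
    (universalRange C).isClosed_topologicalClosure
  have : CompleteSpace (universalCStar C) := hcl.completeSpace_coe
  have hr : IsClosed (Set.range fun T : universalCStar C => (naturalHom π T : π.K →L[ℂ] π.K)) :=
    hiso.isClosedEmbedding.isClosed_range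
  have hS : (S : π.K →L[ℂ] π.K) ∈ closure (π.rep.range : Set (π.K →L[ℂ] π.K)) := S.2
  obtain ⟨T, hT⟩ := closure_minimal (by
    rintro _ ⟨x, rfl⟩
    obtain ⟨T, hT⟩ := exists_universal x
    exact ⟨T, hT π⟩) hr hS
  exact ⟨T, Subtype.ext hT⟩

theorem trivialRep_eq (x : FusionAlgebra C) : trivialRep x = lift (fun a => (a.dim : ℂ)) x := by
  rw [lift_apply, trivialRep]
  simp only [Irr.catDim_obj, smul_eq_mul]

theorem trivialRep_objClass (X : C) : trivialRep (objClass X) = catDim X := by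
  rw [trivialRep_eq, lift_objClass _ (irrDecomp X), (irrDecomp X).catDim_eq]
  push_cast
  rfl

theorem catDim_conj (X : C) : catDim (conj X) = catDim X :=
  (catDim_eq_of_pairing (conjPairing X)).symm

theorem trivialRep_mul (x y : FusionAlgebra C) :
    trivialRep (x * y) = trivialRep x * trivialRep y := by
  obtain ⟨S, r, rfl⟩ := eq_sum x
  obtain ⟨S', r', rfl⟩ := eq_sum y
  have h : ∀ a b : Irr C, lift (fun a => (a.dim : ℂ)) (basisElt a * basisElt b) = a.dim * b.dim := by
    intro a b
    rw [basisElt_mul_basisElt, ← trivialRep_eq, trivialRep_objClass, catDim_tensor, a.catDim_obj,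
      b.catDim_obj]
    push_cast
    rfl
  rw [trivialRep_eq, trivialRep_eq, trivialRep_eq, mul_eq]
  simp only [map_sum, LinearMap.sum_apply, map_smul, LinearMap.smul_apply, ← mul_eq, h,
    lift_basisElt, Finset.sum_mul, Finset.mul_sum, smul_mul_assoc, mul_smul_comm,
    Finset.smul_sum]

theorem trivialRep_star (x : FusionAlgebra C) : trivialRep (star x) = star (trivialRep x) := by
  obtain ⟨S, r, rfl⟩ := eq_sum x
  rw [trivialRep_eq, trivialRep_eq]
  change lift _ (starHom _) = _
  have h : ∀ a : Irr C, lift (fun a => (a.dim : ℂ)) (starHom (basisElt a)) = a.dim := by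
    intro a
    change lift _ (star (basisElt a)) = _
    rw [star_basisElt, ← trivialRep_eq, trivialRep_objClass, catDim_conj, a.catDim_obj]
  simp only [map_sum, map_smul, map_smulₛₗ, h, lift_basisElt, star_sum, star_smul]
  simp

theorem trivialRep_one : trivialRep (1 : FusionAlgebra C) = 1 := by
  change trivialRep (basisElt (Irr.unit C)) = 1
  rw [trivialRep_eq, lift_basisElt, Irr.dim_unit, Complex.ofReal_one]

variable (C) in
/-- The trivial representation as a representation on a one-dimensional Hilbert space. -/
def trivialStarRep : StarRep C (EuclideanSpace ℂ PUnit.{u + 1}) where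
  toFun x := trivialRep x • 1
  map_add' x y := by simp only [trivialRep_eq, map_add, add_smul]
  map_smul' c x := by
    simp only [trivialRep_eq, map_smul, smul_eq_mul, mul_smul, RingHom.id_apply]
  map_one' := by
    rw [trivialRep_one, one_smul]
  map_mul' x y := by
    rw [trivialRep_mul, smul_mul_smul_comm, one_mul]
  map_star' x := by
    rw [trivialRep_star, star_smul, star_one]

theorem trivialStarRep_apply (x : FusionAlgebra C) : trivialStarRep C x = trivialRep x • 1 := rfl

theorem norm_trivialStarRep (x : FusionAlgebra C) : ‖trivialStarRep C x‖ = ‖trivialRep x‖ := by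
  rw [trivialStarRep_apply, norm_smul, norm_one, mul_one]

/-- The dimensions cancel, so the coefficients are the constants ‖ξ‖². -/
theorem trivialStarRep_isAdmissible : (trivialStarRep C).IsAdmissible := by
  intro ξ
  have h : (fun a : Irr C => ((catDim a.obj : ℝ) : ℂ)⁻¹ *
      inner ℂ ξ (trivialStarRep C (basisElt a) ξ)) = fun _ => ((‖ξ‖ ^ 2 : ℝ) : ℂ) := by
    funext a
    have hd : (a.dim : ℂ) ≠ 0 := by exact_mod_cast a.dim_pos.ne'
    rw [trivialStarRep_apply, trivialRep_eq, lift_basisElt, a.catDim_obj, smul_apply,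
      inner_smul_right, inv_mul_cancel_left₀ hd]
    simp [inner_self_eq_norm_sq_to_K]
  rw [h]
  exact isCpMultiplier_const (sq_nonneg _)

variable (C) in
/-- The trivial representation as an admissible representation. -/
def trivialAdmissibleRep : AdmissibleRep C where
  K := EuclideanSpace ℂ PUnit.{u + 1}
  rep := trivialStarRep C
  admissible := trivialStarRep_isAdmissible

/-- An injective *-homomorphism of C*-algebras is isometric, so the norm in `π` is the universal
one, which dominates the coordinate of the trivial representation. -/
theorem norm_trivialRep_le_of_injective (π : AdmissibleRep C)
    (h : Function.Injective (naturalHom π)) (x : FusionAlgebra C) : ‖trivialRep x‖ ≤ ‖π.rep x‖ := by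
  obtain ⟨T, hT⟩ := exists_universal x
  have h1 : IsClosed (universalCStar C : Set (AdmissibleRep.Prod C)) :=
    (universalRange C).isClosed_topologicalClosure
  have h2 : IsClosed (π.rep.cstar : Set (π.K →L[ℂ] π.K)) :=
    π.rep.range.isClosed_topologicalClosure
  have hn : ‖naturalHom π T‖ = ‖T‖ := NonUnitalStarAlgHom.norm_map (naturalHom π) h T
  have h3 : ‖naturalHom π T‖ = ‖π.rep x‖ := congrArg norm (hT π)
  have h4 : ‖(T : AdmissibleRep.Prod C) (trivialAdmissibleRep C)‖ ≤ ‖T‖ :=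
    lp.norm_apply_le_norm ENNReal.top_ne_zero (T : AdmissibleRep.Prod C) _
  have h5 : ‖(T : AdmissibleRep.Prod C) (trivialAdmissibleRep C)‖ = ‖trivialRep x‖ := by
    rw [hT]
    exact norm_trivialStarRep x
  rw [← h3, hn, ← h5]
  exact h4

theorem objClass_eq_of_directSum {X : C} {ι : Type*} [Fintype ι] {c : ι → Irr C}
    (p : ∀ i, (c i).obj ⟶ X) (h1 : ∀ i, p i ≫ dagger (p i) = 𝟙 _)
    (h3 : ∑ i, dagger (p i) ≫ p i = 𝟙 X) : objClass X = ∑ i, basisElt (c i) := by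
  classical
  refine Finsupp.ext fun a => ?_
  refine (mult_eq_sum_of_directSum a p h1 h3).trans ?_
  rw [show (∑ i, basisElt (c i) : FusionAlgebra C)
    = ∑ i, (Finsupp.single (c i) (1 : ℂ) : Irr C →₀ ℂ) from rfl, Finsupp.finsetSum_apply]
  refine Finset.sum_congr rfl fun i _ => ?_
  rw [Finsupp.single_apply, mult_obj]
  simp only [eq_comm (a := a)]
  split_ifs <;> simp

/-- For every finite set of irreducible objects there is an object that is the direct sum of the
unit and these objects. -/
theorem exists_objClass_eq (F : Finset (Irr C)) : ∃ X : C,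
    objClass X = 1 + ∑ a ∈ F, basisElt a ∧ catDim X = 1 + ∑ a ∈ F, a.dim := by
  let c : Option F → Irr C := fun i => i.elim (Irr.unit C) Subtype.val
  obtain ⟨X, p, h1, -, h3⟩ := exists_directSum_fintype fun i => (c i).obj
  have h : objClass X = 1 + ∑ a ∈ F, basisElt a := by
    rw [objClass_eq_of_directSum p h1 h3, Fintype.sum_option, ← Finset.sum_coe_sort F]
    rfl
  refine ⟨X, h, ?_⟩
  have h2 := trivialRep_objClass X
  rw [h, trivialRep_eq, map_add, map_sum, ← trivialRep_eq, trivialRep_one] at h2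
  simp only [lift_basisElt] at h2
  exact_mod_cast h2.symm

theorem norm_one_sub_sq_le {z : ℂ} (hz : ‖z‖ ≤ 1) : ‖1 - z‖ ^ 2 ≤ 2 * (1 - z.re) := by
  have h1 : ‖1 - z‖ ^ 2 = (1 - z.re) ^ 2 + z.im ^ 2 := by
    rw [Complex.sq_norm, Complex.normSq_apply]
    simp
    ring
  have h2 : z.re ^ 2 + z.im ^ 2 ≤ 1 := by
    have h3 : ‖z‖ ^ 2 = z.re ^ 2 + z.im ^ 2 := by
      rw [Complex.sq_norm, Complex.normSq_apply]
      ring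
    rw [← h3]
    exact pow_le_one₀ (norm_nonneg _) hz
  rw [h1]
  linarith

/-- Quantitative strict convexity. Expanding ‖ζ + η‖² gives Re⟨ζ, η⟩ ≥ d - δ(1 + d), and a point of
the closed unit disc with real part near 1 is itself near 1. -/
theorem one_sub_re_inner_le {K : Type*} [NormedAddCommGroup K] [InnerProductSpace ℂ K] {ζ η : K}
    {d δ : ℝ} (hd : 0 < d) (hδ : 0 < δ) (hδ1 : δ ≤ 1) (hζ : ‖ζ‖ ≤ 1) (hη : ‖η‖ ≤ d)
    (h : 1 + d - δ ≤ ‖ζ + η‖) : ‖1 - (d : ℂ)⁻¹ * inner ℂ ζ η‖ ^ 2 ≤ 2 * (δ * ((1 + d) / d)) := by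
  have h1 : ‖ζ + η‖ ^ 2 = ‖ζ‖ ^ 2 + 2 * (inner ℂ ζ η).re + ‖η‖ ^ 2 := norm_add_sq (𝕜 := ℂ) ζ η
  have h2 : (1 + d - δ) ^ 2 ≤ ‖ζ + η‖ ^ 2 := pow_le_pow_left₀ (by linarith) h 2
  have h3 : ‖ζ‖ ^ 2 ≤ 1 := pow_le_one₀ (norm_nonneg _) hζ
  have h4 : ‖η‖ ^ 2 ≤ d ^ 2 := pow_le_pow_left₀ (norm_nonneg _) hη 2
  have h5 : ‖inner ℂ ζ η‖ ≤ d := (norm_inner_le_norm ζ η).trans (by nlinarith [norm_nonneg ζ])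
  have hz : ‖(d : ℂ)⁻¹ * inner ℂ ζ η‖ ≤ 1 := by
    rw [norm_mul, norm_inv, Complex.norm_real, Real.norm_of_nonneg hd.le]
    exact inv_mul_le_one_of_le₀ h5 hd.le
  refine (norm_one_sub_sq_le hz).trans ?_
  have h6 : ((d : ℂ)⁻¹ * inner ℂ ζ η).re = d⁻¹ * (inner ℂ ζ η).re := by
    rw [← Complex.ofReal_inv, Complex.re_ofReal_mul]
  have h7 : d - δ * (1 + d) ≤ (inner ℂ ζ η).re := by nlinarith
  rw [h6]
  have h8 := mul_le_mul_of_nonneg_left h7 (inv_pos.2 hd).le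
  have h9 : d⁻¹ * (d - δ * (1 + d)) = 1 - δ * ((1 + d) / d) := by
    field_simp
  linarith

/-- A vector that almost attains the maximal norm of the sum over the unit and `F` must have all its
images almost maximal and aligned with the image under the unit, which is the vector itself.
Including the unit makes self-adjointness of the object unnecessary. -/
theorem IsRegular.exists_almost_invariant {Θ : StarRep C (L2Irr C)} (hΘ : IsRegular Θ)
    (h : ∀ X : C, ‖Θ (objClass X)‖ = catDim X) (F : Finset (Irr C)) {δ : ℝ} (hδ : 0 < δ) :
    ∃ (S : Finset (Irr C)) (ξ : Irr C → ℂ), ∀ a ∈ F, ‖1 - regularCoeff S ξ a‖ ≤ δ := by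
  classical
  obtain ⟨X, hX, hdim⟩ := exists_objClass_eq F
  let M : ℝ := 1 + ∑ a ∈ F, (1 + a.dim) / a.dim
  have hpos : ∀ a : Irr C, 0 ≤ (1 + a.dim) / a.dim := fun a =>
    div_nonneg (by linarith [a.dim_pos]) a.dim_pos.le
  have hM : 0 < M := by
    have := Finset.sum_nonneg fun a (_ : a ∈ F) => hpos a
    simp only [M]
    linarith
  -- The bound by 1 keeps 1 + d(a) - δ' nonnegative, so that it can be squared; the other bound
  -- gives 2 δ' (1 + d(a)) / d(a) ≤ δ², because `M` dominates every (1 + d(a)) / d(a).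
  let δ' : ℝ := min 1 (δ ^ 2 / (2 * M))
  have hδ' : 0 < δ' := lt_min one_pos (by positivity)
  obtain ⟨η, hη1, hη2⟩ := (Θ (objClass X)).exists_lt_apply_of_lt_opNorm
    (show catDim X - δ' < ‖Θ (objClass X)‖ by rw [h]; linarith)
  -- By continuity the almost norming vector may be truncated to finite support.
  have hlim : Filter.Tendsto (fun S : Finset (Irr C) => ∑ b ∈ S, (lp.single 2 b (η b) : L2Irr C))
      Filter.atTop (nhds η) := lp.hasSum_single (by norm_num) η
  have e1 := hlim.norm.eventually_lt_const hη1
  have e2 := (((Θ (objClass X)).continuous.tendsto η).comp hlim).norm.eventually_const_lt hη2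
  obtain ⟨S, hS1, hS2⟩ := (e1.and e2).exists
  refine ⟨S, η, fun a ha => ?_⟩
  rw [← hΘ.inner_eq_regularCoeff, a.catDim_obj]
  set ζ : L2Irr C := ∑ b ∈ S, lp.single 2 b (η b) with hζ
  have hbd : ∀ b : Irr C, ‖Θ (basisElt b) ζ‖ ≤ b.dim := fun b =>
    ((Θ (basisElt b)).le_opNorm ζ).trans ((mul_le_mul (hΘ.isAdmissible.norm_basisElt_le b) hS1.le
      (norm_nonneg _) b.dim_pos.le).trans_eq (mul_one _))
  have hT : Θ (objClass X) ζ = (ζ + Θ (basisElt a) ζ) + ∑ b ∈ F.erase a, Θ (basisElt b) ζ := by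
    have h1 : Θ (objClass X) = 1 + ∑ b ∈ F, Θ (basisElt b) := by
      change Θ.toLinearMap (objClass X) = _
      rw [hX, map_add, map_sum]
      exact congrArg (· + _) Θ.map_one'
    rw [h1, add_apply, sum_apply, ← Finset.add_sum_erase F _ ha, add_assoc]
    rfl
  have hlow : 1 + a.dim - δ' ≤ ‖ζ + Θ (basisElt a) ζ‖ := by
    have h1 : ‖Θ (objClass X) ζ‖ ≤ ‖ζ + Θ (basisElt a) ζ‖ + ∑ b ∈ F.erase a, b.dim := by
      rw [hT]
      refine (norm_add_le _ _).trans (add_le_add le_rfl ?_)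
      exact (norm_sum_le _ _).trans (Finset.sum_le_sum fun b _ => hbd b)
    have h2 : catDim X - δ' < ‖Θ (objClass X) ζ‖ := hS2
    rw [hdim, ← Finset.add_sum_erase F _ ha] at h2
    linarith
  have key := one_sub_re_inner_le a.dim_pos hδ' (min_le_left _ _) hS1.le (hbd a) hlow
  refine le_of_sq_le_sq (key.trans ?_) hδ.le
  have h3 : (1 + a.dim) / a.dim ≤ M :=
    (Finset.single_le_sum (f := fun a : Irr C => (1 + a.dim) / a.dim) (fun a _ => hpos a) ha).trans
      (by simp [M])
  calc 2 * (δ' * ((1 + a.dim) / a.dim)) ≤ 2 * (δ ^ 2 / (2 * M) * M) :=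
        mul_le_mul_of_nonneg_left (mul_le_mul (min_le_right _ _) h3 (hpos a) (by positivity))
          two_pos.le
    _ = δ ^ 2 := by field_simp

/-- By Frobenius reciprocity only constituents of the finitely many objects `c.obj ⊗ b.dual`
contribute. -/
theorem finite_support_regularCoeff (S : Finset (Irr C)) (ξ : Irr C → ℂ) :
    (Function.support (regularCoeff S ξ)).Finite := by
  obtain ⟨F, -, hF⟩ := exists_finset_irrSupport (𝟙_ C) S fun b c => c.obj ⊗ b.dual
  refine F.finite_toSet.subset fun a ha => ?_
  by_contra hne
  refine ha ?_
  rw [regularCoeff, Finset.sum_eq_zero fun b hb => Finset.sum_eq_zero fun c hc => ?_, mul_zero]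
  rw [← mult_tensor_dual, mult_eq_zero_of_notMem (hF b hb c hc) hne, Nat.cast_zero, mul_zero]

theorem IsRegular.isAmenable {Θ : StarRep C (L2Irr C)} (hΘ : IsRegular Θ)
    (h : ∀ X : C, ‖Θ (objClass X)‖ = catDim X) : IsAmenable C := by
  classical
  -- The net is indexed by a finite set on which the coefficient is controlled together with the
  -- tolerance 1 / (n + 1).
  choose S ξ hS using fun i : Finset (Irr C) × ℕ =>
    hΘ.exists_almost_invariant h i.1 (δ := 1 / ((i.2 : ℝ) + 1)) (by positivity)
  refine ⟨Finset (Irr C) × ℕ, inferInstance, inferInstance, inferInstance,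
    fun i => regularCoeff (S i) (ξ i), fun i => ⟨finite_support_regularCoeff _ _,
      isCpMultiplier_regularCoeff _ _⟩, fun a => ?_⟩
  · rw [tendsto_iff_norm_sub_tendsto_zero]
    have h1 : Filter.Tendsto (fun i : Finset (Irr C) × ℕ => 1 / ((i.2 : ℝ) + 1)) Filter.atTop
        (nhds 0) := by
      rw [← Filter.prod_atTop_atTop_eq]
      exact tendsto_one_div_add_atTop_nhds_zero_nat.comp Filter.tendsto_snd
    refine squeeze_zero' (Filter.Eventually.of_forall fun _ => norm_nonneg _) ?_ h1
    filter_upwards [Filter.eventually_ge_atTop (({a} : Finset (Irr C)), 0)] with i hi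
    rw [norm_sub_rev]
    exact hS i a (hi.1 (Finset.mem_singleton_self a))

end Amenability

end CStarTensor

end

open CStarTensor in
/-- The universal *-representation `x ↦ (π(x))_π` is bounded, there is a unique *-representation
`Θ₀` given by the formula for the regular representation, it is admissible, and the four conditions
are equivalent. -/
theorem proposition5p3 (C : Type u) [Category.{v} C] [Preadditive C] [Linear ℂ C]
    [MonoidalCategory C] [MonoidalPreadditive C] [MonoidalLinear ℂ C]
    [CStarTensorCategory C] [RigidCStarTensorCategory C] :
    (∀ x : FusionAlgebra C, ∃ T : universalCStar C,
      ∀ π : AdmissibleRep C, (T : AdmissibleRep.Prod C) π = π.rep x) ∧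
    (∃! Θ₀ : StarRep C (L2Irr C), IsRegular Θ₀) ∧
    ∀ Θ₀ : StarRep C (L2Irr C), IsRegular Θ₀ →
      ∃ hΘ₀ : Θ₀.IsAdmissible,
        List.TFAE [
          IsAmenable C,
          Function.Bijective (naturalHom (AdmissibleRep.mk (L2Irr C) Θ₀ hΘ₀)),
          ∀ x : FusionAlgebra C, ‖trivialRep x‖ ≤ ‖Θ₀ x‖,
          ∀ X : C, ‖Θ₀ (objClass X)‖ = catDim X] := by
  refine ⟨exists_universal, ⟨regularRep C, isRegular_regularRep, fun Θ hΘ => hΘ.eq_regularRep⟩,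
    fun Θ hΘ => ⟨hΘ.isAdmissible, ?_⟩⟩
  tfae_have 1 → 2 := fun h => naturalHom_bijective _ fun π x =>
    hΘ.norm_le_of_isAmenable h π.admissible x
  tfae_have 2 → 3 := fun h x => norm_trivialRep_le_of_injective _ h.1 x
  tfae_have 3 → 4 := fun h X => le_antisymm (hΘ.isAdmissible.norm_objClass_le X) (by
    have h1 := h (objClass X)
    rwa [trivialRep_objClass, Complex.norm_real, Real.norm_of_nonneg (catDim_nonneg X)] at h1)
  tfae_have 4 → 1 := hΘ.isAmenable
  tfae_finish
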